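/- **Setting.** Let $A=\{0,1,\infty,x\}$ and $B=\{0,1,\infty,y,z\}$ be sets of labels, let $\iota:A\to B$ be the injection $0\mapsto0,\ 1\mapsto1,\ \infty\mapsto\infty,\ x\mapsto y$, and let $f$ be a degree-two branched covering of the sphere with critical values $\infty$ and $z$, with critical point $0\in A$, and with $f(0)=\infty$, $f(\infty)=1$, $f(1)=y$, $f(x)=0$ (the combinatorics of $\mathrm{Per}_4(0)^*$; under $\iota$, $A$ is the cycle $0\mapsto\infty\mapsto1\mapsto x\mapsto0$). A *rational curve* is a connected nodal curve whose components are projective lines and whose dual graph is a tree. It is *pre-stable* if it carries distinct labelled smooth points, and *stable* if moreover each component has at least three distinguished points (nodes or marked points). The augmented moduli space $\mathcal{AM}_f$ is the set of isomorphism classes of finite degree-two maps $F:\mathcal C_U\to\mathcal C_L$ of rational curves, with $\mathcal C_U$ marked by $A$, $\mathcal C_L$ marked by $B$ and stable, such that $F$ restricts to $f|_A$ on the marked points, the nodes of $\mathcal C_U$ are exactly the points over the nodes of $\mathcal C_L$, the local degrees of $F$ on the two branches at each node of $\mathcal C_U$ agree, and away from the nodes $F$ ramifies exactly over the points labelled $\infty$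 and $z$. It is given the topology and algebraic structure defined by the cross ratios of the points of $F^{-1}(B)$ on $\mathcal C_U$ and of the points of $B$ on $\mathcal C_L$ (cross ratios being normalized by $[0,\infty;1,\lambda]=\lambda$ and computed, on a nodal curve, on the component on which the first three points have distinct projections). Let $\mathcal{AV}\subset\mathcal{AM}_f$ be the set of classes for which the stabilization of $(\mathcal C_U,A)$ and the stabilization of $(\mathcal C_L,\iota(A))$ are isomorphic as $A$-marked curves. For a partition of $B$ the corresponding stratum of $\mathcal{AM}_f$ consists of the classes for which two points of $B$ lie on the same component of $\mathcal C_L$ iff they lie in the same part. Let $\mathcal A_1$, $\mathcal A_2$ and $\mathcal A_{12}$ be the strata of $\{\infty,y,z\}\cup\{0,1\}$, of $\{0,1,z\}\cup\{y,\infty\}$ and of $\{0,1\}\cup\{z\}\cup\{y,\infty\}$. In $\mathbb P^1\times\mathbb P^1$ with coordinates $(x,y)$ let $\mathcal L$ be the union of the six lines $x,y\in\{0,1,\infty\}$, and let $\mathcal Z$ be the closure of the union of the affine curves $1-2x+x^2-y=0$, $x^2+y=1$, $x+y=1$ and $2xy+x^2-y-2x+1=0$. A point $(x,y)\notin\mathcal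 L\cup\mathcal Z$ is identified with the class in $\mathcal{AM}_f$ of the map $$F(t)=\frac{(t-x)(t-r)}{t^2},\qquad r=\frac{x+y-1}{x-1},$$ from $\mathbb P^1$ marked by $0,1,\infty,x$ to $\mathbb P^1$ marked by $0,1,\infty,y$ and $z=-\frac{(1-2x+x^2-y)^2}{4x(x-1)(x+y-1)}$. Let $\mathcal V=\{(x,y)\notin\mathcal L\cup\mathcal Z: x=y\}$. Let $\sigma:\widetilde{\mathbb P^1\times\mathbb P^1}\to\mathbb P^1\times\mathbb P^1$ be the composition of the blowup of $(0,0)$, $(1,1)$, $(\infty,\infty)$ and the blowup of the point $q$ at which the exceptional curve $E_\infty$ over $(\infty,\infty)$ meets the proper transform of $\{y=\infty\}$. Let $E_q$ be the exceptional curve over $q$, and write $E_\infty$ also for its proper transform. Let $u=y/x$, which is a coordinate on $E_\infty$, and $w=\frac{y-x}{x(x-1)}$, which is a coordinate on $E_q$. With hats denoting proper transforms, put $$X=(\widehat{\mathcal V}\cup E_\infty\cup E_q)\setminus\widehat{\mathcal L\cup\mathcal Z}.$$ **Lemma.** $X$ is connected. There are an embedding $\nu:\mathcal V\hookrightarrow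 X$ with $\sigma\circ\nu=\mathrm{id}$ and an embedding of algebraic sets $\xi:X\hookrightarrow\mathcal{AV}$ (a topological embedding that is regular, with regular inverse on its image) such that $\xi\circ\nu$ is the inclusion of $\mathcal V$ in $\mathcal{AV}\subset\mathcal{AM}_f$, and moreover: 1. $\xi$ maps $X\cap E_\infty\setminus E_q$ into $\mathcal A_1$; at the point with coordinate $u$ (where $u$ is finite and $u\ne0,-1$) the cross ratio $[0,\infty;y,z]$ on $\mathcal C_L$ is $-\dfrac{1}{4u(1+u)}$; 2. $\xi$ maps $X\cap E_q\setminus E_\infty$ into $\mathcal A_2$; at the point with coordinate $w$ (where $w$ is finite and nonzero) the cross ratio $[0,\infty;1,z]$ on $\mathcal C_L$ is $-\dfrac{(1-w)^2}{4w}$; 3. $\xi$ maps $X\cap E_\infty\cap E_q$ into $\mathcal A_{12}$. -/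

import Mathlib

open Topology Polynomial OnePoint

noncomputable section

namespace PerFour

/-! ### The projective line, cross ratios, rational maps -/

/-- The complex projective line. Its automorphisms are the maps `p ↦ g • p`, `g ∈ GL₂(ℂ)`. -/
abbrev P1 : Type := OnePoint ℂ

/-- The group whose elements act on `P1` as the Möbius transformations. -/
abbrev Moeb : Type := GL (Fin 2) ℂ

/-- The point `[n : d]` of the projective line. -/
def ratio (n d : ℂ) : P1 := if d = 0 then ∞ else ((n / d : ℂ) : P1)

/-- First homogeneous coordinate. -/
def hom0 : P1 → ℂ
  | ∞ => 1
  | OnePoint.some t => t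

/-- Second homogeneous coordinate. -/
def hom1 : P1 → ℂ
  | ∞ => 0
  | OnePoint.some _ => 1

/-- The determinant of the homogeneous coordinates of two points; it vanishes iff `p = q`. -/
def bracket (p q : P1) : ℂ := hom0 p * hom1 q - hom1 p * hom0 q

/-- The cross ratio `[a, b; c, d]`, normalized so that `[0, ∞; 1, d] = d`. It is meaningful as soon
as no three of the four points coincide. -/
def crossRatio (a b c d : P1) : P1 :=
  ratio (bracket a d * bracket b c) (bracket a c * bracket b d)

/-- A nonconstant rational map `P1 → P1`, in lowest terms. -/
structure RatMap where
  num : ℂ[X]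
  den : ℂ[X]
  coprime : IsCoprime num den
  pos : 0 < max num.natDegree den.natDegree

namespace RatMap

/-- The degree of a rational map. -/
def degree (F : RatMap) : ℕ := max F.num.natDegree F.den.natDegree

/-- The map `P1 → P1` given by a rational function. -/
def eval (F : RatMap) : P1 → P1
  | ∞ => ratio (F.num.coeff F.degree) (F.den.coeff F.degree)
  | OnePoint.some t => ratio (F.num.eval t) (F.den.eval t)

/-- The polynomial whose roots are the finite points of the fibre over a point. -/
def fibrePoly (F : RatMap) : P1 → ℂ[X]
  | ∞ => F.den
  | OnePoint.some c => F.num - C c * F.den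

/-- The local degree (ramification index) at a point. -/
def localDeg (F : RatMap) : P1 → ℕ
  | ∞ => F.degree - (F.fibrePoly (F.eval ∞)).natDegree
  | OnePoint.some t => (F.fibrePoly (F.eval t)).rootMultiplicity t

end RatMap

/-! ### Marked rational curves -/

/-- A rational nodal curve with marked points labelled by `A` (a pre-stable rational curve).
The irreducible components are copies of `P1` indexed by `Comp`; the dual graph is a tree;
`node v w` is the point of the component `v` at which it is glued to the point `node w v` of an
adjacent component `w` (the value is irrelevant if `v` and `w` are not adjacent).
The marked points are pairwise distinct and are not nodes. -/
structure MarkedCurve (A : Type) where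
  Comp : Type
  finite : Finite Comp
  graph : SimpleGraph Comp
  isTree : graph.IsTree
  node : Comp → Comp → P1
  node_inj : ∀ v w w', graph.Adj v w → graph.Adj v w' → node v w = node v w' → w = w'
  mark : A → Comp × P1
  mark_inj : Function.Injective mark
  mark_ne_node : ∀ a w, graph.Adj (mark a).1 w → (mark a).2 ≠ node (mark a).1 w

namespace MarkedCurve

variable {A B : Type}

/-- The distinguished points (nodes and marked points) on a component. -/
def special (C : MarkedCurve A) (v : C.Comp) : Set P1 :=
  {p | (∃ w, C.graph.Adj v w ∧ p = C.node v w) ∨ ∃ a, C.mark a = (v, p)}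

/-- A marked curve is stable if every component has at least three distinguished points. -/
def IsStable (C : MarkedCurve A) : Prop := ∀ v, 3 ≤ (C.special v).encard

/-- The vertex following `v` on the path from `v` to `w` in the dual graph. -/
def next (C : MarkedCurve A) (v w : C.Comp) : C.Comp :=
  (C.isTree.existsUnique_path v w).choose.snd

open Classical in
/-- The retraction of the curve onto its component `v`: points of `v` are fixed, and a point of any
other component goes to the node of `v` that separates it from `v`. -/
def proj (C : MarkedCurve A) (v : C.Comp) (p : C.Comp × P1) : P1 :=
  if p.1 = v then p.2 else C.node v (C.next v p.1)

/-- The component `v` on which the three marked points `a, b, c` have distinct projections. (For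
three different labels there is exactly one such component.) -/
def IsMedian (C : MarkedCurve A) (a b c : A) (v : C.Comp) : Prop :=
  C.proj v (C.mark a) ≠ C.proj v (C.mark b) ∧ C.proj v (C.mark a) ≠ C.proj v (C.mark c) ∧
    C.proj v (C.mark b) ≠ C.proj v (C.mark c)

open Classical in
/-- The cross ratio of four marked points of a nodal curve: it is computed, after projection, on the
component on which the first three of them become distinct. This is the value in
`P1 = M̄_{0,4}` of the map that forgets all other marked points and stabilizes. -/
def cross (C : MarkedCurve A) (a b c d : A) : P1 :=
  if h : ∃ v, C.IsMedian a b c v then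
    crossRatio (C.proj h.choose (C.mark a)) (C.proj h.choose (C.mark b))
      (C.proj h.choose (C.mark c)) (C.proj h.choose (C.mark d))
  else ∞

/-- Forget and relabel marked points along an injection of labels. -/
def relabel (C : MarkedCurve A) (i : B → A) (hi : Function.Injective i) : MarkedCurve B where
  Comp := C.Comp
  finite := C.finite
  graph := C.graph
  isTree := C.isTree
  node := C.node
  node_inj := C.node_inj
  mark := fun b => C.mark (i b)
  mark_inj := C.mark_inj.comp hi
  mark_ne_node := fun b => C.mark_ne_node (i b)

/-- `S` is the stabilization of `C`: `S` is stable, and it is obtained from `C` by keeping the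
components `e v` (up to automorphisms `g v` of the projective line) and contracting all other
components to points, carrying the marked points along. A marked point of `C` is seen from a
component that is kept as its projection to that component. -/
def IsStabilization (C S : MarkedCurve A) : Prop :=
  S.IsStable ∧ ∃ (e : S.Comp → C.Comp) (g : S.Comp → Moeb),
    ∀ v a, C.proj (e v) (C.mark a) = g v • S.proj v (S.mark a)

/-- An isomorphism of marked curves. -/
structure Iso (C C' : MarkedCurve A) where
  comp : C.graph ≃g C'.graph
  moeb : C.Comp → Moeb
  node_eq : ∀ v w, C.graph.Adj v w → C'.node (comp v) (comp w) = moeb v • C.node v w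
  mark_eq : ∀ a, C'.mark a = (comp (C.mark a).1, moeb (C.mark a).1 • (C.mark a).2)

end MarkedCurve

/-! ### The combinatorics of the map `f` -/

/-- Labels of the marked points of the source: the critical 4-cycle `0 ↦ ∞ ↦ 1 ↦ x ↦ 0`. -/
inductive LA | zero | one | inf | x

/-- Labels of the marked points of the target; `inf` and `z` are the critical values. -/
inductive LB | zero | one | inf | y | z

/-- Labels of the full preimage `f⁻¹(B)`: the four points of `A`, the second critical point `crit`,
and the second preimages `inf'`, `x'`, `one'` of `f(∞)`, `f(x)`, `f(1)`. -/
inductive LP | zero | one | inf | x | crit | inf' | x' | one'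

/-- The map `f` on `f⁻¹(B)`. -/
def LP.f : LP → LB
  | .zero => .inf
  | .one => .y
  | .inf => .one
  | .x => .zero
  | .crit => .z
  | .inf' => .one
  | .x' => .zero
  | .one' => .y

/-- The inclusion of `A` in `f⁻¹(B)`. -/
def LA.toLP : LA → LP
  | .zero => .zero
  | .one => .one
  | .inf => .inf
  | .x => .x

/-- The identification `ι : A → B`. -/
def LA.iota : LA → LB
  | .zero => .zero
  | .one => .one
  | .inf => .inf
  | .x => .y

theorem LA.toLP_injective : Function.Injective LA.toLP := by
  intro a b h; cases a <;> cases b <;> first | rfl | (simp [LA.toLP] at h)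

theorem LA.iota_injective : Function.Injective LA.iota := by
  intro a b h; cases a <;> cases b <;> first | rfl | (simp [LA.iota] at h)

/-! ### Augmented moduli space -/

/-- A pre-admissible covering `F : (𝒞_U, A) → (𝒞_L, B)` with the combinatorics of `f`: a finite map
of degree two of marked rational curves, `𝒞_L` being stable, such that the nodes of `𝒞_U` are exactly
the points over the nodes of `𝒞_L`, the local degrees on the two branches at each node agree,
and, away from the nodes, `F` ramifies exactly over the marked points `∞` and `z`, as `f` does.
Besides the points of `A`, the other points of `F⁻¹(B)` carry labels too; these are
determined by the labels of the points of `A`, since every fibre has two points counted with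
multiplicity. -/
structure Diagram where
  upper : MarkedCurve LP
  lower : MarkedCurve LB
  stable : lower.IsStable
  comp : upper.Comp → lower.Comp
  map : upper.Comp → RatMap
  degree_eq : ∀ a, ∑ᶠ v ∈ comp ⁻¹' {a}, (map v).degree = 2
  node_adj : ∀ v w, upper.graph.Adj v w → lower.graph.Adj (comp v) (comp w)
  node_map : ∀ v w, upper.graph.Adj v w →
    (map v).eval (upper.node v w) = lower.node (comp v) (comp w)
  node_preimage : ∀ v b p, lower.graph.Adj (comp v) b → (map v).eval p = lower.node (comp v) b →
    ∃ w, upper.graph.Adj v w ∧ comp w = b ∧ p = upper.node v w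
  balanced : ∀ v w, upper.graph.Adj v w →
    (map v).localDeg (upper.node v w) = (map w).localDeg (upper.node w v)
  mark_map : ∀ l, lower.mark l.f =
    (comp (upper.mark l).1, (map (upper.mark l).1).eval (upper.mark l).2)
  ramified : ∀ v p, (comp v, (map v).eval p) = lower.mark .inf ∨
    (comp v, (map v).eval p) = lower.mark .z → (map v).localDeg p = 2
  unramified : ∀ v p, (∀ w, upper.graph.Adj v w → p ≠ upper.node v w) →
    (comp v, (map v).eval p) ≠ lower.mark .inf → (comp v, (map v).eval p) ≠ lower.mark .z →
    (map v).localDeg p = 1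

/-- An isomorphism of diagrams. -/
structure Diagram.Iso (D D' : Diagram) where
  up : D.upper.Iso D'.upper
  low : D.lower.Iso D'.lower
  comp_eq : ∀ v, D'.comp (up.comp v) = low.comp (D.comp v)
  map_eq : ∀ v p, (D'.map (up.comp v)).eval (up.moeb v • p) =
    low.moeb (D.comp v) • (D.map v).eval p

/-! Isomorphism is an equivalence relation. -/

namespace MarkedCurve.Iso

variable {A : Type} {C C' C'' : MarkedCurve A}

def refl (C : MarkedCurve A) : C.Iso C where
  comp := SimpleGraph.Iso.refl
  moeb := fun _ => 1
  node_eq := by intro v w _; simp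
  mark_eq := by intro a; simp

def symm (φ : C.Iso C') : C'.Iso C where
  comp := φ.comp.symm
  moeb := fun v => (φ.moeb (φ.comp.symm v))⁻¹
  node_eq := by
    intro v w h
    have h' : C.graph.Adj (φ.comp.symm v) (φ.comp.symm w) := φ.comp.symm.map_adj_iff.2 h
    have := φ.node_eq _ _ h'
    simp only [RelIso.apply_symm_apply] at this
    rw [this, inv_smul_smul]
  mark_eq := by
    intro a
    rw [φ.mark_eq a]
    simp

def trans (φ : C.Iso C') (ψ : C'.Iso C'') : C.Iso C'' where
  comp := φ.comp.trans ψ.comp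
  moeb := fun v => ψ.moeb (φ.comp v) * φ.moeb v
  node_eq := by
    intro v w h
    have h' : C'.graph.Adj (φ.comp v) (φ.comp w) := φ.comp.map_adj_iff.2 h
    have := ψ.node_eq _ _ h'
    rw [φ.node_eq _ _ h] at this
    simpa [mul_smul] using this
  mark_eq := by
    intro a
    rw [ψ.mark_eq a, φ.mark_eq a]
    simp [mul_smul]

end MarkedCurve.Iso

instance Diagram.setoid : Setoid Diagram where
  r D D' := Nonempty (D.Iso D')
  iseqv :=
    { refl := fun D => ⟨⟨.refl _, .refl _, by intro v; rfl, by
        intro v p; simp [MarkedCurve.Iso.refl]⟩⟩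
      symm := by
        rintro D D' ⟨φ⟩
        refine ⟨⟨φ.up.symm, φ.low.symm, ?_, ?_⟩⟩
        · intro v
          have := φ.comp_eq (φ.up.comp.symm v)
          simp only [RelIso.apply_symm_apply] at this
          simp [MarkedCurve.Iso.symm, this]
        · intro v p
          have h1 := φ.comp_eq (φ.up.comp.symm v)
          have h2 := φ.map_eq (φ.up.comp.symm v) ((φ.up.moeb (φ.up.comp.symm v))⁻¹ • p)
          simp only [RelIso.apply_symm_apply, smul_inv_smul] at h1 h2
          simp [MarkedCurve.Iso.symm, h1, h2]
      trans := by
        rintro D D' D'' ⟨φ⟩ ⟨ψ⟩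
        refine ⟨⟨φ.up.trans ψ.up, φ.low.trans ψ.low, ?_, ?_⟩⟩
        · intro v
          simp [MarkedCurve.Iso.trans, ψ.comp_eq, φ.comp_eq]
        · intro v p
          simp [MarkedCurve.Iso.trans, mul_smul, ψ.map_eq, φ.map_eq, φ.comp_eq] }

/-- The augmented moduli space `𝒜ℳ_f`: isomorphism classes of diagrams. -/
def AMf : Type 1 := Quotient Diagram.setoid

/-! Cross ratios are invariant under isomorphism. -/

theorem hom_smul (g : Moeb) (p : P1) : ∃ s : ℂ, s ≠ 0 ∧
    g 0 0 * hom0 p + g 0 1 * hom1 p = s * hom0 (g • p) ∧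
    g 1 0 * hom0 p + g 1 1 * hom1 p = s * hom1 (g • p) := by
  have hdet : g 0 0 * g 1 1 - g 0 1 * g 1 0 ≠ 0 := by
    have := g.det_ne_zero
    rwa [Matrix.det_fin_two] at this
  induction p using OnePoint.rec with
  | infty =>
    rw [smul_infty_eq_ite]
    by_cases h : g 1 0 = 0
    · refine ⟨g 0 0, ?_, ?_, ?_⟩
      · rintro h0; simp [h, h0] at hdet
      · simp [h, hom0, hom1]
      · simp [h, hom0, hom1]
    · refine ⟨g 1 0, h, ?_, ?_⟩
      · simp [h, hom0, hom1]; field_simp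
      · simp [h, hom0, hom1]
  | coe t =>
    rw [smul_some_eq_ite]
    by_cases h : g 1 0 * t + g 1 1 = 0
    · refine ⟨g 0 0 * t + g 0 1, ?_, ?_, ?_⟩
      · rintro h0
        apply hdet
        linear_combination g 0 0 * h - g 1 0 * h0
      · simp [h, hom0, hom1]
      · simp [h, hom0, hom1]
    · refine ⟨g 1 0 * t + g 1 1, h, ?_, ?_⟩
      · simp only [h, hom0, hom1, if_false, mul_one]
        rw [mul_div_cancel₀ _ h]
      · simp [h, hom0, hom1]

theorem crossRatio_smul (g : Moeb) (a b c d : P1) :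
    crossRatio (g • a) (g • b) (g • c) (g • d) = crossRatio a b c d := by
  have hdet : g 0 0 * g 1 1 - g 0 1 * g 1 0 ≠ 0 := by
    have := g.det_ne_zero
    rwa [Matrix.det_fin_two] at this
  obtain ⟨s, hs, hs0, hs1⟩ := hom_smul g a
  obtain ⟨t, ht, ht0, ht1⟩ := hom_smul g b
  obtain ⟨u, hu, hu0, hu1⟩ := hom_smul g c
  obtain ⟨v, hv, hv0, hv1⟩ := hom_smul g d
  have key : ∀ p q : P1, ∀ x y : ℂ,
      g 0 0 * hom0 p + g 0 1 * hom1 p = x * hom0 (g • p) →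
      g 1 0 * hom0 p + g 1 1 * hom1 p = x * hom1 (g • p) →
      g 0 0 * hom0 q + g 0 1 * hom1 q = y * hom0 (g • q) →
      g 1 0 * hom0 q + g 1 1 * hom1 q = y * hom1 (g • q) →
      x * y * bracket (g • p) (g • q) = (g 0 0 * g 1 1 - g 0 1 * g 1 0) * bracket p q := by
    intro p q x y h1 h2 h3 h4
    have : x * y * bracket (g • p) (g • q) =
        (x * hom0 (g • p)) * (y * hom1 (g • q)) - (x * hom1 (g • p)) * (y * hom0 (g • q)) := by
      simp only [bracket]; ring
    rw [this, ← h1, ← h2, ← h3, ← h4]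
    simp only [bracket]; ring
  have had := key a d s v hs0 hs1 hv0 hv1
  have hbc := key b c t u ht0 ht1 hu0 hu1
  have hac := key a c s u hs0 hs1 hu0 hu1
  have hbd := key b d t v ht0 ht1 hv0 hv1
  have scale : ∀ k n m : ℂ, k ≠ 0 → ratio (k * n) (k * m) = ratio n m := by
    intro k n m hk
    by_cases hm : m = 0
    · simp [ratio, hm]
    · simp only [ratio, mul_eq_zero, hk, hm, or_self, if_false]
      rw [mul_div_mul_left _ _ hk]
  unfold crossRatio
  rw [← scale (s * t * u * v) _ _ (by simp [hs, ht, hu, hv]),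
    ← scale ((g 0 0 * g 1 1 - g 0 1 * g 1 0) ^ 2) (bracket a d * bracket b c) _
      (pow_ne_zero 2 hdet)]
  congr 1
  · linear_combination (t * u * bracket (g • b) (g • c)) * had +
      ((g 0 0 * g 1 1 - g 0 1 * g 1 0) * bracket a d) * hbc
  · linear_combination (t * v * bracket (g • b) (g • d)) * hac +
      ((g 0 0 * g 1 1 - g 0 1 * g 1 0) * bracket a c) * hbd

namespace MarkedCurve

variable {A : Type} {C C' : MarkedCurve A}

theorem next_eq (C : MarkedCurve A) {v w : C.Comp} (p : C.graph.Walk v w) (hp : p.IsPath) :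
    C.next v w = p.snd := by
  have h := C.isTree.existsUnique_path v w
  have : h.choose = p := h.unique h.choose_spec.1 hp
  simp only [next, this]

theorem adj_next (C : MarkedCurve A) {v w : C.Comp} (h : v ≠ w) :
    C.graph.Adj v (C.next v w) :=
  SimpleGraph.Walk.adj_snd (SimpleGraph.Walk.not_nil_of_ne h)

theorem Iso.next_eq (φ : C.Iso C') (v w : C.Comp) :
    C'.next (φ.comp v) (φ.comp w) = φ.comp (C.next v w) := by
  obtain ⟨p, hp, -⟩ := C.isTree.existsUnique_path v w
  have h := C'.next_eq (p.map φ.comp.toHom) (hp.map φ.comp.injective)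
  rw [SimpleGraph.Walk.snd, SimpleGraph.Walk.getVert_map] at h
  rw [C.next_eq p hp]
  exact h

theorem Iso.proj_eq (φ : C.Iso C') (v : C.Comp) (a : A) :
    C'.proj (φ.comp v) (C'.mark a) = φ.moeb v • C.proj v (C.mark a) := by
  unfold proj
  rw [φ.mark_eq a]
  by_cases h : (C.mark a).1 = v
  · simp [h]
  · simp only [EmbeddingLike.apply_eq_iff_eq, h, if_false]
    rw [φ.next_eq, φ.node_eq _ _ (C.adj_next (Ne.symm h))]

theorem Iso.isMedian_iff (φ : C.Iso C') (a b c : A) (v : C.Comp) :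
    C'.IsMedian a b c (φ.comp v) ↔ C.IsMedian a b c v := by
  simp [IsMedian, φ.proj_eq]

theorem next_eq_of_adj (C : MarkedCurve A) {v w w' : C.Comp} (hw : v ≠ w) (hw' : v ≠ w')
    (h : C.graph.Adj w w') : C.next v w = C.next v w' := by
  classical
  obtain ⟨p, hp, -⟩ := C.isTree.existsUnique_path v w
  obtain ⟨q, hq, -⟩ := C.isTree.existsUnique_path v w'
  have key : ∀ {w w' : C.Comp} (p : C.graph.Walk v w) (q : C.graph.Walk v w') (_ : p.IsPath)
      (_ : q.IsPath) (_ : v ≠ w) (h : C.graph.Adj w w') (_ : w ∈ q.support),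
      p.snd = q.snd := by
    intro w w' p q hp hq hw h hv
    rw [C.isTree.isAcyclic.path_concat hp hq h hv]
    cases p with
    | nil => exact absurd rfl hw
    | cons _ _ => simp [SimpleGraph.Walk.concat_cons]
  rw [C.next_eq p hp, C.next_eq q hq]
  by_cases hv : w ∈ q.support
  · exact key p q hp hq hw h hv
  · exact (key q p hq hp hw' h.symm
      (C.isTree.isAcyclic.mem_support_of_ne_mem_support_of_adj_of_isPath hp hq h hv)).symm

theorem next_eq_of_walk (C : MarkedCurve A) {v w w' : C.Comp} (q : C.graph.Walk w w')
    (hv : v ∉ q.support) : C.next v w = C.next v w' := by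
  induction q with
  | nil => rfl
  | @cons a b c h q ih =>
    rw [SimpleGraph.Walk.support_cons, List.mem_cons, not_or] at hv
    rw [← ih hv.2]
    exact C.next_eq_of_adj hv.1 (fun e => hv.2 (e ▸ q.start_mem_support)) h

theorem proj_or (C : MarkedCurve A) {v v' : C.Comp} (h : v ≠ v') (p : C.Comp × P1) :
    C.proj v p = C.node v (C.next v v') ∨ C.proj v' p = C.node v' (C.next v' v) := by
  classical
  by_cases h1 : p.1 = v
  · right
    simp only [proj, h1, if_neg h]
  by_cases h2 : p.1 = v'
  · left
    simp only [proj, h2, if_neg h.symm]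
  obtain ⟨q, hq, -⟩ := C.isTree.existsUnique_path v p.1
  by_cases hm : v' ∈ q.support
  · left
    simp only [proj, h1, if_false]
    have hv : v ∉ (q.dropUntil v' hm).support := by
      intro hv
      have hq' := hq
      rw [← q.take_spec hm] at hq'
      exact hq'.ne_of_mem_support_of_append (x := v) (y := v) h
        (q.takeUntil v' hm).start_mem_support hv rfl
    rw [C.next_eq_of_walk _ hv]
  · right
    simp only [proj, h2, if_false]
    rw [C.next_eq_of_walk q hm]

theorem IsMedian.unique {C : MarkedCurve A} {a b c : A} {v v' : C.Comp}
    (h : C.IsMedian a b c v) (h' : C.IsMedian a b c v') : v = v' := by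
  by_contra hne
  obtain ⟨h1, h2, h3⟩ := h
  obtain ⟨h1', h2', h3'⟩ := h'
  rcases C.proj_or hne (C.mark a) with ha | ha <;>
  rcases C.proj_or hne (C.mark b) with hb | hb <;>
  rcases C.proj_or hne (C.mark c) with hc | hc <;>
  simp_all

theorem cross_eq {C : MarkedCurve A} {a b c : A} {v : C.Comp} (h : C.IsMedian a b c v) (d : A) :
    C.cross a b c d = crossRatio (C.proj v (C.mark a)) (C.proj v (C.mark b))
      (C.proj v (C.mark c)) (C.proj v (C.mark d)) := by
  have hex : ∃ v, C.IsMedian a b c v := ⟨v, h⟩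
  have : hex.choose = v := hex.choose_spec.unique h
  simp only [cross, dif_pos hex, this]

theorem Iso.cross_eq (φ : C.Iso C') (a b c d : A) : C'.cross a b c d = C.cross a b c d := by
  by_cases h : ∃ v, C.IsMedian a b c v
  · obtain ⟨v, hv⟩ := h
    rw [MarkedCurve.cross_eq hv, MarkedCurve.cross_eq ((φ.isMedian_iff a b c v).2 hv)]
    simp only [φ.proj_eq, crossRatio_smul]
  · have h' : ¬ ∃ v, C'.IsMedian a b c v := by
      rintro ⟨v, hv⟩
      refine h ⟨φ.comp.symm v, (φ.isMedian_iff a b c _).1 ?_⟩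
      simpa using hv
    simp only [cross, dif_neg h, dif_neg h']

end MarkedCurve

namespace AMf

/-- Indices of the cross ratio coordinates on `𝒜ℳ_f`: quadruples of points of `F⁻¹(B)` on the
upper curve and quadruples of points of `B` on the lower curve. -/
abbrev Index : Type := (LP × LP × LP × LP) ⊕ (LB × LB × LB × LB)

/-- The cross ratio coordinates on `𝒜ℳ_f`. -/
def coord (α : AMf) : Index → P1 :=
  Quotient.lift (fun D : Diagram => Sum.elim
    (fun l : LP × LP × LP × LP => D.upper.cross l.1 l.2.1 l.2.2.1 l.2.2.2)
    (fun l : LB × LB × LB × LB => D.lower.cross l.1 l.2.1 l.2.2.1 l.2.2.2))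
    (by
      rintro D D' ⟨φ⟩
      funext l
      rcases l with l | l
      · exact (φ.up.cross_eq _ _ _ _).symm
      · exact (φ.low.cross_eq _ _ _ _).symm) α

/-- The topology of `𝒜ℳ_f` is the standard one of moduli of stable marked rational curves: the
coarsest topology for which all cross ratios of marked points are continuous. -/
instance : TopologicalSpace AMf := TopologicalSpace.induced coord inferInstance

/-- The stratum of `𝒜ℳ_f` of a partition of `B` (given as the partition into fibres of a function):
two points of `B` lie on the same component of `𝒞_L` iff they are in the same part. -/
def stratum (part : LB → ℕ) : Set AMf :=
  {α | ∃ D : Diagram, (⟦D⟧ : AMf) = α ∧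
    ∀ b b', (D.lower.mark b).1 = (D.lower.mark b').1 ↔ part b = part b'}

/-- `𝒜₁`, the stratum of the partition `{∞, y, z} ∪ {0, 1}`. -/
def A1 : Set AMf := stratum fun
  | .zero => 0 | .one => 0 | .inf => 1 | .y => 1 | .z => 1

/-- `𝒜₂`, the stratum of the partition `{0, 1, z} ∪ {y, ∞}`. -/
def A2 : Set AMf := stratum fun
  | .zero => 0 | .one => 0 | .z => 0 | .y => 1 | .inf => 1

/-- The stratum of the partition `{0, 1} ∪ {z} ∪ {y, ∞}`. -/
def A12 : Set AMf := stratum fun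
  | .zero => 0 | .one => 0 | .z => 1 | .y => 2 | .inf => 2

end AMf

/-- `𝒜𝒱_{f,ι}`, the equalizer of `p_U, p_L : 𝒜ℳ_f → 𝒜ℳ_{(S²,A)}`: the stabilizations of `𝒞_U`, marked
by `A`, and of `𝒞_L`, marked by `A` through `ι`, are isomorphic. -/
def AV : Set AMf :=
  {α | ∃ D : Diagram, (⟦D⟧ : AMf) = α ∧ ∃ S : MarkedCurve LA,
    (D.upper.relabel LA.toLP LA.toLP_injective).IsStabilization S ∧
    (D.lower.relabel LA.iota LA.iota_injective).IsStabilization S}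

/-! ### The moduli space `ℳ_f` and its parameters -/

/-- A smooth marked rational curve. -/
def smoothCurve {A : Type} (m : A → P1) (hm : Function.Injective m) : MarkedCurve A where
  Comp := Unit
  finite := inferInstance
  graph := ⊥
  isTree := .of_subsingleton
  node := fun _ _ => ∞
  node_inj := fun _ _ _ _ _ _ => rfl
  mark := fun a => ((), m a)
  mark_inj := fun a b h => hm (Prod.mk.inj h).2
  mark_ne_node := fun _ _ h => absurd h (by simp)

/-- Nondegeneracy of the parameters `x, y`. -/
structure Nondeg (x y : ℂ) : Prop where
  x0 : x ≠ 0
  x1 : x ≠ 1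
  y0 : y ≠ 0
  y1 : y ≠ 1
  z0 : 1 - 2 * x + x ^ 2 - y ≠ 0
  z1 : x ^ 2 + y ≠ 1
  zinf : x + y ≠ 1
  zy : 2 * x * y + x ^ 2 - y - 2 * x + 1 ≠ 0

/-- The second zero of `F`. -/
def rPar (x y : ℂ) : ℂ := (x + y - 1) / (x - 1)

/-- The second critical value of `F`. -/
def zPar (x y : ℂ) : ℂ :=
  -(1 - 2 * x + x ^ 2 - y) ^ 2 / (4 * x * (x - 1) * (x + y - 1))

/-- The marked points `0, 1, ∞, y, z` of the target. -/
def lowMark (x y : ℂ) : LB → P1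
  | .zero => ((0 : ℂ) : P1)
  | .one => ((1 : ℂ) : P1)
  | .inf => ∞
  | .y => (y : P1)
  | .z => (zPar x y : P1)

/-- The marked points `0, 1, ∞, x` of the source, and the other points over `0, 1, ∞, y, z`. -/
def upMark (x y : ℂ) : LP → P1
  | .zero => ((0 : ℂ) : P1)
  | .one => ((1 : ℂ) : P1)
  | .inf => ∞
  | .x => (x : P1)
  | .crit => ((2 * x * rPar x y / (x + rPar x y) : ℂ) : P1)
  | .inf' => ((x * rPar x y / (x + rPar x y) : ℂ) : P1)
  | .x' => (rPar x y : P1)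
  | .one' => ((x * rPar x y / (1 - y) : ℂ) : P1)

namespace Nondeg

variable {x y : ℂ}

theorem r_ne (h : Nondeg x y) : rPar x y ≠ 0 :=
  div_ne_zero (fun e => h.zinf (by linear_combination e)) (sub_ne_zero.2 h.x1)

theorem r_mul (h : Nondeg x y) : rPar x y * (x - 1) = x + y - 1 :=
  div_mul_cancel₀ _ (sub_ne_zero.2 h.x1)

theorem xr_ne (h : Nondeg x y) : x + rPar x y ≠ 0 := by
  intro e
  apply h.z1
  linear_combination (x - 1) * e - h.r_mul

theorem x_ne_r (h : Nondeg x y) : x ≠ rPar x y := by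
  intro e
  apply h.z0
  linear_combination (x - 1) * e + h.r_mul

theorem z_eq (h : Nondeg x y) : zPar x y = -(x - rPar x y) ^ 2 / (4 * x * rPar x y) := by
  have h1 := sub_ne_zero.2 h.x1
  have h0 := h.x0
  have h2 : x + y - 1 ≠ 0 := fun e => h.zinf (by linear_combination e)
  unfold zPar rPar
  field_simp
  ring

theorem lowMark_inj (h : Nondeg x y) : Function.Injective (lowMark x y) := by
  have h1 := sub_ne_zero.2 h.x1
  have hx0 := h.x0
  have h2 : x + y - 1 ≠ 0 := fun e => h.zinf (by linear_combination e)
  have hd : 4 * x * (x - 1) * (x + y - 1) ≠ 0 := by simp [hx0, h1, h2]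
  have e0 : zPar x y ≠ 0 := div_ne_zero (neg_ne_zero.2 (pow_ne_zero 2 h.z0)) hd
  have e1 : zPar x y ≠ 1 := by
    intro e
    rw [zPar, div_eq_one_iff_eq hd] at e
    have : (x ^ 2 + y - 1) ^ 2 = 0 := by linear_combination -e
    exact h.z1 (by linear_combination pow_eq_zero_iff (two_ne_zero) |>.1 this)
  have ey : zPar x y ≠ y := by
    intro e
    rw [zPar, div_eq_iff hd] at e
    have : (2 * x * y + x ^ 2 - y - 2 * x + 1) ^ 2 = 0 := by linear_combination -e
    exact h.zy (pow_eq_zero_iff (two_ne_zero) |>.1 this)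
  have hy0 := h.y0
  have hy1 := h.y1
  intro a b hab
  cases a <;> cases b <;> simp only [lowMark, coe_eq_coe, infty_ne_coe, coe_ne_infty] at hab <;>
    first
    | rfl
    | exact absurd hab zero_ne_one
    | exact absurd hab one_ne_zero
    | exact absurd hab hy0
    | exact absurd hab.symm hy0
    | exact absurd hab hy1
    | exact absurd hab.symm hy1
    | exact absurd hab e0
    | exact absurd hab.symm e0
    | exact absurd hab e1
    | exact absurd hab.symm e1
    | exact absurd hab ey
    | exact absurd hab.symm ey

end Nondeg

/-- The rational map `F(t) = (t - x)(t - r) / t²`. -/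
def fMap (x y : ℂ) (h : Nondeg x y) : RatMap where
  num := (X - C x) * (X - C (rPar x y))
  den := X ^ 2
  coprime := by
    apply IsCoprime.pow_right
    apply IsCoprime.mul_left
    · simpa using (isCoprime_X_sub_C_of_isUnit_sub (R := ℂ) (a := x) (b := 0)
        (by simpa using h.x0))
    · simpa using (isCoprime_X_sub_C_of_isUnit_sub (R := ℂ) (a := rPar x y) (b := 0)
        (by simpa using h.r_ne))
  pos := by simp

theorem fMap_degree {x y : ℂ} (h : Nondeg x y) : (fMap x y h).degree = 2 := by
  have : ((X - C x) * (X - C (rPar x y))).natDegree = 2 := by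
    rw [natDegree_mul (X_sub_C_ne_zero _) (X_sub_C_ne_zero _)]
    simp
  simp [RatMap.degree, fMap, this]

theorem fMap_inf {x y : ℂ} (h : Nondeg x y) : (fMap x y h).eval ∞ = ((1 : ℂ) : P1) := by
  have h1 : ((X - C x) * (X - C (rPar x y))).coeff 2 = 1 := by
    have : (X - C x) * (X - C (rPar x y)) = X ^ 2 - C (x + rPar x y) * X + C (x * rPar x y) := by
      simp only [C_add, C_mul]; ring
    rw [this]
    simp
  simp only [RatMap.eval, fMap_degree h]
  simp [fMap, h1, ratio]

theorem fMap_zero {x y : ℂ} (h : Nondeg x y) : (fMap x y h).eval ((0 : ℂ) : P1) = ∞ := by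
  simp [RatMap.eval, fMap, ratio]

theorem fMap_coe {x y : ℂ} (h : Nondeg x y) {t : ℂ} (ht : t ≠ 0) :
    (fMap x y h).eval (t : P1) = (((t - x) * (t - rPar x y) / t ^ 2 : ℂ) : P1) := by
  simp [RatMap.eval, fMap, ratio, ht]

theorem fMap_mark {x y : ℂ} (h : Nondeg x y) (l : LP) :
    lowMark x y l.f = (fMap x y h).eval (upMark x y l) := by
  have hx := h.x0
  have hr := h.r_ne
  have hs := h.xr_ne
  have hy := sub_ne_zero.2 h.y1.symm
  have hrm := h.r_mul
  have hz := h.z_eq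
  cases l <;> simp only [LP.f, lowMark, upMark]
  · rw [fMap_zero]
  · rw [fMap_coe h one_ne_zero]
    congr 1
    linear_combination -hrm
  · rw [fMap_inf]
  · rw [fMap_coe h hx]; simp
  · rw [fMap_coe h (by simp [hx, hr, hs]), hz]
    congr 1
    field_simp
    ring
  · rw [fMap_coe h (by simp [hx, hr, hs])]
    congr 1
    field_simp
    ring
  · rw [fMap_coe h hr]; simp
  · rw [fMap_coe h (by simp [hx, hr, hy])]
    congr 1
    have ht : x * rPar x y / (1 - y) ≠ 0 := by simp [hx, hr, hy]
    have ht' : x * rPar x y / (1 - y) * (1 - y) = x * rPar x y := div_mul_cancel₀ _ hy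
    generalize x * rPar x y / (1 - y) = t at ht ht'
    rw [eq_div_iff (pow_ne_zero 2 ht)]
    linear_combination (1 - t) * ht' - t * hrm

theorem upMark_inj {x y : ℂ} (h : Nondeg x y) : Function.Injective (upMark x y) := by
  have hy := sub_ne_zero.2 h.y1.symm
  have h1 : x * rPar x y / (1 - y) ≠ 1 := by
    intro e
    rw [div_eq_one_iff_eq hy] at e
    apply h.zy
    linear_combination (x - 1) * e - x * h.r_mul
  intro a b hab
  have hf : LP.f a = LP.f b := h.lowMark_inj (by rw [fMap_mark h, fMap_mark h, hab])
  cases a <;> cases b <;> try first | rfl | (simp only [LP.f, reduceCtorEq] at hf)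
  all_goals simp only [upMark, coe_eq_coe, infty_ne_coe, coe_ne_infty] at hab
  · exact absurd hab.symm h1
  · exact absurd hab h.x_ne_r
  · exact absurd hab.symm h.x_ne_r
  · exact absurd hab h1

theorem fMap_localDeg {x y : ℂ} (h : Nondeg x y) (p : P1) :
    ((fMap x y h).eval p = ∞ ∨ (fMap x y h).eval p = (zPar x y : P1) →
      (fMap x y h).localDeg p = 2) ∧
    ((fMap x y h).eval p ≠ ∞ → (fMap x y h).eval p ≠ (zPar x y : P1) →
      (fMap x y h).localDeg p = 1) := by
  have hx := h.x0
  have hr := h.r_ne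
  have hs := h.xr_ne
  have hz := h.z_eq
  have hexp : (X - C x) * (X - C (rPar x y)) =
      X ^ 2 - C (x + rPar x y) * X + C (x * rPar x y) := by
    simp only [C_add, C_mul]; ring
  induction p using OnePoint.rec with
  | infty =>
    have hdeg : (fMap x y h).localDeg ∞ = 1 := by
      have : (fMap x y h).fibrePoly ((1 : ℂ) : P1) =
          C (-(x + rPar x y)) * X + C (x * rPar x y) := by
        simp only [RatMap.fibrePoly, fMap, hexp, C_neg, C_1]
        ring
      simp only [RatMap.localDeg, fMap_inf h, this, fMap_degree h]
      rw [natDegree_linear (neg_ne_zero.2 hs)]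
    refine ⟨?_, fun _ _ => hdeg⟩
    rw [fMap_inf h]
    rintro (e | e)
    · exact absurd e (coe_ne_infty _)
    · exact absurd (h.lowMark_inj (a₁ := .one) (a₂ := .z) e) (by simp)
  | coe t =>
    by_cases ht : t = 0
    · subst ht
      refine ⟨fun _ => ?_, fun e => absurd (fMap_zero h) e⟩
      have : (fMap x y h).fibrePoly ∞ = (X - C 0) ^ 2 := by
        simp [RatMap.fibrePoly, fMap]
      simp only [RatMap.localDeg, fMap_zero h, this]
      exact rootMultiplicity_X_sub_C_pow _ _
    · rw [fMap_coe h ht]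
      set c : ℂ := (t - x) * (t - rPar x y) / t ^ 2 with hc
      have hc' : c * t ^ 2 = (t - x) * (t - rPar x y) := div_mul_cancel₀ _ (pow_ne_zero 2 ht)
      have hq : t * (x * rPar x y / t) = x * rPar x y := mul_div_cancel₀ _ ht
      have hq0 : x * rPar x y / t ≠ 0 := by simp [hx, hr, ht]
      set q : ℂ := x * rPar x y / t with hqdef
      have hlin : (1 - c) * t + q = x + rPar x y := by
        have : t * ((1 - c) * t + q) = t * (x + rPar x y) := by
          linear_combination -hc' + hq
        exact mul_left_cancel₀ ht this
      have hpoly : (fMap x y h).fibrePoly (c : P1) = (X - C t) * (C (1 - c) * X - C q) := by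
        simp only [RatMap.fibrePoly, fMap, hexp]
        rw [← hlin, ← hq]
        simp only [C_add, C_mul, C_sub, C_1]
        ring
      have hloc : (fMap x y h).localDeg (t : P1) =
          ((X - C t) * (C (1 - c) * X - C q)).rootMultiplicity t := by
        rw [← hpoly]
        simp only [RatMap.localDeg]
        rw [fMap_coe h ht]
      have hne : (X - C t) * (C (1 - c) * X - C q) ≠ 0 := by
        intro e
        have := congrArg (Polynomial.eval 0) e
        simp only [eval_mul, eval_sub, eval_X, eval_C, mul_zero, zero_sub, eval_zero] at this
        rw [neg_mul_neg] at this
        exact (mul_ne_zero ht hq0) this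
      -- the point is critical iff the second factor vanishes there, iff `c` is the value `z`
      have hiff : c = zPar x y ↔ (1 - c) * t = q := by
        rw [hz, eq_div_iff (by simp [hx, hr])]
        constructor
        · intro e
          have : ((1 - c) * t - q) ^ 2 = 0 := by
            linear_combination ((1 - c) * t + q + x + rPar x y) * hlin + e -
              4 * (1 - c) * hq
          linear_combination (pow_eq_zero_iff two_ne_zero).1 this
        · intro e
          linear_combination -((1 - c) * t + q + x + rPar x y) * hlin +
              4 * (1 - c) * hq + ((1 - c) * t - q) * e
      rw [hloc, rootMultiplicity_mul hne, rootMultiplicity_X_sub_C_self]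
      refine ⟨?_, ?_⟩
      · rintro (e | e)
        · exact absurd e (coe_ne_infty _)
        · have e' := hiff.1 (coe_eq_coe.1 e)
          have h1c : 1 - c ≠ 0 := by
            intro e0
            rw [e0, zero_mul] at e'
            exact hq0 e'.symm
          have : C (1 - c) * X - C q = C (1 - c) * (X - C t) := by
            rw [← e', C_mul]; ring
          rw [this, rootMultiplicity_mul (mul_ne_zero (C_ne_zero.2 h1c) (X_sub_C_ne_zero t)),
            rootMultiplicity_X_sub_C_self, rootMultiplicity_C]
      · intro _ e
        have : ¬ IsRoot (C (1 - c) * X - C q) t := by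
          intro hroot
          apply e
          rw [coe_eq_coe, hiff]
          simpa [IsRoot, sub_eq_zero] using hroot
        rw [rootMultiplicity_eq_zero this]

/-- The point of `ℳ_f` with parameters `(x, y)`:
`F(t) = (t - x)(t - r) / t²` from `P1` marked by `0, 1, ∞, x` to `P1` marked by `0, 1, ∞, y, z`. -/
def smoothDiagram (x y : ℂ) (h : Nondeg x y) : Diagram where
  upper := smoothCurve (upMark x y) (upMark_inj h)
  lower := smoothCurve (lowMark x y) h.lowMark_inj
  stable := by
    intro v
    have hsub : lowMark x y '' {.zero, .one, .inf} ⊆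
        (smoothCurve (lowMark x y) h.lowMark_inj).special v := by
      rintro _ ⟨b, -, rfl⟩
      exact Or.inr ⟨b, rfl⟩
    refine le_trans (le_of_eq ?_) (Set.encard_le_encard hsub)
    rw [h.lowMark_inj.encard_image, Set.encard_insert_of_notMem (by simp),
      Set.encard_insert_of_notMem (by simp), Set.encard_singleton]
    norm_num
  comp := id
  map := fun _ => fMap x y h
  degree_eq := by
    intro a
    have : (id ⁻¹' {a} : Set Unit) = {()} := by
      ext b; exact ⟨fun _ => rfl, fun _ => rfl⟩
    erw [this, finsum_mem_singleton]
    exact fMap_degree h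
  node_adj := fun _ _ h => False.elim h
  node_map := fun _ _ h => False.elim h
  node_preimage := fun _ _ _ h => False.elim h
  balanced := fun _ _ h => False.elim h
  mark_map := fun l => Prod.ext rfl (fMap_mark h l)
  ramified := fun _ p hp => (fMap_localDeg h p).1
    (hp.imp (fun e => (Prod.mk.inj e).2) (fun e => (Prod.mk.inj e).2))
  unramified := fun _ p _ h1 h2 => (fMap_localDeg h p).2
    (fun e => h1 (Prod.ext rfl e)) (fun e => h2 (Prod.ext rfl e))

/-- The lines `x, y ∈ {0, 1, ∞}`. -/
def LSet : Set (P1 × P1) :=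
  {p | p.1 = ((0 : ℂ) : P1) ∨ p.2 = ((0 : ℂ) : P1) ∨ p.1 = ((1 : ℂ) : P1) ∨
    p.2 = ((1 : ℂ) : P1) ∨ p.1 = ∞ ∨ p.2 = ∞}

/-- The closure of the union of the four affine curves on which `z ∈ {0, 1, ∞, y}`. -/
def ZSet : Set (P1 × P1) :=
  closure {p | ∃ x y : ℂ, p = ((x : P1), (y : P1)) ∧
    (1 - 2 * x + x ^ 2 - y = 0 ∨ x ^ 2 + y = 1 ∨ x + y = 1 ∨
      2 * x * y + x ^ 2 - y - 2 * x + 1 = 0)}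

/-- `ℳ_f` in its parameters: the complement of `ℒ ∪ 𝒵` in `P1 × P1`. -/
def Mf : Set (P1 × P1) := (LSet ∪ ZSet)ᶜ

/-- `𝒱`, the diagonal of `ℳ_f`. -/
def VSet : Set (P1 × P1) := {p | p ∈ Mf ∧ p.1 = p.2}

/-- The affine coordinate of a finite point of `P1` (and `0` at `∞`). -/
def aff (p : P1) : ℂ := p.elim 0 id

theorem Mf.nondeg {p : P1 × P1} (hp : p ∈ Mf) : Nondeg (aff p.1) (aff p.2) := by
  obtain ⟨a, b⟩ := p
  simp only [Mf, Set.mem_compl_iff, Set.mem_union, not_or] at hp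
  obtain ⟨hL, hZ⟩ := hp
  simp only [LSet, Set.mem_ofPred_eq, not_or] at hL
  obtain ⟨h1, h2, h3, h4, h5, h6⟩ := hL
  obtain ⟨x, rfl⟩ := ne_infty_iff_exists.1 h5
  obtain ⟨y, rfl⟩ := ne_infty_iff_exists.1 h6
  simp only [coe_eq_coe] at h1 h2 h3 h4
  have hZ'' : ¬ (1 - 2 * x + x ^ 2 - y = 0 ∨ x ^ 2 + y = 1 ∨ x + y = 1 ∨
      2 * x * y + x ^ 2 - y - 2 * x + 1 = 0) :=
    fun h => hZ (subset_closure ⟨x, y, rfl, h⟩)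
  simp only [not_or] at hZ''
  exact ⟨h1, h3, h2, h4, hZ''.1, hZ''.2.1, hZ''.2.2.1, hZ''.2.2.2⟩

/-- The inclusion `ℳ_f → 𝒜ℳ_f`, `(x, y)` going to the covering of smooth curves with
parameters `(x, y)`. -/
def Mf.toAMf (p : Mf) : AMf := ⟦smoothDiagram (aff p.1.1) (aff p.1.2) (Mf.nondeg p.2)⟧

/-- The inclusion `𝒱 → 𝒜ℳ_f` (with image in `𝒜𝒱`). -/
def VSet.toAMf (p : VSet) : AMf := Mf.toAMf ⟨p.1, p.2.1⟩

/-! ### The blowup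

A blowup is realized as the closure of the graph of the ratio of two functions that generate the
ideal of the centre. -/

/-- The blowup of `P1 × P1` at `(0,0)`, `(1,1)` and `(∞,∞)`, with coordinates `(x, y, u, t)`.
The rational function `u = y / x` is a ratio of local parameters at `(0,0)` and `(∞,∞)`, and is
defined at all other points; `t = (y - 1) / (x - 1)` is a ratio of local
parameters at `(1,1)` and `(∞,∞)`, and is defined at all other points. -/
def blowupThree : Set (Fin 4 → P1) :=
  closure {p | ∃ x y : ℂ, x ≠ 0 ∧ x ≠ 1 ∧
    p = ![(x : P1), (y : P1), ((y / x : ℂ) : P1), (((y - 1) / (x - 1) : ℂ) : P1)]}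

/-- The point `q` (as a one-point set): the intersection of the exceptional curve over `(∞,∞)` with
the proper transform of the line `y = ∞`. -/
def centreQ : Set (Fin 4 → P1) :=
  {p | p ∈ blowupThree ∧ p 0 = ∞ ∧ p 1 = ∞} ∩ closure {p | p ∈ blowupThree ∧ p 1 = ∞ ∧ p 0 ≠ ∞}

/-- The blowup of `blowupThree` at `q`, with coordinates `(x, y, u, t, w)`. Near `q` the functions
`1 / x` and `1 / u` are local parameters, and
`w = (y - x) / (x (x - 1)) = (1 / x) (1 - 1 / u) / ((1 / u) (1 - 1 / x))`
is the ratio of two local parameters; `w` is defined at all other points of `blowupThree`. -/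
def blowup : Set (Fin 5 → P1) :=
  closure {p | ∃ x y : ℂ, x ≠ 0 ∧ x ≠ 1 ∧
    p = ![(x : P1), (y : P1), ((y / x : ℂ) : P1), (((y - 1) / (x - 1) : ℂ) : P1),
      (((y - x) / (x * (x - 1)) : ℂ) : P1)]}

/-- The map `σ` to `P1 × P1`. -/
def sigma (p : Fin 5 → P1) : P1 × P1 := (p 0, p 1)

/-- The exceptional curve `E_q` over `q`. -/
def ExcQ : Set (Fin 5 → P1) := {p | p ∈ blowup ∧ (fun i : Fin 4 => p i.castSucc) ∈ centreQ}

/-- (The proper transform of) the exceptional curve `E_∞` over `(∞,∞)`. -/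
def ExcInf : Set (Fin 5 → P1) := closure {p | p ∈ blowup ∧ sigma p = (∞, ∞) ∧ p ∉ ExcQ}

/-- The proper transform of a subset of `P1 × P1`. -/
def properTransform (S : Set (P1 × P1)) : Set (Fin 5 → P1) :=
  closure {p | p ∈ blowup ∧ sigma p ∈ S ∧ sigma p ≠ (((0 : ℂ) : P1), ((0 : ℂ) : P1)) ∧
    sigma p ≠ (((1 : ℂ) : P1), ((1 : ℂ) : P1)) ∧ sigma p ≠ (∞, ∞)}

/-- `X = (𝒱̂ ∪ E_∞ ∪ E_q) ∖ (ℒ ∪ 𝒵)^`. -/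
def XSet : Set (Fin 5 → P1) := (properTransform VSet ∪ ExcInf ∪ ExcQ) \ properTransform (LSet ∪ ZSet)

/-! ### Regular maps and embeddings -/

/-- A function `g : T → P1` is regular with respect to coordinates `c : T → P1 ^ I` if locally, in
affine charts of the projective lines, it is a quotient of polynomials in the coordinates. -/
def IsRegular {T I : Type*} [TopologicalSpace T] (c : T → I → P1) (g : T → P1) : Prop :=
  ∀ p, ∃ (h : I → Moeb) (k : Moeb) (N D : MvPolynomial I ℂ), ∀ᶠ q in 𝓝 p, ∃ a : I → ℂ,
    (∀ i, h i • c q i = (a i : P1)) ∧ MvPolynomial.eval a D ≠ 0 ∧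
    k • g q = ((MvPolynomial.eval a N / MvPolynomial.eval a D : ℂ) : P1)

/-- An embedding of algebraic sets with coordinates `c : S → P1 ^ I` and `d : T → P1 ^ J`:
a topological embedding that is regular and whose inverse on the image is regular. -/
def IsAlgEmbedding {S T I J : Type*} [TopologicalSpace S] [TopologicalSpace T]
    (c : S → I → P1) (d : T → J → P1) (φ : S → T) : Prop :=
  IsEmbedding φ ∧ (∀ j, IsRegular c fun s => d (φ s) j) ∧
    ∀ i, IsRegular (fun s => d (φ s)) fun s => c s i

end PerFour
end

noncomputable section

namespace PerFour

open Filter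

/-! ### Homogeneous coordinates on the projective line -/

/-! The set X is a curve with three components, the proper transform of the diagonal, `E_∞` and
`E_q`, each a projective line with finitely many points removed. The points lost are u = 0, -1, -1/2
on `E_∞`, w = ∞, 1, -1 on `E_q`, and on the diagonal those x ≠ 0, 1, ∞ for which (x, x) is
degenerate; the diagonal keeps its points over (0,0) and (1,1). This is `mem_XSet_iff`: explicit
branches of the lines and of `𝒵` pass through the lost points, and multihomogeneous equations keep
the closure away from the others. The diagonal meets `E_∞` at u = 1, and `E_∞` (at u = ∞) meets
`E_q` (at w = 0), so X is connected.

The map ξ sends a point of X to the limit of the coverings F. If x → ∞ and y / x → u, then r → u +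
1, and after rescaling F becomes a squaring map with two components of degree one attached over the
node. If y grows like w x², then r grows like w x, and F breaks into two squaring maps. The corner
is the common degeneration of both families, and x = y → 0 or 1 gives two further limits. All these
coverings consist of identity and squaring maps on trees of lines, so they can be written as finite
tables. They lie in `𝒜𝒱` because a curve with two components and two marked points on each has no
moduli: it is enough that source and target separate the four marks in the same way.

Regularity of ξ rests on sections. For every component of a special covering there are homogeneous
coordinates of all marked points, polynomial in a few local regular functions on X, which give the
projections to that component at the special point and, at each nearby point of X, a Möbius image of
the projections to some component of the nearby curve. A cross ratio is computed on the median
component of its first three points, which exists by `MarkedCurve.exists_isMedian`, so it is a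
quotient of such polynomials (`regPt_cross`).

Conversely x and y are cross ratios themselves, and near infinity u and w are rational in 1/x and
the cross ratios r = [0,∞;1,x'] and r/x = [0,∞;x,x'] (`coord_eq_of_ne`), so the inverse is regular
(`regPt_inverse`). Regular maps are continuous; hence the coordinates of X and the cross ratios
define the same neighbourhoods (`nearby_eq`), and ξ is a topological embedding as well. -/

theorem hom_ne_zero (p : P1) : hom0 p ≠ 0 ∨ hom1 p ≠ 0 := by
  induction p using OnePoint.rec with
  | infty => exact Or.inl one_ne_zero
  | coe t => exact Or.inr one_ne_zero

@[simp] theorem hom0_infty : hom0 (∞ : P1) = 1 := rfl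
@[simp] theorem hom1_infty : hom1 (∞ : P1) = 0 := rfl
@[simp] theorem hom0_coe (t : ℂ) : hom0 (t : P1) = t := rfl
@[simp] theorem hom1_coe (t : ℂ) : hom1 (t : P1) = 1 := rfl
@[simp] theorem aff_coe (t : ℂ) : aff (t : P1) = t := rfl
@[simp] theorem aff_infty : aff (∞ : P1) = 0 := rfl

@[simp] theorem ratio_zero_right (n : ℂ) : ratio n 0 = ∞ := by simp [ratio]

@[simp] theorem ratio_one_right (n : ℂ) : ratio n 1 = (n : P1) := by simp [ratio]

theorem ratio_of_ne {n d : ℂ} (h : d ≠ 0) : ratio n d = ((n / d : ℂ) : P1) := by simp [ratio, h]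

@[simp] theorem ratio_hom (p : P1) : ratio (hom0 p) (hom1 p) = p := by
  induction p using OnePoint.rec with
  | infty => simp
  | coe t => simp

theorem hom_ratio {n d : ℂ} (h : n ≠ 0 ∨ d ≠ 0) :
    ∃ s : ℂ, s ≠ 0 ∧ n = s * hom0 (ratio n d) ∧ d = s * hom1 (ratio n d) := by
  by_cases hd : d = 0
  · exact ⟨n, by simpa [hd] using h, by simp [hd], by simp [hd]⟩
  · exact ⟨d, hd, by rw [ratio_of_ne hd, hom0_coe, mul_div_cancel₀ _ hd],
      by rw [ratio_of_ne hd, hom1_coe, mul_one]⟩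

theorem ratio_mul_left {k : ℂ} (hk : k ≠ 0) (n d : ℂ) : ratio (k * n) (k * d) = ratio n d := by
  by_cases hm : d = 0
  · simp [hm]
  · rw [ratio_of_ne hm, ratio_of_ne (mul_ne_zero hk hm), mul_div_mul_left _ _ hk]

theorem ratio_eq_ratio {n d n' d' : ℂ} (h : n ≠ 0 ∨ d ≠ 0) (h' : n' ≠ 0 ∨ d' ≠ 0)
    (e : n * d' = n' * d) : ratio n d = ratio n' d' := by
  by_cases hd : d = 0
  · subst hd
    have hn : n ≠ 0 := by simpa using h
    have hd' : d' = 0 := by simpa [hn] using e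
    rw [hd', ratio_zero_right, ratio_zero_right]
  · have hd' : d' ≠ 0 := by
      rintro rfl
      have hn' : n' ≠ 0 := by simpa using h'
      simp [hn', hd] at e
    rw [ratio_of_ne hd, ratio_of_ne hd', coe_eq_coe, div_eq_div_iff hd hd', e]

theorem ratio_eq_coe_iff {n d t : ℂ} (h : n ≠ 0 ∨ d ≠ 0) : ratio n d = (t : P1) ↔ n = t * d := by
  by_cases hd : d = 0
  · subst hd
    have hn : n ≠ 0 := by simpa using h
    simp [hn]
  · rw [ratio_of_ne hd, coe_eq_coe, div_eq_iff hd]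

theorem bracket_eq_zero {p q : P1} : bracket p q = 0 ↔ p = q := by
  induction p using OnePoint.rec <;> induction q using OnePoint.rec <;>
    simp [bracket, sub_eq_zero]

theorem bracket_ratio {n d n' d' : ℂ} (h : n ≠ 0 ∨ d ≠ 0) (h' : n' ≠ 0 ∨ d' ≠ 0) :
    ratio n d = ratio n' d' ↔ n * d' - d * n' = 0 := by
  refine ⟨fun e => ?_, fun e => ratio_eq_ratio h h' (by linear_combination e)⟩
  obtain ⟨s, -, hn, hd⟩ := hom_ratio h
  obtain ⟨s', -, hn', hd'⟩ := hom_ratio h'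
  rw [e] at hn hd
  generalize ratio n' d' = p at *
  subst hn hd hn' hd'
  ring

/-- The action of a Möbius transformation in homogeneous coordinates. -/
theorem smul_ratio (g : Moeb) {n d : ℂ} (h : n ≠ 0 ∨ d ≠ 0) :
    g • ratio n d = ratio (g 0 0 * n + g 0 1 * d) (g 1 0 * n + g 1 1 * d) := by
  obtain ⟨s, hs, hn, hd⟩ := hom_ratio h
  obtain ⟨t, ht, h0, h1⟩ := hom_smul g (ratio n d)
  have e0 : g 0 0 * n + g 0 1 * d = (s * t) * hom0 (g • ratio n d) := by
    linear_combination g 0 0 * hn + g 0 1 * hd + s * h0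
  have e1 : g 1 0 * n + g 1 1 * d = (s * t) * hom1 (g • ratio n d) := by
    linear_combination g 1 0 * hn + g 1 1 * hd + s * h1
  rw [e0, e1, ratio_mul_left (mul_ne_zero hs ht), ratio_hom]

/-- The Möbius transformation with given matrix. -/
def mkMoeb (a b c d : ℂ) (h : a * d - b * c ≠ 0) : Moeb :=
  Matrix.GeneralLinearGroup.mkOfDetNeZero !![a, b; c, d] (by rwa [Matrix.det_fin_two_of])

theorem mkMoeb_smul_ratio {a b c d : ℂ} (h : a * d - b * c ≠ 0) {n m : ℂ} (hn : n ≠ 0 ∨ m ≠ 0) :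
    mkMoeb a b c d h • ratio n m = ratio (a * n + b * m) (c * n + d * m) := by
  rw [smul_ratio _ hn]
  rfl

theorem crossRatio_ratio {na da nb db nc dc nd dd : ℂ} (ha : na ≠ 0 ∨ da ≠ 0)
    (hb : nb ≠ 0 ∨ db ≠ 0) (hc : nc ≠ 0 ∨ dc ≠ 0) (hd : nd ≠ 0 ∨ dd ≠ 0) :
    crossRatio (ratio na da) (ratio nb db) (ratio nc dc) (ratio nd dd) =
      ratio ((na * dd - da * nd) * (nb * dc - db * nc))
        ((na * dc - da * nc) * (nb * dd - db * nd)) := by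
  obtain ⟨sa, hsa, ha0, ha1⟩ := hom_ratio ha
  obtain ⟨sb, hsb, hb0, hb1⟩ := hom_ratio hb
  obtain ⟨sc, hsc, hc0, hc1⟩ := hom_ratio hc
  obtain ⟨sd, hsd, hd0, hd1⟩ := hom_ratio hd
  unfold crossRatio
  rw [← ratio_mul_left (mul_ne_zero (mul_ne_zero hsa hsb) (mul_ne_zero hsc hsd))]
  generalize ratio na da = a at *
  generalize ratio nb db = b at *
  generalize ratio nc dc = c at *
  generalize ratio nd dd = d at *
  subst ha0 ha1 hb0 hb1 hc0 hc1 hd0 hd1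
  congr 1 <;> simp only [bracket] <;> ring

/-- Three distinct points are the images of `0, 1, ∞` under a Möbius transformation. -/
theorem exists_moeb {p q r : P1} (hpq : p ≠ q) (hpr : p ≠ r) (hqr : q ≠ r) :
    ∃ g : Moeb, g • ((0 : ℂ) : P1) = p ∧ g • ((1 : ℂ) : P1) = q ∧ g • (∞ : P1) = r := by
  replace hpq := bracket_eq_zero.not.2 hpq
  replace hpr := bracket_eq_zero.not.2 hpr
  replace hqr := bracket_eq_zero.not.2 hqr
  have e0 : ((0 : ℂ) : P1) = ratio 0 1 := by simp
  have e1 : ((1 : ℂ) : P1) = ratio 1 1 := by simp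
  have e2 : (∞ : P1) = ratio 1 0 := by simp
  have hd : (bracket p q * hom0 r) * (bracket q r * hom1 p) -
      (bracket q r * hom0 p) * (bracket p q * hom1 r) ≠ 0 := by
    have : (bracket p q * hom0 r) * (bracket q r * hom1 p) -
      (bracket q r * hom0 p) * (bracket p q * hom1 r) =
      - (bracket p q * bracket q r * bracket p r) := by simp only [bracket]; ring
    rw [this]
    exact neg_ne_zero.2 (mul_ne_zero (mul_ne_zero hpq hqr) hpr)
  -- The columns of the matrix are the homogeneous coordinates of `r` and of `p`, scaled by [p,q]
  -- and [q,r]. By the Plücker relation their sum is [p,r] times the coordinates of `q`.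
  refine ⟨mkMoeb _ _ _ _ hd, ?_, ?_, ?_⟩
  · rw [e0, mkMoeb_smul_ratio hd (by simp)]
    simp only [mul_zero, mul_one, zero_add]
    rw [ratio_mul_left hqr, ratio_hom]
  · rw [e1, mkMoeb_smul_ratio hd (by simp)]
    refine Eq.trans ?_ ((ratio_mul_left hpr _ _).trans (ratio_hom q))
    congr 1 <;> simp only [bracket] <;> ring
  · rw [e2, mkMoeb_smul_ratio hd (by simp)]
    simp only [mul_zero, mul_one, add_zero]
    rw [ratio_mul_left hpq, ratio_hom]

/-! ### Topology of the projective line -/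

/-- Where `d₀ ≠ 0` this is continuity of division. Where `d₀ = 0`, eventually ‖n‖ > M ‖d‖ for every
bound M, so the ratio leaves each compact subset of ℂ; where `d` vanishes the ratio is `∞` by
convention, in agreement with the limit. -/
theorem tendsto_ratio {α : Type*} {l : Filter α} {n d : α → ℂ} {n₀ d₀ : ℂ}
    (hn : Tendsto n l (𝓝 n₀)) (hd : Tendsto d l (𝓝 d₀)) (h : n₀ ≠ 0 ∨ d₀ ≠ 0) :
    Tendsto (fun i => ratio (n i) (d i)) l (𝓝 (ratio n₀ d₀)) := by
  by_cases h0 : d₀ = 0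
  · subst h0
    have hn0 : n₀ ≠ 0 := by simpa using h
    rw [ratio_zero_right, (hasBasis_nhds_infty (X := ℂ)).tendsto_right_iff]
    rintro s ⟨-, hs⟩
    obtain ⟨M, hM⟩ := hs.isBounded.exists_norm_le
    have h1 : Tendsto (fun i => ‖n i‖ - M * ‖d i‖) l (𝓝 (‖n₀‖ - M * ‖(0 : ℂ)‖)) :=
      hn.norm.sub (hd.norm.const_mul M)
    have h2 : 0 < ‖n₀‖ - M * ‖(0 : ℂ)‖ := by simpa using hn0
    filter_upwards [h1.eventually (lt_mem_nhds h2)] with i hi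
    by_cases hdi : d i = 0
    · right; simp [hdi]
    · left
      refine ⟨n i / d i, fun hmem => ?_, (ratio_of_ne hdi).symm⟩
      have := hM _ hmem
      rw [norm_div, div_le_iff₀ (norm_pos_iff.2 hdi)] at this
      linarith
  · have hev : ∀ᶠ i in l, d i ≠ 0 := hd.eventually_ne h0
    rw [ratio_of_ne h0]
    refine Tendsto.congr' (f₁ := fun i => ((n i / d i : ℂ) : P1)) ?_
      ((continuous_coe.tendsto _).comp (hn.div hd h0))
    filter_upwards [hev] with i hi
    rw [ratio_of_ne hi]

open Classical in
/-- A Möbius transformation taking `b` to a finite point: the identity or the inversion. -/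
def chart (b : P1) : Moeb := if b = ∞ then mkMoeb 0 1 1 0 (by simp) else 1

/-- The affine coordinate centred at the chart of `b`. -/
def loc (b z : P1) : ℂ := aff (chart b • z)

open Classical in
/-- First homogeneous coordinate, normalized near `b`. -/
def lift0 (b z : P1) : ℂ := if b = ∞ then 1 else loc b z

open Classical in
/-- Second homogeneous coordinate, normalized near `b`. -/
def lift1 (b z : P1) : ℂ := if b = ∞ then loc b z else 1

theorem inversion_smul {n d : ℂ} (h : n ≠ 0 ∨ d ≠ 0) :
    mkMoeb 0 1 1 0 (by simp) • ratio n d = ratio d n := by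
  rw [mkMoeb_smul_ratio _ h]; simp

theorem inversion_coe (t : ℂ) : mkMoeb 0 1 1 0 (by simp) • (t : P1) = ratio 1 t := by
  have := inversion_smul (n := t) (d := 1) (by simp)
  rwa [ratio_one_right] at this

theorem inversion_infty : mkMoeb 0 1 1 0 (by simp) • (∞ : P1) = ((0 : ℂ) : P1) := by
  have := inversion_smul (n := 1) (d := 0) (by simp)
  rw [ratio_zero_right] at this
  simpa using this

theorem loc_coe (t : ℂ) (z : P1) : loc (t : P1) z = aff z := by
  simp [loc, chart]

theorem loc_infty_coe (t : ℂ) : loc ∞ (t : P1) = t⁻¹ := by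
  rw [loc, chart, if_pos rfl, inversion_coe]
  by_cases h : t = 0
  · simp [h]
  · rw [ratio_of_ne h, aff_coe, one_div]

theorem loc_infty_infty : loc ∞ ∞ = 0 := by
  rw [loc, chart, if_pos rfl, inversion_infty, aff_coe]

theorem chart_smul_ne_infty (b : P1) : ∀ᶠ z in 𝓝 b, chart b • z ≠ ∞ := by
  induction b using OnePoint.rec with
  | infty =>
    have : ({((0 : ℂ) : P1)} : Set P1)ᶜ ∈ 𝓝 (∞ : P1) :=
      isClosed_singleton.isOpen_compl.mem_nhds (by simp)
    filter_upwards [this] with z hz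
    rw [chart, if_pos rfl]
    induction z using OnePoint.rec with
    | infty => rw [inversion_infty]; simp
    | coe t =>
      rw [inversion_coe, ratio_of_ne (by simpa using hz)]
      simp
  | coe t =>
    filter_upwards [isOpen_range_coe.mem_nhds ⟨t, rfl⟩] with z hz
    obtain ⟨s, rfl⟩ := hz
    simp [chart]

theorem coe_loc {b z : P1} (h : chart b • z ≠ ∞) : chart b • z = (loc b z : P1) := by
  obtain ⟨t, ht⟩ := ne_infty_iff_exists.1 h
  rw [loc, ← ht, aff_coe]

theorem tendsto_loc (b : P1) : Tendsto (loc b) (𝓝 b) (𝓝 (loc b b)) := by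
  induction b using OnePoint.rec with
  | infty =>
    rw [loc_infty_infty, tendsto_nhds_infty']
    constructor
    · rw [tendsto_pure_left]
      intro s hs
      rw [loc_infty_infty]
      exact mem_of_mem_nhds hs
    · have : (loc ∞ ∘ (fun t : ℂ => (t : P1))) = fun t => t⁻¹ := by
        funext t; exact loc_infty_coe t
      erw [this]
      rw [coclosedCompact_eq_cocompact, ← Metric.cobounded_eq_cocompact]
      exact tendsto_inv₀_cobounded
  | coe t =>
    rw [nhds_coe_eq, tendsto_map'_iff]
    have : (loc (t : P1) ∘ (fun t : ℂ => (t : P1))) = id := by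
      funext s; simp [loc_coe]
    erw [this]
    simp only [loc_coe, aff_coe]
    exact tendsto_id

theorem ratio_lift {b z : P1} (h : chart b • z ≠ ∞) : ratio (lift0 b z) (lift1 b z) = z := by
  unfold lift0 lift1
  induction b using OnePoint.rec with
  | infty =>
    simp only [if_true]
    induction z using OnePoint.rec with
    | infty => simp [loc_infty_infty]
    | coe t =>
      have ht : t ≠ 0 := by
        rintro rfl
        rw [chart, if_pos rfl, inversion_coe] at h
        simp at h
      rw [loc_infty_coe, ratio_of_ne (inv_ne_zero ht)]
      simp
  | coe t =>
    simp only [coe_ne_infty, if_false, loc_coe, ratio_one_right]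
    have hz : z ≠ ∞ := by simpa [chart] using h
    obtain ⟨s, rfl⟩ := ne_infty_iff_exists.1 hz
    simp

theorem lift_ne_zero (b z : P1) : lift0 b z ≠ 0 ∨ lift1 b z ≠ 0 := by
  unfold lift0 lift1
  split_ifs <;> simp

@[simp] theorem lift0_self (b : P1) : lift0 b b = hom0 b := by
  unfold lift0
  induction b using OnePoint.rec <;> simp [loc_coe]

@[simp] theorem lift1_self (b : P1) : lift1 b b = hom1 b := by
  unfold lift1
  induction b using OnePoint.rec <;> simp [loc_infty_infty]

theorem tendsto_lift0 (b : P1) : Tendsto (lift0 b) (𝓝 b) (𝓝 (hom0 b)) := by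
  rw [← lift0_self]
  unfold lift0
  split_ifs
  · exact tendsto_const_nhds
  · exact tendsto_loc b

theorem tendsto_lift1 (b : P1) : Tendsto (lift1 b) (𝓝 b) (𝓝 (hom1 b)) := by
  rw [← lift1_self]
  unfold lift1
  split_ifs
  · exact tendsto_loc b
  · exact tendsto_const_nhds

/-- The zero set of a multihomogeneous function is closed. -/
theorem isClosed_multihomogeneous {I : Type*} [Finite I] (Φ : (I → ℂ) → (I → ℂ) → ℂ)
    (hc : Continuous fun p : (I → ℂ) × (I → ℂ) => Φ p.1 p.2)
    (hh : ∀ s n d : I → ℂ, (∀ i, s i ≠ 0) → Φ n d = 0 →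
      Φ (fun i => s i * n i) (fun i => s i * d i) = 0) :
    IsClosed {p : I → P1 | Φ (fun i => hom0 (p i)) (fun i => hom1 (p i)) = 0} := by
  rw [← closure_subset_iff_isClosed]
  intro p hp
  rw [mem_closure_iff_nhdsWithin_neBot] at hp
  set S := {p : I → P1 | Φ (fun i => hom0 (p i)) (fun i => hom1 (p i)) = 0} with hS
  -- The functions `hom0` and `hom1` jump at `∞`, whereas the normalized lifts are continuous at
  -- `p`. The two differ by nonzero factors, so by homogeneity `Φ` also vanishes on the lifts of the
  -- points of `S` near `p`.
  have hev : ∀ᶠ q in 𝓝[S] p, Φ (fun i => lift0 (p i) (q i)) (fun i => lift1 (p i) (q i)) = 0 := by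
    have h1 : ∀ᶠ q in 𝓝[S] p, ∀ i, chart (p i) • q i ≠ ∞ := by
      rw [eventually_all]
      intro i
      exact (((continuous_apply i).tendsto p).mono_left nhdsWithin_le_nhds).eventually
        (chart_smul_ne_infty (p i))
    filter_upwards [h1, self_mem_nhdsWithin] with q hq hqS
    choose s hs h0 h1 using fun i => hom_ratio (lift_ne_zero (p i) (q i))
    have := hh s _ _ hs hqS
    convert this using 2
    · funext i; rw [h0 i, ratio_lift (hq i)]
    · funext i; rw [h1 i, ratio_lift (hq i)]
  have hlim : Tendsto (fun q : I → P1 =>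
      Φ (fun i => lift0 (p i) (q i)) (fun i => lift1 (p i) (q i))) (𝓝[S] p)
      (𝓝 (Φ (fun i => hom0 (p i)) (fun i => hom1 (p i)))) := by
    refine (hc.tendsto ((fun i => hom0 (p i)), (fun i => hom1 (p i)))).comp
      (Tendsto.prodMk_nhds ?_ ?_)
    · rw [tendsto_pi_nhds]
      intro i
      exact (tendsto_lift0 (p i)).comp
        (((continuous_apply i).tendsto p).mono_left nhdsWithin_le_nhds)
    · rw [tendsto_pi_nhds]
      intro i
      exact (tendsto_lift1 (p i)).comp
        (((continuous_apply i).tendsto p).mono_left nhdsWithin_le_nhds)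
  exact tendsto_nhds_unique (hlim.congr' hev) tendsto_const_nhds

/-! ### Trees given by a table of next vertices -/

theorem walk_eq_nil_of_isPath {V : Type*} {G : SimpleGraph V} {v : V} {p : G.Walk v v}
    (hp : p.IsPath) : p = .nil :=
  SimpleGraph.Walk.eq_nil_iff_nil.2 (SimpleGraph.Walk.isPath_iff_nil.1 hp)

/-- The table `nx v w` of the first step on the way from `v` to `w` in a tree on `Fin n`. -/
structure IsNextTable {n : ℕ} (nx : Fin n → Fin n → Fin n) : Prop where
  symm : ∀ v w, nx v w = w → nx w v = v
  step : ∀ v w w', v ≠ w → v ≠ w' → nx w w' = w' → nx v w = nx v w'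
  adj : ∀ v w, nx v (nx v w) = nx v w
  ne : ∀ v w, v ≠ w → v ≠ nx v w
  -- The bound on the number of steps makes the condition decidable, so concrete tables are verified
  -- by `decide`.
  reach : ∀ v w, ∃ k ≤ n, (fun a => nx a w)^[k] v = w

section NextTable

variable {n : ℕ} {nx : Fin n → Fin n → Fin n}

/-- The graph of a table of next vertices. -/
def tableGraph (nx : Fin n → Fin n → Fin n) (h : IsNextTable nx) : SimpleGraph (Fin n) where
  Adj v w := v ≠ w ∧ nx v w = w
  symm := ⟨fun v w hvw => ⟨hvw.1.symm, h.symm v w hvw.2⟩⟩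
  loopless := ⟨fun _ hv => hv.1 rfl⟩

/-- Consecutive vertices of the walk are adjacent and different from `v`, so `IsNextTable.step` puts
them in the same direction from `v`. -/
theorem table_eq_of_walk (h : IsNextTable nx) {v w w' : Fin n} (p : (tableGraph nx h).Walk w w')
    (hv : v ∉ p.support) : nx v w = nx v w' := by
  induction p with
  | nil => rfl
  | @cons a b c hab p ih =>
    rw [SimpleGraph.Walk.support_cons, List.mem_cons, not_or] at hv
    rw [← ih hv.2]
    exact h.step v a b hv.1 (fun e => hv.2 (e ▸ p.start_mem_support)) hab.2

theorem snd_eq_table (h : IsNextTable nx) {v w : Fin n} (p : (tableGraph nx h).Walk v w)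
    (hp : p.IsPath) (hne : v ≠ w) : p.snd = nx v w := by
  cases p with
  | nil => exact absurd rfl hne
  | @cons _ b _ hab p =>
    rw [SimpleGraph.Walk.cons_isPath_iff] at hp
    rw [SimpleGraph.Walk.snd_cons, ← table_eq_of_walk h p hp.2, hab.2]

/-- Connectedness: following the table leads from any vertex to any other. Acyclicity: the table
prescribes the second vertex of every path with given ends (`snd_eq_table`), hence by induction the
whole path. -/
theorem tableGraph_isTree [NeZero n] (h : IsNextTable nx) : (tableGraph nx h).IsTree := by
  refine ⟨?_, ?_⟩
  · have key : ∀ w k v, (fun a => nx a w)^[k] v = w → (tableGraph nx h).Reachable v w := by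
      intro w k
      induction k with
      | zero => intro v hv; exact (show v = w from hv) ▸ SimpleGraph.Reachable.refl _
      | succ k ih =>
        intro v hv
        rw [Function.iterate_succ_apply] at hv
        by_cases hvw : v = w
        · exact hvw ▸ SimpleGraph.Reachable.refl _
        · exact (SimpleGraph.Adj.reachable
            (show (tableGraph nx h).Adj v (nx v w) from ⟨h.ne v w hvw, h.adj v w⟩)).trans (ih _ hv)
    exact { preconnected := fun v w => by
              obtain ⟨k, -, hk⟩ := h.reach v w
              exact key w k v hk
            nonempty := ⟨0⟩ }
  · rw [SimpleGraph.isAcyclic_iff_subsingleton_path]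
    refine fun v w => ⟨?_⟩
    rintro ⟨p, hp⟩ ⟨q, hq⟩
    rw [Subtype.mk.injEq]
    induction p with
    | nil => exact (walk_eq_nil_of_isPath hq).symm
    | @cons a b c hab p ih =>
      have hac : a ≠ c := by
        rintro rfl
        simp at hp
      have h1 := snd_eq_table h _ hp hac
      have h2 := snd_eq_table h _ hq hac
      cases q with
      | nil => exact absurd rfl hac
      | @cons _ b' _ hab' q =>
        rw [SimpleGraph.Walk.snd_cons] at h1 h2
        obtain rfl : b = b' := h1.trans h2.symm
        rw [SimpleGraph.Walk.cons_isPath_iff] at hp hq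
        rw [ih hp.1 q hq.1]

end NextTable

/-- A marked curve with `n` components given by a table of next vertices, the positions of the
nodes, and the positions of the marked points. -/
structure CurveTable (A : Type) (n : ℕ) where
  nx : Fin n → Fin n → Fin n
  isNext : IsNextTable nx
  node : Fin n → Fin n → P1
  pos : A → Fin n
  pt : A → P1
  node_inj : ∀ v w w', v ≠ w → nx v w = w → v ≠ w' → nx v w' = w' → node v w = node v w' → w = w'
  mark_inj : ∀ a b, pos a = pos b → pt a = pt b → a = b
  mark_ne : ∀ a w, pos a ≠ w → nx (pos a) w = w → pt a ≠ node (pos a) w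

namespace CurveTable

variable {A : Type} {n : ℕ} (T : CurveTable A n)

/-- Adjacency of components. -/
abbrev Adj (v w : Fin n) : Prop := v ≠ w ∧ T.nx v w = w

/-- The marked curve given by a table. -/
def curve [NeZero n] : MarkedCurve A where
  Comp := Fin n
  finite := inferInstance
  graph := tableGraph T.nx T.isNext
  isTree := tableGraph_isTree T.isNext
  node := T.node
  node_inj := fun v w w' h1 h2 => T.node_inj v w w' h1.1 h1.2 h2.1 h2.2
  mark := fun a => (T.pos a, T.pt a)
  mark_inj := fun a b hab => T.mark_inj a b (Prod.mk.inj hab).1 (Prod.mk.inj hab).2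
  mark_ne_node := fun a w hw => T.mark_ne a w hw.1 hw.2

/-- The position of a marked point as seen from a component. -/
def proj (v : Fin n) (a : A) : P1 :=
  if T.pos a = v then T.pt a else T.node v (T.nx v (T.pos a))

/-- The abstract projection goes through a chosen path in the tree; the table makes it an explicit
value that `simp` can evaluate. -/
theorem curve_proj [NeZero n] (v : Fin n) (a : A) :
    T.curve.proj v (T.curve.mark a) = T.proj v a := by
  unfold MarkedCurve.proj proj
  by_cases hv : T.pos a = v
  · rw [if_pos hv]; exact if_pos hv
  · rw [if_neg hv]
    refine (if_neg hv).trans (congrArg (T.node v) ?_)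
    obtain ⟨p, hp, -⟩ := (tableGraph_isTree T.isNext).existsUnique_path v (T.pos a)
    exact (MarkedCurve.next_eq T.curve p hp).trans (snd_eq_table T.isNext p hp (Ne.symm hv))

theorem isStable [NeZero n]
    (h : ∀ v, ∃ a b c, a ≠ b ∧ a ≠ c ∧ b ≠ c ∧ ∀ p, p = a ∨ p = b ∨ p = c →
      (∃ w, T.Adj v w ∧ p = T.node v w) ∨ ∃ l, T.pos l = v ∧ T.pt l = p) :
    T.curve.IsStable := by
  intro v
  obtain ⟨a, b, c, hab, hac, hbc, h⟩ := h v
  have hsub : ({a, b, c} : Set P1) ⊆ T.curve.special v := by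
    intro p hp
    rcases h p hp with ⟨w, hw, e⟩ | ⟨l, e1, e2⟩
    · exact Or.inl ⟨w, hw, e⟩
    · exact Or.inr ⟨l, Prod.ext e1 e2⟩
  refine le_trans (le_of_eq ?_) (Set.encard_le_encard hsub)
  rw [Set.encard_insert_of_notMem (by simp [hab, hac]), Set.encard_insert_of_notMem (by simp [hbc]),
    Set.encard_singleton]
  norm_num

end CurveTable

/-! ### Medians -/

namespace MarkedCurve

variable {A : Type} {C : MarkedCurve A}

theorem dist_next (C : MarkedCurve A) {v w : C.Comp} (h : v ≠ w) :
    C.graph.dist (C.next v w) w < C.graph.dist v w := by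
  obtain ⟨p, hp, hl⟩ := C.isTree.connected.exists_path_of_dist v w
  rw [C.next_eq p hp, ← hl]
  cases p with
  | nil => exact absurd rfl h
  | cons hab p =>
    rw [SimpleGraph.Walk.snd_cons, SimpleGraph.Walk.length_cons]
    exact Nat.lt_succ_of_le (SimpleGraph.dist_le p)

/-- If two different marked points have the same projection to `v`, both of them lie in the
direction of the same neighbour of `v`. -/
theorem exists_adj_of_proj_eq (C : MarkedCurve A) {v : C.Comp} {a b : A} (hab : a ≠ b)
    (h : C.proj v (C.mark a) = C.proj v (C.mark b)) :
    ∃ w, C.graph.Adj v w ∧ C.graph.dist w (C.mark a).1 < C.graph.dist v (C.mark a).1 ∧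
      C.graph.dist w (C.mark b).1 < C.graph.dist v (C.mark b).1 := by
  unfold proj at h
  by_cases ha : (C.mark a).1 = v <;> by_cases hb : (C.mark b).1 = v
  · rw [if_pos ha, if_pos hb] at h
    exact absurd (C.mark_inj (Prod.ext (ha.trans hb.symm) h)) hab
  · rw [if_pos ha, if_neg hb] at h
    exact absurd (ha ▸ h) (C.mark_ne_node a _ (ha ▸ C.adj_next (Ne.symm hb)))
  · rw [if_neg ha, if_pos hb] at h
    exact absurd (hb ▸ h.symm) (C.mark_ne_node b _ (hb ▸ C.adj_next (Ne.symm ha)))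
  · rw [if_neg ha, if_neg hb] at h
    have e := C.node_inj _ _ _ (C.adj_next (Ne.symm ha)) (C.adj_next (Ne.symm hb)) h
    refine ⟨_, C.adj_next (Ne.symm ha), C.dist_next (Ne.symm ha), ?_⟩
    rw [e]
    exact C.dist_next (Ne.symm hb)

/-- Three different marked points have distinct projections to some component. -/
theorem exists_isMedian (C : MarkedCurve A) {a b c : A} (hab : a ≠ b) (hac : a ≠ c) (hbc : b ≠ c) :
    ∃ v, C.IsMedian a b c v := by
  have := C.finite
  have : Nonempty C.Comp := ⟨(C.mark a).1⟩
  -- The median minimizes the sum of the distances to the three components. If two of the marks had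
  -- the same projection, one step in their common direction would shorten two distances and
  -- lengthen the third by at most one.
  obtain ⟨v, hv⟩ := Finite.exists_min (fun v => C.graph.dist v (C.mark a).1 +
    C.graph.dist v (C.mark b).1 + C.graph.dist v (C.mark c).1)
  have key : ∀ w x, C.graph.Adj v w → C.graph.dist w x ≤ C.graph.dist v x + 1 := by
    intro w x h
    have := C.isTree.connected.dist_triangle (u := w) (v := v) (w := x)
    rw [SimpleGraph.dist_eq_one_iff_adj.2 h.symm] at this
    omega
  refine ⟨v, fun h => ?_, fun h => ?_, fun h => ?_⟩
  · obtain ⟨w, hw, h1, h2⟩ := C.exists_adj_of_proj_eq hab h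
    have := hv w; have := key w (C.mark c).1 hw; omega
  · obtain ⟨w, hw, h1, h2⟩ := C.exists_adj_of_proj_eq hac h
    have := hv w; have := key w (C.mark b).1 hw; omega
  · obtain ⟨w, hw, h1, h2⟩ := C.exists_adj_of_proj_eq hbc h
    have := hv w; have := key w (C.mark a).1 hw; omega

theorem cross_of_not_isMedian {a b c : A} (h : ¬ ∃ v, C.IsMedian a b c v) (d : A) :
    C.cross a b c d = ∞ := by
  rw [cross, dif_neg h]

theorem cross_of_eq {a b c : A} (h : a = b ∨ a = c ∨ b = c) (d : A) : C.cross a b c d = ∞ := by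
  apply cross_of_not_isMedian
  rintro ⟨v, h1, h2, h3⟩
  rcases h with rfl | rfl | rfl
  exacts [h1 rfl, h2 rfl, h3 rfl]

/-- The points `m a` are, up to a Möbius transformation, the projections of the marked points of `C`
to one of its components. -/
def Realizes (C : MarkedCurve A) (m : A → P1) : Prop :=
  ∃ (v : C.Comp) (g : Moeb), ∀ a, m a = g • C.proj v (C.mark a)

/-- Distinctness of the three values shows that the realizing component is the median, on which the
cross ratio is computed; the Möbius factor then drops out. -/
theorem Realizes.cross_eq {m : A → P1} (h : C.Realizes m) {a b c : A} (hab : m a ≠ m b)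
    (hac : m a ≠ m c) (hbc : m b ≠ m c) (d : A) :
    C.cross a b c d = crossRatio (m a) (m b) (m c) (m d) := by
  obtain ⟨v, g, hg⟩ := h
  have hm : C.IsMedian a b c v := by
    refine ⟨fun e => hab ?_, fun e => hac ?_, fun e => hbc ?_⟩ <;> rw [hg, hg, e]
  rw [MarkedCurve.cross_eq hm, hg a, hg b, hg c, hg d, crossRatio_smul]

theorem realizes_of_proj (v : C.Comp) {m : A → P1} (h : ∀ a, C.proj v (C.mark a) = m a) :
    C.Realizes m := ⟨v, 1, fun a => by rw [one_smul, h]⟩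

theorem smoothCurve_proj {m : A → P1} (hm : Function.Injective m) (v : Unit) (a : A) :
    (smoothCurve m hm).proj v ((smoothCurve m hm).mark a) = m a := by
  unfold proj
  exact if_pos rfl

/-- The hypothesis `e` is the comparison with the Möbius image after clearing denominators, so that
each use reduces to polynomial or rational identities, one for every mark. The coordinates of the
image cannot both vanish because the determinant does not. -/
theorem realizes_of_ratio (v : C.Comp) {α β γ δ : ℂ}
    (hdet : α * δ - β * γ ≠ 0) {n d n' d' : A → ℂ} (h : ∀ a, n a ≠ 0 ∨ d a ≠ 0)
    (h' : ∀ a, n' a ≠ 0 ∨ d' a ≠ 0) (hmn : ∀ a, C.proj v (C.mark a) = ratio (n a) (d a))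
    (e : ∀ a, n' a * (γ * n a + δ * d a) = d' a * (α * n a + β * d a)) :
    C.Realizes fun a => ratio (n' a) (d' a) := by
  refine ⟨v, mkMoeb α β γ δ hdet, fun a => ?_⟩
  rw [hmn, mkMoeb_smul_ratio hdet (h a)]
  refine ratio_eq_ratio (h' a) ?_ (by linear_combination e a)
  by_contra hcon
  rw [not_or, not_not, not_not] at hcon
  obtain ⟨h0, h1⟩ := hcon
  rcases h a with hn | hn
  · apply mul_ne_zero hdet hn; linear_combination δ * h0 - β * h1
  · apply mul_ne_zero hdet hn; linear_combination α * h1 - γ * h0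

end MarkedCurve

/-! ### The stabilization of a curve with four marked points -/

/-- The stable curve with two components on which the four points `a` of `A` are distributed by the
first entry of `σ a`. -/
def splitCurve {A : Type} (σ : A ≃ Bool × Bool) : MarkedCurve A where
  Comp := Bool
  finite := inferInstance
  graph := ⊤
  isTree := by
    rw [SimpleGraph.isTree_iff_existsUnique_path]
    refine ⟨inferInstance, fun v w => ?_⟩
    by_cases h : v = w
    · subst h
      exact ⟨.nil, by simp, fun p hp => walk_eq_nil_of_isPath hp⟩
    · refine ⟨.cons (show (⊤ : SimpleGraph Bool).Adj v w from h) .nil, by simp [h], ?_⟩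
      intro p hp
      cases p with
      | nil => exact absurd rfl h
      | @cons _ b _ hab p =>
        rw [SimpleGraph.Walk.cons_isPath_iff] at hp
        obtain rfl : b = w := by
          have : v ≠ b := hab.ne
          revert h this; cases v <;> cases b <;> cases w <;> simp
        rw [walk_eq_nil_of_isPath hp.1]
  node := fun _ _ => ∞
  node_inj := by
    intro v w w' h h' _
    have := h.ne; have := h'.ne
    revert v w w'; decide
  mark := fun a => ((σ a).1, if (σ a).2 then ((1 : ℂ) : P1) else ((0 : ℂ) : P1))
  mark_inj := by
    intro a b h
    apply σ.injective
    rw [Prod.mk.injEq] at h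
    refine Prod.ext h.1 ?_
    revert h
    cases (σ a).2 <;> cases (σ b).2 <;> simp
  mark_ne_node := by
    intro a w _
    cases (σ a).2 <;> simp

theorem splitCurve_proj {A : Type} (σ : A ≃ Bool × Bool) (v : Bool) (a : A) :
    (splitCurve σ).proj v ((splitCurve σ).mark a) =
      if (σ a).1 = v then (if (σ a).2 then ((1 : ℂ) : P1) else ((0 : ℂ) : P1)) else ∞ := by
  unfold MarkedCurve.proj
  by_cases h : (σ a).1 = v
  · rw [if_pos h]; exact if_pos h
  · rw [if_neg h]; exact if_neg h

theorem splitCurve_isStable {A : Type} (σ : A ≃ Bool × Bool) : (splitCurve σ).IsStable := by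
  intro v
  have hsub : ({((0 : ℂ) : P1), ((1 : ℂ) : P1), ∞} : Set P1) ⊆ (splitCurve σ).special v := by
    rintro p (rfl | rfl | rfl)
    · exact Or.inr ⟨σ.symm (v, false), by simp [splitCurve]⟩
    · exact Or.inr ⟨σ.symm (v, true), by simp [splitCurve]⟩
    · exact Or.inl ⟨!v, by cases v <;> simp [splitCurve], rfl⟩
  refine le_trans (le_of_eq ?_) (Set.encard_le_encard hsub)
  rw [Set.encard_insert_of_notMem (by simp), Set.encard_insert_of_notMem (by simp),
    Set.encard_singleton]
  norm_num

/-- A four-pointed curve with two components has no moduli. It suffices to find, for each half of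
the splitting, a component from which the two marks of that half and the common image of the other
two are three different points; a Möbius transformation normalizes these to 0, 1, ∞. -/
theorem isStabilization_splitCurve {A : Type} (σ : A ≃ Bool × Bool) (C : MarkedCurve A)
    (e : Bool → C.Comp) (he : ∀ v, C.proj (e v) (C.mark (σ.symm (v, false))) ≠
        C.proj (e v) (C.mark (σ.symm (v, true))) ∧
      C.proj (e v) (C.mark (σ.symm (!v, false))) = C.proj (e v) (C.mark (σ.symm (!v, true))) ∧
      C.proj (e v) (C.mark (σ.symm (v, false))) ≠ C.proj (e v) (C.mark (σ.symm (!v, false))) ∧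
      C.proj (e v) (C.mark (σ.symm (v, true))) ≠ C.proj (e v) (C.mark (σ.symm (!v, false)))) :
    C.IsStabilization (splitCurve σ) := by
  refine ⟨splitCurve_isStable σ, e, ?_⟩
  choose g h0 h1 h2 using fun v => exists_moeb (he v).1 (he v).2.2.1 (he v).2.2.2
  suffices key : ∀ (v : Bool) a, C.proj (e v) (C.mark a) = g v •
      if (σ a).1 = v then (if (σ a).2 then ((1 : ℂ) : P1) else ((0 : ℂ) : P1)) else ∞ from
    ⟨g, fun v a => (key v a).trans (congrArg (g v • ·) (splitCurve_proj σ v a).symm)⟩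
  intro v a
  obtain ⟨⟨i, j⟩, rfl⟩ := σ.symm.surjective a
  rw [Equiv.apply_symm_apply]
  by_cases hi : i = v
  · subst hi
    cases j
    · simp [h0]
    · simp [h1]
  · obtain rfl : i = !v := by revert hi; cases i <;> cases v <;> simp
    rw [if_neg hi, h2]
    cases j
    · rfl
    · exact (he v).2.1.symm

/-! ### The identity and the squaring map -/

/-- The identity (`false`) and the squaring map (`true`) of the projective line. -/
def powMap : Bool → RatMap
  | false => ⟨X, 1, isCoprime_one_right, by simp⟩
  | true => ⟨X ^ 2, 1, isCoprime_one_right, by simp⟩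

/-- The values of `powMap`. -/
def pw : Bool → P1 → P1
  | false, p => p
  | true, ∞ => ∞
  | true, OnePoint.some t => ((t ^ 2 : ℂ) : P1)

@[simp] theorem pw_false (p : P1) : pw false p = p := rfl
@[simp] theorem pw_true_infty : pw true ∞ = ∞ := rfl
@[simp] theorem pw_true_coe (t : ℂ) : pw true (t : P1) = ((t ^ 2 : ℂ) : P1) := rfl

open Classical in
/-- The local degrees of `powMap`. -/
def pwDeg : Bool → P1 → ℕ
  | false, _ => 1
  | true, p => if p = ∞ ∨ p = ((0 : ℂ) : P1) then 2 else 1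

theorem powMap_degree (b : Bool) : (powMap b).degree = if b then 2 else 1 := by
  cases b <;> simp [RatMap.degree, powMap]

theorem powMap_eval (b : Bool) (p : P1) : (powMap b).eval p = pw b p := by
  cases b <;> induction p using OnePoint.rec with
  | infty => simp [RatMap.eval, RatMap.degree, powMap, coeff_one]
  | coe t => simp [RatMap.eval, powMap]

theorem powMap_localDeg (b : Bool) (p : P1) : (powMap b).localDeg p = pwDeg b p := by
  induction p using OnePoint.rec with
  | infty =>
    have h : (powMap b).localDeg ∞ =
      (powMap b).degree - ((powMap b).fibrePoly ((powMap b).eval ∞)).natDegree := rfl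
    rw [h, powMap_eval, powMap_degree]
    cases b <;> simp [RatMap.fibrePoly, pwDeg, powMap]
  | coe t =>
    have h : (powMap b).localDeg t =
      ((powMap b).fibrePoly ((powMap b).eval t)).rootMultiplicity t := rfl
    rw [h, powMap_eval]
    cases b
    · simp only [pw_false, RatMap.fibrePoly, powMap, pwDeg]
      rw [mul_one, rootMultiplicity_X_sub_C_self]
    · have h1 : (powMap true).fibrePoly (pw true t) = (X - C t) * (X - C (-t)) := by
        simp only [pw_true_coe, RatMap.fibrePoly, powMap, C_neg, C_pow]; ring
      rw [h1, rootMultiplicity_mul (mul_ne_zero (X_sub_C_ne_zero _) (X_sub_C_ne_zero _)),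
        rootMultiplicity_X_sub_C_self, rootMultiplicity_X_sub_C]
      by_cases ht : t = 0
      · simp [ht, pwDeg]
      · have : t ≠ -t := fun e => ht (self_eq_neg.1 e)
        simp [ht, this, pwDeg]

/-! ### Coverings given by tables -/

theorem finsum_powMap_degree {n m : ℕ} (comp : Fin n → Fin m) (sq : Fin n → Bool) (a : Fin m) :
    ∑ᶠ v ∈ comp ⁻¹' {a}, (powMap (sq v)).degree =
      ∑ v, (if comp v = a then (if sq v then 2 else 1) else 0) := by
  rw [finsum_mem_def]
  refine (finsum_eq_sum_of_fintype _).trans (Finset.sum_congr rfl fun v _ => ?_)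
  by_cases h : comp v = a
  · rw [Set.indicator_of_mem (show v ∈ comp ⁻¹' {a} from h), if_pos h, powMap_degree]
  · rw [Set.indicator_of_notMem (show v ∉ comp ⁻¹' {a} from h), if_neg h]

section TableDiagram

variable {n m : ℕ} [NeZero n] [NeZero m]

/-- A covering of curves given by tables, all of whose component maps are the identity or the
squaring map. -/
def tableDiagram (U : CurveTable LP n) (L : CurveTable LB m) (comp : Fin n → Fin m)
    (sq : Fin n → Bool)
    (stable : L.curve.IsStable)
    (degree : ∀ a, ∑ v, (if comp v = a then (if sq v then 2 else 1) else 0) = 2)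
    (node_adj : ∀ v w, U.Adj v w → L.Adj (comp v) (comp w))
    (node_map : ∀ v w, U.Adj v w → pw (sq v) (U.node v w) = L.node (comp v) (comp w))
    (node_preimage : ∀ v b p, L.Adj (comp v) b → pw (sq v) p = L.node (comp v) b →
      ∃ w, U.Adj v w ∧ comp w = b ∧ p = U.node v w)
    (balanced : ∀ v w, U.Adj v w → pwDeg (sq v) (U.node v w) = pwDeg (sq w) (U.node w v))
    (mark_map : ∀ l : LP, L.pos l.f = comp (U.pos l) ∧ L.pt l.f = pw (sq (U.pos l)) (U.pt l))
    (ramified : ∀ v p, (comp v = L.pos .inf ∧ pw (sq v) p = L.pt .inf) ∨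
      (comp v = L.pos .z ∧ pw (sq v) p = L.pt .z) → pwDeg (sq v) p = 2)
    (unramified : ∀ v p, (∀ w, U.Adj v w → p ≠ U.node v w) →
      ¬ (comp v = L.pos .inf ∧ pw (sq v) p = L.pt .inf) →
      ¬ (comp v = L.pos .z ∧ pw (sq v) p = L.pt .z) → pwDeg (sq v) p = 1) : Diagram where
  upper := U.curve
  lower := L.curve
  stable := stable
  comp := comp
  map := fun v => powMap (sq v)
  degree_eq := fun a => (finsum_powMap_degree comp sq a).trans (degree a)
  node_adj := node_adj
  node_map := fun v w h => (powMap_eval _ _).trans (node_map v w h)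
  node_preimage := fun v b p h e => node_preimage v b p h ((powMap_eval _ _).symm.trans e)
  balanced := fun v w h => by
    rw [powMap_localDeg, powMap_localDeg]; exact balanced v w h
  mark_map := fun l => Prod.ext (mark_map l).1 ((mark_map l).2.trans (powMap_eval _ _).symm)
  ramified := fun v p h => by
    rw [powMap_localDeg]
    refine ramified v p (h.imp (fun e => ?_) fun e => ?_) <;>
    · rw [powMap_eval] at e
      exact Prod.mk.inj e
  unramified := fun v p h h1 h2 => by
    rw [powMap_localDeg]
    refine unramified v p h (fun e => h1 ?_) (fun e => h2 ?_) <;>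
    · rw [powMap_eval]
      exact Prod.ext e.1 e.2

end TableDiagram

/-! ### The coverings over the special points -/

theorem pw_true_eq_infty {p : P1} : pw true p = ∞ ↔ p = ∞ := by
  induction p using OnePoint.rec <;> simp

theorem pw_true_eq_zero {p : P1} : pw true p = ((0 : ℂ) : P1) ↔ p = ((0 : ℂ) : P1) := by
  induction p using OnePoint.rec <;> simp

theorem pw_true_eq_one {p : P1} :
    pw true p = ((1 : ℂ) : P1) ↔ p = ((-1 : ℂ) : P1) ∨ p = ((1 : ℂ) : P1) := by
  induction p using OnePoint.rec with
  | infty => simp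
  | coe t => simp only [pw_true_coe, coe_eq_coe, sq_eq_one_iff, or_comm]

theorem isNextTable_pair : IsNextTable (n := 2) ![![0, 1], ![0, 1]] :=
  ⟨by decide, by decide, by decide, by decide, by decide⟩

theorem isNextTable_star3 : IsNextTable (n := 3) ![![0, 1, 2], ![0, 1, 0], ![0, 0, 2]] :=
  ⟨by decide, by decide, by decide, by decide, by decide⟩

theorem isNextTable_star4 :
    IsNextTable (n := 4) ![![0, 1, 2, 3], ![0, 1, 0, 0], ![0, 0, 2, 0], ![0, 0, 0, 3]] :=
  ⟨by decide, by decide, by decide, by decide, by decide⟩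

theorem isNextTable_path3 : IsNextTable (n := 3) ![![0, 1, 1], ![0, 1, 2], ![1, 1, 2]] :=
  ⟨by decide, by decide, by decide, by decide, by decide⟩

theorem isNextTable_path5 : IsNextTable (n := 5) ![![0, 1, 2, 1, 2], ![0, 1, 0, 3, 0],
    ![0, 0, 2, 0, 4], ![1, 1, 1, 3, 1], ![2, 2, 2, 2, 4]] :=
  ⟨by decide, by decide, by decide, by decide, by decide⟩

/-- The parameters `u` of the coverings with components `{∞, y, z}` and `{0, 1}`. -/
structure GoodU (u : ℂ) : Prop where
  u0 : u ≠ 0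
  u1 : u + 1 ≠ 0
  u2 : 2 * u + 1 ≠ 0

/-- The parameters `w` of the coverings with components `{0, 1, z}` and `{y, ∞}`. -/
structure GoodW (w : ℂ) : Prop where
  w0 : w ≠ 0
  w1 : w ≠ 1
  w2 : w ≠ -1

/-- The upper curve of the covering with components `{∞, y, z}` and `{0, 1}`. -/
def upperU (u : ℂ) (h : GoodU u) : CurveTable LP 3 where
  nx := ![![0, 1, 2], ![0, 1, 0], ![0, 0, 2]]
  isNext := isNextTable_star3
  -- For x → ∞ and y / x → u one has r → u + 1. The component 0 carries the limit of T = (2r - t)/t,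
  -- in which 1 + 4rF/x tends to T². The points ∞ and x collide at T = -1, and the points `inf'` and
  -- `x'`, both tending to t = r, collide at T = 1; a component of degree one grows at each of these
  -- nodes.
  node := ![![∞, ((-1 : ℂ) : P1), ((1 : ℂ) : P1)], ![∞, ∞, ∞], ![∞, ∞, ∞]]
  pos := fun
    | .zero => 0 | .one => 0 | .crit => 0 | .one' => 0
    | .inf => 1 | .x => 1 | .inf' => 2 | .x' => 2
  pt := fun
    | .zero => ∞ | .one => ((2 * u + 1 : ℂ) : P1) | .crit => ((0 : ℂ) : P1)
    | .one' => ((-(2 * u + 1) : ℂ) : P1)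
    | .inf => ((1 : ℂ) : P1) | .x => ((0 : ℂ) : P1) | .inf' => ((1 : ℂ) : P1) | .x' => ((0 : ℂ) : P1)
  node_inj := by
    intro v w w'
    fin_cases v <;> fin_cases w <;> fin_cases w' <;> simp
    all_goals norm_num
  mark_inj := by
    intro a b
    have := h.u2
    cases a <;> cases b <;> simp
    all_goals grind
  mark_ne := by
    intro a w
    have := h.u0
    have := h.u1
    cases a <;> fin_cases w <;> simp
    all_goals grind

/-- The lower curve of the covering with components `{∞, y, z}` and `{0, 1}`. -/
def lowerU (u : ℂ) (h : GoodU u) : CurveTable LB 2 where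
  nx := ![![0, 1], ![0, 1]]
  isNext := isNextTable_pair
  node := ![![∞, ((1 : ℂ) : P1)], ![∞, ∞]]
  pos := fun | .zero => 1 | .one => 1 | .inf => 0 | .y => 0 | .z => 0
  pt := fun
    | .zero => ((0 : ℂ) : P1) | .one => ((1 : ℂ) : P1) | .inf => ∞
    | .y => (((2 * u + 1) ^ 2 : ℂ) : P1) | .z => ((0 : ℂ) : P1)
  node_inj := by
    intro v w w'
    fin_cases v <;> fin_cases w <;> fin_cases w' <;> simp
  mark_inj := by
    intro a b
    have := h.u2
    cases a <;> cases b <;> simp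
    all_goals grind
  mark_ne := by
    intro a w
    have := h.u0
    have := h.u1
    cases a <;> fin_cases w <;> simp
    all_goals grind

/-- The covering with components `{∞, y, z}` and `{0, 1}`. -/
def diagramU (u : ℂ) (h : GoodU u) : Diagram :=
  tableDiagram (upperU u h) (lowerU u h) ![0, 1, 1] ![true, false, false]
    (by
      refine CurveTable.isStable _ fun v => ?_
      fin_cases v
      · refine ⟨∞, ((0 : ℂ) : P1), ((1 : ℂ) : P1), by simp, by simp, by simp, ?_⟩
        rintro p (rfl | rfl | rfl)
        exacts [Or.inr ⟨.inf, rfl, rfl⟩, Or.inr ⟨.z, rfl, rfl⟩, Or.inl ⟨1, ⟨by decide, rfl⟩, rfl⟩]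
      · refine ⟨∞, ((0 : ℂ) : P1), ((1 : ℂ) : P1), by simp, by simp, by simp, ?_⟩
        rintro p (rfl | rfl | rfl)
        exacts [Or.inl ⟨0, ⟨by decide, rfl⟩, rfl⟩, Or.inr ⟨.zero, rfl, rfl⟩, Or.inr ⟨.one, rfl, rfl⟩])
    (by decide)
    (by
      intro v w
      fin_cases v <;> fin_cases w <;> simp [CurveTable.Adj, upperU, lowerU])
    (by
      intro v w
      fin_cases v <;> fin_cases w <;> simp [CurveTable.Adj, upperU, lowerU])
    (by
      intro v b p
      fin_cases v <;> fin_cases b <;>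
        simp [CurveTable.Adj, upperU, lowerU, pw_true_eq_one, Fin.exists_fin_succ])
    (by
      intro v w
      fin_cases v <;> fin_cases w <;> simp [CurveTable.Adj, upperU, pwDeg])
    (by
      intro l
      cases l <;> simp [upperU, lowerU, LP.f]
      ring)
    (by
      intro v p
      fin_cases v <;> simp [lowerU, pwDeg, pw_true_eq_infty, pw_true_eq_zero]
      tauto)
    (by
      intro v p
      fin_cases v <;> simp [lowerU, pwDeg, pw_true_eq_infty, pw_true_eq_zero]
      tauto)

/-- The upper curve of the covering with components `{0, 1, z}` and `{y, ∞}`. -/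
def upperW (w : ℂ) (h : GoodW w) : CurveTable LP 2 where
  nx := ![![0, 1], ![0, 1]]
  isNext := isNextTable_pair
  -- Here y grows like w x² and r like w x. In s = x/t the limit of F is (1 - s)(1 - w s), and T =
  -- 2ws - (1 + w) completes the square: T² = 4w(F - 1) + (1 + w)². This is the coordinate on the
  -- component 0. The component 1 carries 1/t, because F is close to xr/t² when t stays bounded.
  node := ![![∞, ∞], ![((0 : ℂ) : P1), ∞]]
  pos := fun
    | .zero => 1 | .one => 1 | .one' => 1
    | .crit => 0 | .inf => 0 | .x => 0 | .inf' => 0 | .x' => 0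
  pt := fun
    | .zero => ∞ | .one => ((1 : ℂ) : P1) | .one' => ((-1 : ℂ) : P1) | .crit => ((0 : ℂ) : P1)
    | .inf => ((-(1 + w) : ℂ) : P1) | .inf' => ((1 + w : ℂ) : P1)
    | .x => ((w - 1 : ℂ) : P1) | .x' => ((1 - w : ℂ) : P1)
  node_inj := by
    intro v w w'
    fin_cases v <;> fin_cases w <;> fin_cases w' <;> simp
  mark_inj := by
    intro a b
    have := h.w0
    have := h.w1
    have := h.w2
    cases a <;> cases b <;> simp
    all_goals grind
  mark_ne := by
    intro a w
    cases a <;> fin_cases w <;> simp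

/-- The lower curve of the covering with components `{0, 1, z}` and `{y, ∞}`. -/
def lowerW (w : ℂ) (h : GoodW w) : CurveTable LB 2 where
  nx := ![![0, 1], ![0, 1]]
  isNext := isNextTable_pair
  node := ![![∞, ∞], ![((0 : ℂ) : P1), ∞]]
  pos := fun | .zero => 0 | .one => 0 | .z => 0 | .inf => 1 | .y => 1
  pt := fun
    | .zero => (((1 - w) ^ 2 : ℂ) : P1) | .one => (((1 + w) ^ 2 : ℂ) : P1) | .inf => ∞
    | .y => ((1 : ℂ) : P1) | .z => ((0 : ℂ) : P1)
  node_inj := by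
    intro v w w'
    fin_cases v <;> fin_cases w <;> fin_cases w' <;> simp
  mark_inj := by
    intro a b
    have := h.w0
    have := h.w1
    have := h.w2
    cases a <;> cases b <;> simp
    all_goals grind
  mark_ne := by
    intro a w
    cases a <;> fin_cases w <;> simp

/-- The covering with components `{0, 1, z}` and `{y, ∞}`. -/
def diagramW (w : ℂ) (h : GoodW w) : Diagram :=
  tableDiagram (upperW w h) (lowerW w h) ![0, 1] ![true, true]
    (by
      refine CurveTable.isStable _ fun v => ?_
      have h2 : (1 + w) ^ 2 ≠ 0 := pow_ne_zero 2 fun e => h.w2 (by linear_combination e)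
      fin_cases v
      · refine ⟨∞, ((0 : ℂ) : P1), (((1 + w) ^ 2 : ℂ) : P1), by simp, by simp,
          fun e => h2 (coe_eq_coe.1 e).symm, ?_⟩
        rintro p (rfl | rfl | rfl)
        exacts [Or.inl ⟨1, ⟨by decide, rfl⟩, rfl⟩, Or.inr ⟨.z, rfl, rfl⟩, Or.inr ⟨.one, rfl, rfl⟩]
      · refine ⟨∞, ((0 : ℂ) : P1), ((1 : ℂ) : P1), by simp, by simp, by simp, ?_⟩
        rintro p (rfl | rfl | rfl)
        exacts [Or.inr ⟨.inf, rfl, rfl⟩, Or.inl ⟨0, ⟨by decide, rfl⟩, rfl⟩, Or.inr ⟨.y, rfl, rfl⟩])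
    (by decide)
    (by
      intro v w
      fin_cases v <;> fin_cases w <;> simp [CurveTable.Adj, upperW, lowerW])
    (by
      intro v w
      fin_cases v <;> fin_cases w <;> simp [CurveTable.Adj, upperW, lowerW])
    (by
      intro v b p
      fin_cases v <;> fin_cases b <;>
        simp [CurveTable.Adj, upperW, lowerW, pw_true_eq_zero, pw_true_eq_infty, Fin.exists_fin_succ])
    (by
      intro v w
      fin_cases v <;> fin_cases w <;> simp [CurveTable.Adj, upperW, pwDeg])
    (by
      intro l
      cases l <;> simp [upperW, lowerW, LP.f]
      all_goals ring)
    (by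
      intro v p
      fin_cases v <;> simp +contextual [lowerW, pwDeg, pw_true_eq_infty, pw_true_eq_zero])
    (by
      intro v p
      fin_cases v <;>
        simp +contextual [CurveTable.Adj, upperW, lowerW, pwDeg, pw_true_eq_infty, pw_true_eq_zero, Fin.forall_fin_succ])

/-- The upper curve of the covering with components `{0, 1}`, `{z}` and `{y, ∞}`. -/
def upperCorner : CurveTable LP 4 where
  nx := ![![0, 1, 2, 3], ![0, 1, 0, 0], ![0, 0, 2, 0], ![0, 0, 0, 3]]
  isNext := isNextTable_star4
  -- Common degeneration of the two families. From the first, as u → ∞ the marks at ±(2u + 1) run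
  -- into the mark `zero` at ∞; from the second, as w → 0 the pairs at -1 ∓ w and at 1 ± w collide
  -- at -1 and at 1.
  node := ![![∞, ∞, ((-1 : ℂ) : P1), ((1 : ℂ) : P1)], fun _ => ((0 : ℂ) : P1), fun _ => ∞, fun _ => ∞]
  pos := fun
    | .crit => 0 | .zero => 1 | .one => 1 | .one' => 1
    | .inf => 2 | .x => 2 | .inf' => 3 | .x' => 3
  pt := fun
    | .zero => ∞ | .one => ((1 : ℂ) : P1) | .one' => ((-1 : ℂ) : P1) | .crit => ((0 : ℂ) : P1)
    | .inf => ((1 : ℂ) : P1) | .x => ((0 : ℂ) : P1) | .inf' => ((1 : ℂ) : P1) | .x' => ((0 : ℂ) : P1)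
  node_inj := by
    intro v w w'
    fin_cases v <;> fin_cases w <;> fin_cases w' <;> simp
    all_goals norm_num
  mark_inj := by
    intro a b
    cases a <;> cases b <;> simp
    all_goals norm_num
  mark_ne := by
    intro a w
    cases a <;> fin_cases w <;> simp

/-- The lower curve of the covering with components `{0, 1}`, `{z}` and `{y, ∞}`. -/
def lowerCorner : CurveTable LB 3 where
  nx := ![![0, 1, 2], ![0, 1, 0], ![0, 0, 2]]
  isNext := isNextTable_star3
  node := ![![∞, ∞, ((1 : ℂ) : P1)], fun _ => ((0 : ℂ) : P1), fun _ => ∞]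
  pos := fun | .z => 0 | .inf => 1 | .y => 1 | .zero => 2 | .one => 2
  pt := fun
    | .zero => ((0 : ℂ) : P1) | .one => ((1 : ℂ) : P1) | .inf => ∞
    | .y => ((1 : ℂ) : P1) | .z => ((0 : ℂ) : P1)
  node_inj := by
    intro v w w'
    fin_cases v <;> fin_cases w <;> fin_cases w' <;> simp
  mark_inj := by
    intro a b
    cases a <;> cases b <;> simp
  mark_ne := by
    intro a w
    cases a <;> fin_cases w <;> simp

/-- The covering with components `{0, 1}`, `{z}` and `{y, ∞}`. -/
def diagramCorner : Diagram :=
  tableDiagram upperCorner lowerCorner ![0, 1, 2, 2] ![true, true, false, false]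
    (by
      refine CurveTable.isStable _ fun v => ?_
      refine ⟨∞, ((0 : ℂ) : P1), ((1 : ℂ) : P1), by simp, by simp, by simp, ?_⟩
      fin_cases v
      · rintro p (rfl | rfl | rfl)
        exacts [Or.inl ⟨1, ⟨by decide, rfl⟩, rfl⟩, Or.inr ⟨.z, rfl, rfl⟩, Or.inl ⟨2, ⟨by decide, rfl⟩, rfl⟩]
      · rintro p (rfl | rfl | rfl)
        exacts [Or.inr ⟨.inf, rfl, rfl⟩, Or.inl ⟨0, ⟨by decide, rfl⟩, rfl⟩, Or.inr ⟨.y, rfl, rfl⟩]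
      · rintro p (rfl | rfl | rfl)
        exacts [Or.inl ⟨0, ⟨by decide, rfl⟩, rfl⟩, Or.inr ⟨.zero, rfl, rfl⟩, Or.inr ⟨.one, rfl, rfl⟩])
    (by decide)
    (by
      intro v w
      fin_cases v <;> fin_cases w <;> simp [CurveTable.Adj, upperCorner, lowerCorner])
    (by
      intro v w
      fin_cases v <;> fin_cases w <;> simp [CurveTable.Adj, upperCorner, lowerCorner])
    (by
      intro v b p
      fin_cases v <;> fin_cases b <;>
        simp [CurveTable.Adj, upperCorner, lowerCorner, pw_true_eq_zero, pw_true_eq_one, pw_true_eq_infty,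
          Fin.exists_fin_succ])
    (by
      intro v w
      fin_cases v <;> fin_cases w <;> simp [CurveTable.Adj, upperCorner, pwDeg])
    (by
      intro l
      cases l <;> simp [upperCorner, lowerCorner, LP.f])
    (by
      intro v p
      fin_cases v <;> simp +contextual [lowerCorner, pwDeg, pw_true_eq_infty, pw_true_eq_zero])
    (by
      intro v p
      fin_cases v <;>
        simp +contextual [CurveTable.Adj, upperCorner, lowerCorner, pwDeg, pw_true_eq_infty, pw_true_eq_zero,
          Fin.forall_fin_succ])

/-- The exchange of the labels `0` and `1` of the target, if `b` is true. -/
def swapLB (b : Bool) : LB → LB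
  | .zero => if b then .one else .zero
  | .one => if b then .zero else .one
  | .inf => .inf
  | .y => .y
  | .z => .z

/-- An exchange of labels of the source that covers `swapLB`. -/
def swapLP (b : Bool) : LP → LP
  | .zero => .zero
  | .crit => .crit
  | .one => if b then .one' else .one
  | .one' => if b then .one else .one'
  | .inf => if b then .x' else .inf
  | .x' => if b then .inf else .x'
  | .inf' => if b then .x else .inf'
  | .x => if b then .inf' else .x

theorem swapLB_injective (b : Bool) : Function.Injective (swapLB b) := by
  intro a a'
  cases b <;> cases a <;> cases a' <;> simp [swapLB]

theorem swapLP_injective (b : Bool) : Function.Injective (swapLP b) := by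
  intro a a'
  cases b <;> cases a <;> cases a' <;> simp [swapLP]

/-- Relabelling of a table. -/
def CurveTable.relabel {A B : Type} {n : ℕ} (T : CurveTable A n) (i : B → A)
    (hi : Function.Injective i) : CurveTable B n where
  nx := T.nx
  isNext := T.isNext
  node := T.node
  pos := fun b => T.pos (i b)
  pt := fun b => T.pt (i b)
  node_inj := T.node_inj
  mark_inj := fun _ _ h h' => hi (T.mark_inj _ _ h h')
  mark_ne := fun a => T.mark_ne (i a)

/-- The upper curve of the limit covering for `x = y → 0`. -/
def upperCusp : CurveTable LP 5 where
  nx := ![![0, 1, 2, 1, 2], ![0, 1, 0, 3, 0], ![0, 0, 2, 0, 4], ![1, 1, 1, 3, 1], ![2, 2, 2, 2, 4]]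
  isNext := isNextTable_path5
  -- As x = y → 0 the second zero r tends to 1. The component 0 carries (2x - t)/t, the component 1
  -- carries (t - 1)/t, and the component 2 is seen by zooming in at t = x. The components 3 and 4
  -- separate r from 1 and `one'` from x, since r - 1 = x/(x - 1) and `one'` - x = -x³/(1 - x)².
  node := ![![∞, ((-1 : ℂ) : P1), ((1 : ℂ) : P1), ∞, ∞], ![∞, ∞, ∞, ((0 : ℂ) : P1), ∞],
    ![∞, ∞, ∞, ∞, ((0 : ℂ) : P1)], fun _ => ∞, fun _ => ∞]
  pos := fun
    | .zero => 0 | .crit => 0 | .inf => 1 | .inf' => 2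
    | .x' => 3 | .one => 3 | .x => 4 | .one' => 4
  pt := fun
    | .zero => ∞ | .crit => ((0 : ℂ) : P1) | .inf => ((1 : ℂ) : P1) | .inf' => ((1 : ℂ) : P1)
    | .x' => ((0 : ℂ) : P1) | .one => ((1 : ℂ) : P1) | .x => ((0 : ℂ) : P1)
    | .one' => ((1 : ℂ) : P1)
  node_inj := by
    intro v w w'
    fin_cases v <;> fin_cases w <;> fin_cases w' <;> simp
    all_goals norm_num
  mark_inj := by
    intro a b
    cases a <;> cases b <;> simp
  mark_ne := by
    intro a w
    cases a <;> fin_cases w <;> simp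

/-- The lower curve of the limit covering for `x = y → 0`. -/
def lowerCusp : CurveTable LB 3 where
  nx := ![![0, 1, 1], ![0, 1, 2], ![1, 1, 2]]
  isNext := isNextTable_path3
  node := ![fun _ => ((1 : ℂ) : P1), ![∞, ∞, ((0 : ℂ) : P1)], fun _ => ∞]
  pos := fun | .inf => 0 | .z => 0 | .one => 1 | .zero => 2 | .y => 2
  pt := fun
    | .zero => ((0 : ℂ) : P1) | .one => ((1 : ℂ) : P1) | .inf => ∞
    | .y => ((1 : ℂ) : P1) | .z => ((0 : ℂ) : P1)
  node_inj := by
    intro v w w'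
    fin_cases v <;> fin_cases w <;> fin_cases w' <;> simp
  mark_inj := by
    intro a b
    cases a <;> cases b <;> simp
  mark_ne := by
    intro a w
    cases a <;> fin_cases w <;> simp

/-- The limit coverings for `x = y → 0` (if `b` is false) and for `x = y → 1` (if `b` is true). -/
def diagramCusp (b : Bool) : Diagram :=
  -- As x = y → 1 the second zero tends to ∞, and the limit has the same shape with the roles of 0
  -- and 1 on the target exchanged; on the source the marks over 0 and over 1 change places
  -- accordingly. One table therefore serves both cusps.
  tableDiagram (upperCusp.relabel (swapLP b) (swapLP_injective b))
    (lowerCusp.relabel (swapLB b) (swapLB_injective b)) ![0, 1, 1, 2, 2]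
    ![true, false, false, false, false]
    (by
      refine CurveTable.isStable _ fun v => ?_
      refine ⟨∞, ((0 : ℂ) : P1), ((1 : ℂ) : P1), by simp, by simp, by simp, ?_⟩
      fin_cases v
      · rintro p (rfl | rfl | rfl)
        exacts [Or.inr ⟨.inf, rfl, rfl⟩, Or.inr ⟨.z, rfl, rfl⟩, Or.inl ⟨1, ⟨by decide, rfl⟩, rfl⟩]
      · rintro p (rfl | rfl | rfl)
        · exact Or.inl ⟨0, ⟨by decide, rfl⟩, rfl⟩
        · exact Or.inl ⟨2, ⟨by decide, rfl⟩, rfl⟩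
        · cases b
          exacts [Or.inr ⟨.one, rfl, rfl⟩, Or.inr ⟨.zero, rfl, rfl⟩]
      · rintro p (rfl | rfl | rfl)
        · exact Or.inl ⟨1, ⟨by decide, rfl⟩, rfl⟩
        · cases b
          exacts [Or.inr ⟨.zero, rfl, rfl⟩, Or.inr ⟨.one, rfl, rfl⟩]
        · exact Or.inr ⟨.y, rfl, rfl⟩)
    (by decide)
    (by
      intro v w
      fin_cases v <;> fin_cases w <;> simp [CurveTable.Adj, CurveTable.relabel, upperCusp, lowerCusp])
    (by
      intro v w
      fin_cases v <;> fin_cases w <;> simp [CurveTable.Adj, CurveTable.relabel, upperCusp, lowerCusp])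
    (by
      intro v b p
      fin_cases v <;> fin_cases b <;>
        simp [CurveTable.Adj, CurveTable.relabel, upperCusp, lowerCusp, pw_true_eq_one, Fin.exists_fin_succ])
    (by
      intro v w
      fin_cases v <;> fin_cases w <;> simp [CurveTable.Adj, CurveTable.relabel, upperCusp, pwDeg])
    (by
      intro l
      cases b <;> cases l <;>
        simp [CurveTable.relabel, upperCusp, lowerCusp, LP.f, swapLB, swapLP])
    (by
      intro v p
      fin_cases v <;>
        simp [CurveTable.relabel, lowerCusp, pwDeg, pw_true_eq_infty, pw_true_eq_zero, swapLB]
      tauto)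
    (by
      intro v p
      fin_cases v <;>
        simp [CurveTable.relabel, lowerCusp, pwDeg, pw_true_eq_infty, pw_true_eq_zero, swapLB]
      tauto)

/-! ### The special coverings lie in `𝒜𝒱`, and their strata -/

theorem table_isStabilization {A B : Type} {n : ℕ} [NeZero n] (σ : A ≃ Bool × Bool)
    (T : CurveTable B n) (i : A → B) (hi : Function.Injective i) (e : Bool → Fin n)
    (he : ∀ v, T.proj (e v) (i (σ.symm (v, false))) ≠ T.proj (e v) (i (σ.symm (v, true))) ∧
      T.proj (e v) (i (σ.symm (!v, false))) = T.proj (e v) (i (σ.symm (!v, true))) ∧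
      T.proj (e v) (i (σ.symm (v, false))) ≠ T.proj (e v) (i (σ.symm (!v, false))) ∧
      T.proj (e v) (i (σ.symm (v, true))) ≠ T.proj (e v) (i (σ.symm (!v, false)))) :
    (T.curve.relabel i hi).IsStabilization (splitCurve σ) := by
  refine isStabilization_splitCurve σ _ e fun v => ?_
  have key : ∀ a, (T.curve.relabel i hi).proj (e v) ((T.curve.relabel i hi).mark a) =
      T.proj (e v) (i a) := fun a => T.curve_proj (e v) (i a)
  simp only [key]
  exact he v

/-- The splitting `{0, 1} ∪ {∞, x}` of `A`. -/
def splitZeroOne : LA ≃ Bool × Bool where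
  toFun := fun
    | .zero => (false, false) | .one => (false, true) | .inf => (true, false) | .x => (true, true)
  invFun := fun
    | (false, false) => .zero | (false, true) => .one | (true, false) => .inf | (true, true) => .x
  left_inv := by intro a; cases a <;> rfl
  right_inv := by rintro ⟨_ | _, _ | _⟩ <;> rfl

/-- The splittings `{0, x} ∪ {1, ∞}` and `{1, x} ∪ {0, ∞}` of `A`. -/
def splitCusp (b : Bool) : LA ≃ Bool × Bool where
  toFun := fun
    | .zero => (b, false) | .x => (false, true) | .one => (!b, false) | .inf => (true, true)
  invFun := fun
    | (false, false) => if b then .one else .zero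
    | (false, true) => .x
    | (true, false) => if b then .zero else .one
    | (true, true) => .inf
  left_inv := by intro a; cases b <;> cases a <;> rfl
  right_inv := by cases b <;> rintro ⟨_ | _, _ | _⟩ <;> rfl

/-- The component 2 of the upper curve carries no point of `A` and is contracted. What remains
separates 0, 1 from the other two marks, exactly as the lower curve does. -/
theorem diagramU_mem_AV {u : ℂ} (h : GoodU u) : (⟦diagramU u h⟧ : AMf) ∈ AV := by
  have h0 := h.u0
  have h1 := h.u1
  refine ⟨_, rfl, splitCurve splitZeroOne, ?_, ?_⟩
  · refine table_isStabilization splitZeroOne (upperU u h) _ _ (fun | false => 0 | true => 1) ?_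
    intro v
    cases v <;> simp [splitZeroOne, CurveTable.proj, upperU, LA.toLP]
    all_goals grind
  · refine table_isStabilization splitZeroOne (lowerU u h) _ _ (fun | false => 1 | true => 0) ?_
    intro v
    cases v <;> simp [splitZeroOne, CurveTable.proj, lowerU, LA.iota]
    all_goals grind

theorem diagramW_mem_AV {w : ℂ} (h : GoodW w) : (⟦diagramW w h⟧ : AMf) ∈ AV := by
  have h0 := h.w0
  refine ⟨_, rfl, splitCurve splitZeroOne, ?_, ?_⟩
  · refine table_isStabilization splitZeroOne (upperW w h) _ _ (fun | false => 1 | true => 0) ?_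
    intro v
    cases v <;> simp [splitZeroOne, CurveTable.proj, upperW, LA.toLP]
    all_goals grind
  · refine table_isStabilization splitZeroOne (lowerW w h) _ _ (fun | false => 0 | true => 1) ?_
    intro v
    cases v <;> simp [splitZeroOne, CurveTable.proj, lowerW, LA.iota]
    all_goals grind

/-- The middle component carries no point of `A` on either curve and is contracted, as is the
component of the upper curve with `inf'` and `x'`. -/
theorem diagramCorner_mem_AV : (⟦diagramCorner⟧ : AMf) ∈ AV := by
  refine ⟨_, rfl, splitCurve splitZeroOne, ?_, ?_⟩
  · refine table_isStabilization splitZeroOne upperCorner _ _ (fun | false => 1 | true => 2) ?_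
    intro v
    cases v <;> simp [splitZeroOne, CurveTable.proj, upperCorner, LA.toLP]
  · refine table_isStabilization splitZeroOne lowerCorner _ _ (fun | false => 2 | true => 1) ?_
    intro v
    cases v <;> simp [splitZeroOne, CurveTable.proj, lowerCorner, LA.iota]

theorem diagramCusp_mem_AV (b : Bool) : (⟦diagramCusp b⟧ : AMf) ∈ AV := by
  refine ⟨_, rfl, splitCurve (splitCusp b), ?_, ?_⟩
  · refine table_isStabilization (splitCusp b)
      (upperCusp.relabel (swapLP b) (swapLP_injective b)) _ _
      -- The marks 0 and x are told apart on the component 0 when `b` is false. When `b` is true, 1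
      -- and x are told apart on the component 2, and 0 and ∞ on the component 0.
      (fun | false => if b then 2 else 0 | true => if b then 0 else 1) ?_
    intro v
    cases b <;> cases v <;>
      simp [splitCusp, CurveTable.proj, CurveTable.relabel, upperCusp, LA.toLP, swapLP] <;> norm_num
  · refine table_isStabilization (splitCusp b)
      (lowerCusp.relabel (swapLB b) (swapLB_injective b)) _ _ (fun | false => 2 | true => 1) ?_
    intro v
    cases b <;> cases v <;>
      simp [splitCusp, CurveTable.proj, CurveTable.relabel, lowerCusp, LA.iota, swapLB]

theorem smoothCurve_isStable {A : Type} {m : A → P1} (hm : Function.Injective m) {a b c : A}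
    (hab : a ≠ b) (hac : a ≠ c) (hbc : b ≠ c) : (smoothCurve m hm).IsStable := by
  intro v
  have hsub : m '' {a, b, c} ⊆ (smoothCurve m hm).special v := by
    rintro _ ⟨b, -, rfl⟩
    exact Or.inr ⟨b, rfl⟩
  refine le_trans (le_of_eq ?_) (Set.encard_le_encard hsub)
  rw [hm.encard_image, Set.encard_insert_of_notMem (by simp [hab, hac]),
    Set.encard_insert_of_notMem (by simp [hbc]), Set.encard_singleton]
  norm_num

/-- On the diagonal the positions 0, 1, ∞, x on the source and 0, 1, ∞, y on the target are the same
four points, so the identity does. -/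
theorem smoothDiagram_mem_AV {x : ℂ} (h : Nondeg x x) : (⟦smoothDiagram x x h⟧ : AMf) ∈ AV := by
  have hinj : Function.Injective fun a : LA => upMark x x a.toLP :=
    (upMark_inj h).comp LA.toLP_injective
  refine ⟨_, rfl, smoothCurve _ hinj, ⟨?_, fun _ => (), fun _ => 1, fun v a => ?_⟩,
    ⟨?_, fun _ => (), fun _ => 1, fun v a => ?_⟩⟩
  · exact smoothCurve_isStable hinj (a := .zero) (b := .one) (c := .inf) (by simp) (by simp) (by simp)
  · rw [one_smul]
    exact (if_pos rfl).trans (MarkedCurve.smoothCurve_proj hinj () a).symm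
  · exact smoothCurve_isStable hinj (a := .zero) (b := .one) (c := .inf) (by simp) (by simp) (by simp)
  · have e : lowMark x x a.iota = upMark x x a.toLP := by cases a <;> rfl
    rw [one_smul]
    exact ((if_pos rfl).trans e).trans (MarkedCurve.smoothCurve_proj hinj () a).symm

theorem diagramU_mem_A1 {u : ℂ} (h : GoodU u) : (⟦diagramU u h⟧ : AMf) ∈ AMf.A1 := by
  refine ⟨_, rfl, fun b b' => ?_⟩
  change (lowerU u h).pos b = (lowerU u h).pos b' ↔ _
  cases b <;> cases b' <;> simp [lowerU]

theorem diagramW_mem_A2 {w : ℂ} (h : GoodW w) : (⟦diagramW w h⟧ : AMf) ∈ AMf.A2 := by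
  refine ⟨_, rfl, fun b b' => ?_⟩
  change (lowerW w h).pos b = (lowerW w h).pos b' ↔ _
  cases b <;> cases b' <;> simp [lowerW]

theorem diagramCorner_mem_A12 : (⟦diagramCorner⟧ : AMf) ∈ AMf.A12 := by
  refine ⟨_, rfl, fun b b' => ?_⟩
  change lowerCorner.pos b = lowerCorner.pos b' ↔ _
  cases b <;> cases b' <;> simp [lowerCorner]

/-! ### Some cross ratios of the special coverings -/

theorem table_cross {A : Type} {n : ℕ} [NeZero n] (T : CurveTable A n) (v : Fin n) {a b c : A}
    (hab : T.proj v a ≠ T.proj v b) (hac : T.proj v a ≠ T.proj v c) (hbc : T.proj v b ≠ T.proj v c)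
    (d : A) : T.curve.cross a b c d =
      crossRatio (T.proj v a) (T.proj v b) (T.proj v c) (T.proj v d) :=
  (MarkedCurve.realizes_of_proj (C := T.curve) v (T.curve_proj v)).cross_eq hab hac hbc d

theorem crossRatio_infty_left (b c d : ℂ) :
    crossRatio ∞ (b : P1) (c : P1) (d : P1) = ratio (b - c) (b - d) := by
  simp [crossRatio, bracket]

theorem crossRatio_infty_mid (a c d : ℂ) :
    crossRatio (a : P1) ∞ (c : P1) (d : P1) = ratio (a - d) (a - c) := by
  simp [crossRatio, bracket]

theorem crossRatio_infty_left_right (b c : ℂ) :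
    crossRatio ∞ (b : P1) (c : P1) ∞ = ((0 : ℂ) : P1) := by
  simp [crossRatio, bracket, ratio]

theorem smooth_cross {A : Type} {m : A → P1} (hm : Function.Injective m) {a b c : A}
    (hab : a ≠ b) (hac : a ≠ c) (hbc : b ≠ c) (d : A) :
    (smoothCurve m hm).cross a b c d = crossRatio (m a) (m b) (m c) (m d) :=
  (MarkedCurve.realizes_of_proj (C := smoothCurve m hm) ()
    (MarkedCurve.smoothCurve_proj hm ())).cross_eq (hm.ne hab) (hm.ne hac) (hm.ne hbc) d

/-! ### Local regular functions -/

section Reg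

variable {S I : Type*} (c : S → I → P1) (p : S)

/-- The filter of points whose coordinates are close to those of `p`. -/
def nearby : Filter S := comap c (𝓝 (c p))

/-- The affine coordinates near `p`. -/
def locCoord (q : S) (i : I) : ℂ := loc (c p i) (c q i)

/-- The ring of functions that are, near `p`, quotients of polynomials in the affine coordinates. -/
def Reg : Subring (S → ℂ) where
  carrier := {f | ∃ N D : MvPolynomial I ℂ, ∀ᶠ q in nearby c p,
    MvPolynomial.eval (locCoord c p q) D ≠ 0 ∧
      f q = MvPolynomial.eval (locCoord c p q) N / MvPolynomial.eval (locCoord c p q) D}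
  mul_mem' := by
    rintro f g ⟨N, D, h⟩ ⟨N', D', h'⟩
    refine ⟨N * N', D * D', ?_⟩
    filter_upwards [h, h'] with q hq hq'
    rw [map_mul, map_mul, Pi.mul_apply, hq.2, hq'.2, div_mul_div_comm]
    exact ⟨mul_ne_zero hq.1 hq'.1, rfl⟩
  one_mem' := ⟨1, 1, by simp⟩
  add_mem' := by
    rintro f g ⟨N, D, h⟩ ⟨N', D', h'⟩
    refine ⟨N * D' + D * N', D * D', ?_⟩
    filter_upwards [h, h'] with q hq hq'
    rw [map_add, map_mul, map_mul, map_mul, Pi.add_apply, hq.2, hq'.2, div_add_div _ _ hq.1 hq'.1]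
    exact ⟨mul_ne_zero hq.1 hq'.1, rfl⟩
  zero_mem' := ⟨0, 1, by simp⟩
  neg_mem' := by
    rintro f ⟨N, D, h⟩
    refine ⟨-N, D, ?_⟩
    filter_upwards [h] with q hq
    rw [map_neg, Pi.neg_apply, hq.2, neg_div]
    exact ⟨hq.1, rfl⟩

variable {c p}

/-- The value of a local regular function. -/
def ev (q : S) : Reg c p →+* ℂ := (Pi.evalRingHom (fun _ : S => ℂ) q).comp (Reg c p).subtype

theorem pure_le_nearby : pure p ≤ nearby c p :=
  map_le_iff_le_comap.1 (pure_le_nhds (c p))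

theorem eventually_nearby_self {P : S → Prop} (h : ∀ᶠ q in nearby c p, P q) : P p :=
  pure_le_nearby h

theorem tendsto_nearby (i : I) : Tendsto (fun q => c q i) (nearby c p) (𝓝 (c p i)) :=
  ((continuous_apply i).tendsto _).comp tendsto_comap

theorem eventually_chart [Finite I] : ∀ᶠ q in nearby c p, ∀ i, chart (c p i) • c q i ≠ ∞ := by
  rw [eventually_all]
  exact fun i => (tendsto_nearby i).eventually (chart_smul_ne_infty _)

theorem tendsto_locCoord : Tendsto (locCoord c p) (nearby c p) (𝓝 (locCoord c p p)) := by
  rw [tendsto_pi_nhds]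
  exact fun i => (tendsto_loc (c p i)).comp (tendsto_nearby i)

theorem tendsto_ev (f : Reg c p) : Tendsto (fun q => ev q f) (nearby c p) (𝓝 (ev p f)) := by
  obtain ⟨f, N, D, h⟩ := f
  have hp := eventually_nearby_self h
  have hN := ((MvPolynomial.continuous_eval N).tendsto _).comp (tendsto_locCoord (c := c) (p := p))
  have hD := ((MvPolynomial.continuous_eval D).tendsto _).comp (tendsto_locCoord (c := c) (p := p))
  change Tendsto f _ (𝓝 (f p))
  rw [hp.2]
  refine (hN.div hD hp.1).congr' ?_
  filter_upwards [h] with q hq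
  exact hq.2.symm

theorem eventually_ev_ne {f : Reg c p} (h : ev p f ≠ 0) : ∀ᶠ q in nearby c p, ev q f ≠ 0 :=
  (tendsto_ev f).eventually_ne h

theorem eventually_ev_ne_or {f g : Reg c p} (h : ev p f ≠ 0 ∨ ev p g ≠ 0) :
    ∀ᶠ q in nearby c p, ev q f ≠ 0 ∨ ev q g ≠ 0 := by
  rcases h with h | h
  · filter_upwards [eventually_ev_ne h] with q hq using Or.inl hq
  · filter_upwards [eventually_ev_ne h] with q hq using Or.inr hq

/-- The inverse of a local regular function. -/
def Reg.inv (f : Reg c p) (h : ev p f ≠ 0) : Reg c p :=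
  ⟨fun q => (ev q f)⁻¹, by
    have h' := eventually_ev_ne h
    obtain ⟨f, N, D, hf⟩ := f
    refine ⟨D, N, ?_⟩
    filter_upwards [hf, h'] with q hq hq'
    change f q ≠ 0 at hq'
    change _ ∧ (f q)⁻¹ = _
    rw [hq.2] at hq' ⊢
    rw [inv_div]
    exact ⟨(div_ne_zero_iff.1 hq').1, rfl⟩⟩

@[simp] theorem ev_inv (f : Reg c p) (h : ev p f ≠ 0) (q : S) : ev q (Reg.inv f h) = (ev q f)⁻¹ := rfl

/-- Constant functions. -/
def Reg.const (t : ℂ) : Reg c p := ⟨fun _ => t, MvPolynomial.C t, 1, by simp⟩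

/-- The affine coordinate functions. -/
def Reg.coord (i : I) : Reg c p := ⟨fun q => locCoord c p q i, MvPolynomial.X i, 1, by simp⟩

theorem ev_coord (i : I) (q : S) : ev q (Reg.coord i : Reg c p) = loc (c p i) (c q i) := rfl

/-- The normalized first homogeneous coordinate functions. -/
def Reg.coord0 (i : I) : Reg c p :=
  ⟨fun q => lift0 (c p i) (c q i), by
    unfold lift0
    split_ifs
    · exact (1 : Reg c p).2
    · exact (Reg.coord i : Reg c p).2⟩

/-- The normalized second homogeneous coordinate functions. -/
def Reg.coord1 (i : I) : Reg c p :=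
  ⟨fun q => lift1 (c p i) (c q i), by
    unfold lift1
    split_ifs
    · exact (Reg.coord i : Reg c p).2
    · exact (1 : Reg c p).2⟩

theorem eventually_coord_eq (i : I) :
    ∀ᶠ q in nearby c p, c q i = ratio (ev q (Reg.coord0 i : Reg c p)) (ev q (Reg.coord1 i : Reg c p)) := by
  filter_upwards [(tendsto_nearby i).eventually (chart_smul_ne_infty _)] with q hq
  exact (ratio_lift hq).symm

variable (c p) in
/-- A map to the projective line that is regular near `p`. -/
def RegPt (g : S → P1) : Prop :=
  ∃ (k : Moeb) (f : Reg c p), ∀ᶠ q in nearby c p, k • g q = (ev q f : P1)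

/-- Whichever of the two homogeneous coordinates is nonzero at `p` is invertible in `Reg c p`, so
either the ratio or its inverse is a local regular function. -/
theorem regPt_of_ratio {g : S → P1} (n d : Reg c p) (h : ev p n ≠ 0 ∨ ev p d ≠ 0)
    (hg : ∀ᶠ q in nearby c p, g q = ratio (ev q n) (ev q d)) : RegPt c p g := by
  by_cases hd : ev p d = 0
  · have hn : ev p n ≠ 0 := by simpa [hd] using h
    refine ⟨mkMoeb 0 1 1 0 (by simp), d * Reg.inv n hn, ?_⟩
    filter_upwards [hg, eventually_ev_ne hn] with q hq hq'
    rw [hq, inversion_smul (Or.inl hq'), ratio_of_ne hq', map_mul, ev_inv, div_eq_mul_inv]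
  · refine ⟨1, n * Reg.inv d hd, ?_⟩
    filter_upwards [hg, eventually_ev_ne hd] with q hq hq'
    rw [hq, one_smul, ratio_of_ne hq', map_mul, ev_inv, div_eq_mul_inv]

theorem regPt_coord (i : I) : RegPt c p fun q => c q i :=
  regPt_of_ratio (Reg.coord0 i) (Reg.coord1 i) (lift_ne_zero _ _) (eventually_coord_eq i)

theorem regPt_const (t : P1) : RegPt c p fun _ => t :=
  regPt_of_ratio (Reg.const (hom0 t)) (Reg.const (hom1 t)) (hom_ne_zero t)
    (Eventually.of_forall fun _ => (ratio_hom t).symm)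

theorem RegPt.congr {g g' : S → P1} (h : RegPt c p g) (e : ∀ᶠ q in nearby c p, g' q = g q) :
    RegPt c p g' := by
  obtain ⟨k, f, hf⟩ := h
  refine ⟨k, f, ?_⟩
  filter_upwards [hf, e] with q hq hq'
  rw [hq', hq]

/-- Regularity implies continuity for the topology induced by the coordinates. This is what later
turns regularity in both directions into an equality of topologies. -/
theorem RegPt.tendsto {g : S → P1} (h : RegPt c p g) : Tendsto g (nearby c p) (𝓝 (g p)) := by
  obtain ⟨k, f, hf⟩ := h
  have hpt : ∀ q, k • g q = (ev q f : P1) → g q = ratio (k⁻¹ 0 0 * ev q f + k⁻¹ 0 1 * 1)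
      (k⁻¹ 1 0 * ev q f + k⁻¹ 1 1 * 1) := by
    intro q hq
    rw [← smul_ratio k⁻¹ (Or.inr one_ne_zero), ratio_one_right, ← hq, inv_smul_smul]
  have hp : k • g p = (ev p f : P1) := eventually_nearby_self (P := fun q => k • g q = (ev q f : P1)) hf
  rw [hpt p hp]
  refine Tendsto.congr' (f₁ := fun q => ratio (k⁻¹ 0 0 * ev q f + k⁻¹ 0 1 * 1)
      (k⁻¹ 1 0 * ev q f + k⁻¹ 1 1 * 1)) ?_ ?_
  · filter_upwards [hf] with q hq
    exact (hpt q hq).symm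
  · refine tendsto_ratio (((tendsto_ev f).const_mul _).add_const _)
      (((tendsto_ev f).const_mul _).add_const _) ?_
    by_contra hcon
    rw [not_or, not_not, not_not] at hcon
    have hdet : k⁻¹ 0 0 * k⁻¹ 1 1 - k⁻¹ 0 1 * k⁻¹ 1 0 ≠ 0 := by
      have := (k⁻¹).det_ne_zero
      rwa [Matrix.det_fin_two] at this
    apply hdet
    linear_combination k⁻¹ 0 0 * hcon.2 - k⁻¹ 1 0 * hcon.1

/-- Local regularity is developed for the filter `nearby`, which depends only on the coordinate
functions, so that the same theory applies to X with its coordinates in the blowup and to X with the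
cross ratios. Here it is transferred to the neighbourhood filter. -/
theorem isRegular_of_regPt [TopologicalSpace S] [Finite I] {g : S → P1}
    (hle : ∀ p, 𝓝 p ≤ nearby c p) (h : ∀ p, RegPt c p g) : IsRegular c g := by
  intro p
  obtain ⟨k, ⟨f, N, D, hf⟩, hg⟩ := h p
  refine ⟨fun i => chart (c p i), k, N, D, ?_⟩
  filter_upwards [hle p hf, hle p hg, hle p eventually_chart] with q h1 h2 h3
  refine ⟨locCoord c p q, fun i => coe_loc (h3 i), h1.1, ?_⟩
  rw [h2]
  exact congrArg _ h1.2

/-- Cross ratios are regular near `p` if, for every component of the curve at `p`, the projections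
of the marked points to that component extend to regular families. -/
theorem regPt_cross {A : Type} [Finite A] (C : S → MarkedCurve A)
    (H : ∀ v : (C p).Comp, ∃ n d : A → Reg c p,
      (∀ a, ev p (n a) ≠ 0 ∨ ev p (d a) ≠ 0) ∧
      (∀ a, (C p).proj v ((C p).mark a) = ratio (ev p (n a)) (ev p (d a))) ∧
      ∀ᶠ q in nearby c p, (∀ a, ev q (n a) ≠ 0 ∨ ev q (d a) ≠ 0) →
        (C q).Realizes fun a => ratio (ev q (n a)) (ev q (d a)))
    (a₁ a₂ a₃ a₄ : A) : RegPt c p fun q => (C q).cross a₁ a₂ a₃ a₄ := by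
  by_cases h12 : a₁ = a₂
  · simp only [MarkedCurve.cross_of_eq (Or.inl h12)]
    exact regPt_const ∞
  by_cases h13 : a₁ = a₃
  · simp only [MarkedCurve.cross_of_eq (Or.inr (Or.inl h13))]
    exact regPt_const ∞
  by_cases h23 : a₂ = a₃
  · simp only [MarkedCurve.cross_of_eq (Or.inr (Or.inr h23))]
    exact regPt_const ∞
  obtain ⟨v, hv⟩ := (C p).exists_isMedian h12 h13 h23
  obtain ⟨n, d, hnd, hproj, hev⟩ := H v
  have hne : ∀ a b, (C p).proj v ((C p).mark a) ≠ (C p).proj v ((C p).mark b) →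
      ev p (n a * d b - d a * n b) ≠ 0 := by
    intro a b hab
    rw [hproj, hproj] at hab
    rw [map_sub, map_mul, map_mul]
    exact fun e => hab ((bracket_ratio (hnd a) (hnd b)).2 e)
  have hev0 : ∀ᶠ q in nearby c p, ∀ a, ev q (n a) ≠ 0 ∨ ev q (d a) ≠ 0 := by
    rw [eventually_all]
    exact fun a => eventually_ev_ne_or (hnd a)
  refine regPt_of_ratio ((n a₁ * d a₄ - d a₁ * n a₄) * (n a₂ * d a₃ - d a₂ * n a₃))
    ((n a₁ * d a₃ - d a₁ * n a₃) * (n a₂ * d a₄ - d a₂ * n a₄)) ?_ ?_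
  -- If numerator and denominator both vanished, the fourth point would have the same projection as
  -- the first and as the second, which are different on the median component.
  · by_contra hcon
    rw [not_or, not_not, not_not, map_mul, map_mul] at hcon
    have h14 := (mul_eq_zero.1 hcon.1).resolve_right (hne _ _ hv.2.2)
    have h24 := (mul_eq_zero.1 hcon.2).resolve_left (hne _ _ hv.2.1)
    rw [map_sub, map_mul, map_mul] at h14 h24
    apply hv.1
    rw [hproj, hproj, (bracket_ratio (hnd _) (hnd _)).2 h14,
      (bracket_ratio (hnd _) (hnd _)).2 h24]
  · filter_upwards [hev0, hev, eventually_ev_ne (hne _ _ hv.1), eventually_ev_ne (hne _ _ hv.2.1),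
      eventually_ev_ne (hne _ _ hv.2.2)] with q h0 hR e12 e13 e23
    have key : ∀ a b, ev q (n a * d b - d a * n b) ≠ 0 →
        ratio (ev q (n a)) (ev q (d a)) ≠ ratio (ev q (n b)) (ev q (d b)) := by
      intro a b h e
      rw [bracket_ratio (h0 a) (h0 b)] at e
      rw [map_sub, map_mul, map_mul] at h
      exact h e
    rw [(hR h0).cross_eq (key _ _ e12) (key _ _ e13) (key _ _ e23),
      crossRatio_ratio (h0 _) (h0 _) (h0 _) (h0 _)]
    simp only [map_mul, map_sub]

end Reg

/-! ### Closed relations on the blowup -/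

/-- A generic point of the blowup. -/
def genPt (x y : ℂ) : Fin 5 → P1 :=
  ![(x : P1), (y : P1), ((y / x : ℂ) : P1), (((y - 1) / (x - 1) : ℂ) : P1),
    (((y - x) / (x * (x - 1)) : ℂ) : P1)]

theorem genPt_mem {x y : ℂ} (h0 : x ≠ 0) (h1 : x ≠ 1) : genPt x y ∈ blowup :=
  subset_closure ⟨x, y, h0, h1, rfl⟩

theorem isClosed_blowup : IsClosed blowup := isClosed_closure

/-- The set of points where a multihomogeneous function vanishes. -/
def zeroSet {n : ℕ} (Φ : (Fin n → ℂ) → (Fin n → ℂ) → ℂ) : Set (Fin n → P1) :=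
  {p | Φ (fun i => hom0 (p i)) (fun i => hom1 (p i)) = 0}

/-- The relation `y = u x`. -/
def relU (n d : Fin 5 → ℂ) : ℂ := n 1 * d 0 * d 2 - d 1 * n 0 * n 2

/-- The relation `y - 1 = t (x - 1)`. -/
def relT (n d : Fin 5 → ℂ) : ℂ := (n 1 - d 1) * d 0 * d 3 - n 3 * (n 0 - d 0) * d 1

/-- The relation `w x (x - 1) = y - x`. -/
def relW (n d : Fin 5 → ℂ) : ℂ :=
  n 4 * n 0 * (n 0 - d 0) * d 1 - d 4 * d 0 * (n 1 * d 0 - n 0 * d 1)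

/-- The relation `w (x - 1) = u - 1`. -/
def relUW (n d : Fin 5 → ℂ) : ℂ := n 4 * (n 0 - d 0) * d 2 - d 4 * d 0 * (n 2 - d 2)

/-- The relation `t (x - 1) = u x - 1`. -/
def relUT (n d : Fin 5 → ℂ) : ℂ := n 3 * (n 0 - d 0) * d 2 - d 3 * (n 2 * n 0 - d 2 * d 0)

theorem isClosed_relU : IsClosed (zeroSet relU) :=
  isClosed_multihomogeneous relU (by unfold relU; fun_prop) fun s n d _ h => by
    unfold relU at *; linear_combination s 0 * s 1 * s 2 * h

theorem isClosed_relT : IsClosed (zeroSet relT) :=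
  isClosed_multihomogeneous relT (by unfold relT; fun_prop) fun s n d _ h => by
    unfold relT at *; linear_combination s 0 * s 1 * s 3 * h

theorem isClosed_relW : IsClosed (zeroSet relW) :=
  isClosed_multihomogeneous relW (by unfold relW; fun_prop) fun s n d _ h => by
    unfold relW at *; linear_combination s 0 ^ 2 * s 1 * s 4 * h

theorem isClosed_relUW : IsClosed (zeroSet relUW) :=
  isClosed_multihomogeneous relUW (by unfold relUW; fun_prop) fun s n d _ h => by
    unfold relUW at *; linear_combination s 0 * s 2 * s 4 * h

theorem isClosed_relUT : IsClosed (zeroSet relUT) :=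
  isClosed_multihomogeneous relUT (by unfold relUT; fun_prop) fun s n d _ h => by
    unfold relUT at *; linear_combination s 0 * s 2 * s 3 * h

/-- Each relation holds at generic points and is a closed condition by multihomogeneity. At x = y =
∞ the first three become trivial; `relUW` and `relUT`, from which y has been eliminated, are the
ones that determine the fibre there. -/
theorem blowup_subset : blowup ⊆
    zeroSet relU ∩ zeroSet relT ∩ zeroSet relW ∩ zeroSet relUW ∩ zeroSet relUT := by
  refine closure_minimal ?_ ((((isClosed_relU.inter isClosed_relT).inter isClosed_relW).inter
    isClosed_relUW).inter isClosed_relUT)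
  rintro p ⟨x, y, h0, h1, rfl⟩
  have h1' := sub_ne_zero.2 h1
  refine ⟨⟨⟨⟨?_, ?_⟩, ?_⟩, ?_⟩, ?_⟩ <;>
    simp [zeroSet, relU, relT, relW, relUW, relUT] <;> field_simp <;> ring

/-- This describes the line y = ∞ in the blowup before passing to its closure, and so locates the
point q. -/
theorem blowupThree_subset : blowupThree ⊆
    {p | p 1 = ∞ → p 0 ≠ ∞ → p 2 = ∞ ∧ p 3 = ∞} := by
  let Φ (n d : Fin 4 → ℂ) : ℂ := n 1 * d 0 * d 2 - d 1 * n 0 * n 2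
  let Ψ (n d : Fin 4 → ℂ) : ℂ := (n 1 - d 1) * d 0 * d 3 - n 3 * (n 0 - d 0) * d 1
  have h1 : IsClosed (zeroSet Φ) :=
    isClosed_multihomogeneous Φ (by fun_prop) fun s n d _ h => by
      simp only [Φ] at *; linear_combination s 0 * s 1 * s 2 * h
  have h2 : IsClosed (zeroSet Ψ) :=
    isClosed_multihomogeneous Ψ (by fun_prop) fun s n d _ h => by
      simp only [Ψ] at *; linear_combination s 0 * s 1 * s 3 * h
  refine (closure_minimal (t := zeroSet Φ ∩ zeroSet Ψ) ?_ (h1.inter h2)).trans ?_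
  · rintro p ⟨x, y, h0, h1, rfl⟩
    have h1' := sub_ne_zero.2 h1
    refine ⟨?_, ?_⟩ <;> simp [zeroSet, Φ, Ψ] <;> field_simp <;> ring
  · rintro p ⟨e1, e2⟩ hp1 hp0
    obtain ⟨x, hx⟩ := ne_infty_iff_exists.1 hp0
    simp only [zeroSet, Φ, Ψ, Set.mem_ofPred_eq, hp1, ← hx, hom0_infty, hom1_infty, hom0_coe, hom1_coe] at e1 e2
    constructor
    · generalize p 2 = a at e1
      induction a using OnePoint.rec <;> simp at e1 ⊢
    · generalize p 3 = a at e2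
      induction a using OnePoint.rec <;> simp at e2 ⊢

theorem blowup_relU {p : Fin 5 → P1} (hp : p ∈ blowup) :
    relU (fun i => hom0 (p i)) (fun i => hom1 (p i)) = 0 :=
  (blowup_subset hp).1.1.1.1

theorem blowup_relT {p : Fin 5 → P1} (hp : p ∈ blowup) :
    relT (fun i => hom0 (p i)) (fun i => hom1 (p i)) = 0 :=
  (blowup_subset hp).1.1.1.2

theorem blowup_relW {p : Fin 5 → P1} (hp : p ∈ blowup) :
    relW (fun i => hom0 (p i)) (fun i => hom1 (p i)) = 0 :=
  (blowup_subset hp).1.1.2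

theorem blowup_relUW {p : Fin 5 → P1} (hp : p ∈ blowup) :
    relUW (fun i => hom0 (p i)) (fun i => hom1 (p i)) = 0 :=
  (blowup_subset hp).1.2

theorem blowup_relUT {p : Fin 5 → P1} (hp : p ∈ blowup) :
    relUT (fun i => hom0 (p i)) (fun i => hom1 (p i)) = 0 :=
  (blowup_subset hp).2

theorem eq_infty_of_hom1 {a : P1} (h : hom1 a = 0) : a = ∞ := by
  induction a using OnePoint.rec <;> simp at h ⊢

theorem eq_zero_of_hom0 {a : P1} (h : hom0 a = 0) : a = ((0 : ℂ) : P1) := by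
  induction a using OnePoint.rec <;> simp_all

theorem hom1_ne_zero {a : P1} (h : a ≠ ∞) : hom1 a ≠ 0 := fun e => h (eq_infty_of_hom1 e)

theorem hom0_ne_zero {a : P1} (h : a ≠ ((0 : ℂ) : P1)) : hom0 a ≠ 0 :=
  fun e => h (eq_zero_of_hom0 e)

theorem hom_sub_ne_zero {a : P1} (h : a ≠ ((1 : ℂ) : P1)) : hom0 a - hom1 a ≠ 0 := by
  induction a using OnePoint.rec <;> simp_all [sub_eq_zero]

theorem eq_coe_of_hom {a : P1} {t : ℂ} (h : hom0 a = t * hom1 a) : a = (t : P1) := by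
  induction a using OnePoint.rec <;> simp_all

/-- Points over finite points with `x ≠ 0, 1` are generic. -/
theorem eq_genPt {p : Fin 5 → P1} (hp : p ∈ blowup) {x y : ℂ} (h0 : x ≠ 0) (h1 : x ≠ 1)
    (hx : p 0 = (x : P1)) (hy : p 1 = (y : P1)) : p = genPt x y := by
  have h1' := sub_ne_zero.2 h1
  have e1 := blowup_relU hp
  have e2 := blowup_relT hp
  have e3 := blowup_relW hp
  simp only [relU, relT, relW, hx, hy, hom0_coe, hom1_coe] at e1 e2 e3
  funext i
  fin_cases i
  · exact hx
  · exact hy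
  · refine eq_coe_of_hom ?_
    change hom0 (p 2) = y / x * hom1 (p 2)
    field_simp
    linear_combination -e1
  · refine eq_coe_of_hom ?_
    change hom0 (p 3) = (y - 1) / (x - 1) * hom1 (p 3)
    field_simp
    linear_combination -e2
  · refine eq_coe_of_hom ?_
    change hom0 (p 4) = (y - x) / (x * (x - 1)) * hom1 (p 4)
    field_simp
    linear_combination e3

/-! ### The curves in the blowup -/

/-- The points of the proper transform of the diagonal. -/
def ptV (x : P1) : Fin 5 → P1 := ![x, x, ((1 : ℂ) : P1), ((1 : ℂ) : P1), ((0 : ℂ) : P1)]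

/-- The points of `E_∞`. -/
def ptE (u : P1) : Fin 5 → P1 := ![∞, ∞, u, u, ((0 : ℂ) : P1)]

/-- The points of `E_q`. -/
def ptQ (w : P1) : Fin 5 → P1 := ![∞, ∞, ∞, ∞, w]

theorem continuous_ptV : Continuous ptV := by
  refine continuous_pi fun i => ?_
  fin_cases i <;> simp only [ptV] <;> first | exact continuous_id | exact continuous_const

theorem continuous_ptE : Continuous ptE := by
  refine continuous_pi fun i => ?_
  fin_cases i <;> simp only [ptE] <;> first | exact continuous_id | exact continuous_const

theorem continuous_ptQ : Continuous ptQ := by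
  refine continuous_pi fun i => ?_
  fin_cases i <;> simp only [ptQ] <;> first | exact continuous_id | exact continuous_const

theorem genPt_self {x : ℂ} (h0 : x ≠ 0) (h1 : x ≠ 1) : genPt x x = ptV x := by
  have h1' := sub_ne_zero.2 h1
  simp [genPt, ptV, h0, h1']

theorem closure_coe_compl_finite {s : Set ℂ} (hs : s.Finite) :
    closure ((fun t : ℂ => (t : P1)) '' sᶜ) = Set.univ := by
  have h1 : Dense sᶜ := hs.countable.dense_compl ℂ
  have h2 : DenseRange (fun t : ℂ => (t : P1)) := denseRange_coe
  exact (h2.dense_image continuous_coe h1).closure_eq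

/-- A map of the projective line takes every point to the closure of the image of a cofinite set. -/
theorem mem_closure_of_cofinite {s : Set ℂ} (hs : s.Finite) {f : P1 → Fin 5 → P1}
    (hf : Continuous f) {T : Set (Fin 5 → P1)} (h : ∀ t : ℂ, t ∉ s → f t ∈ T) (a : P1) :
    f a ∈ closure T := by
  have ha : a ∈ closure ((fun t : ℂ => (t : P1)) '' sᶜ) := by
    rw [closure_coe_compl_finite hs]; trivial
  refine closure_mono ?_ (image_closure_subset_closure_image hf ⟨a, ha, rfl⟩)
  rintro _ ⟨_, ⟨t, ht, rfl⟩, rfl⟩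
  exact h t ht

/-- The tool for computing limits: a one-parameter family is written in homogeneous coordinates from
which common factors have been cancelled, so that they are continuous and not both zero at s = 0. -/
theorem mem_closure_of_ratio {k : ℕ} {T : Set (Fin k → P1)} (n d : ℂ → Fin k → ℂ)
    (hn : Continuous n) (hd : Continuous d) (h0 : ∀ i, n 0 i ≠ 0 ∨ d 0 i ≠ 0)
    (hT : ∀ᶠ s in 𝓝[≠] (0 : ℂ), (fun i => ratio (n s i) (d s i)) ∈ T) :
    (fun i => ratio (n 0 i) (d 0 i)) ∈ closure T := by
  refine mem_closure_of_tendsto (b := 𝓝[≠] (0 : ℂ)) ?_ hT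
  rw [tendsto_pi_nhds]
  intro i
  exact tendsto_ratio
    ((((continuous_apply i).comp hn).tendsto 0).mono_left nhdsWithin_le_nhds)
    ((((continuous_apply i).comp hd).tendsto 0).mono_left nhdsWithin_le_nhds) (h0 i)

/-- The points at infinity as limits of generic points `x = 1 / s`. -/
theorem mem_closure_genPt {T : Set (Fin 5 → P1)} {p : Fin 5 → P1} (Y : ℂ → ℂ)
    (n d : ℂ → Fin 5 → ℂ) (hn : Continuous n) (hd : Continuous d)
    (h0 : ∀ i, n 0 i ≠ 0 ∨ d 0 i ≠ 0) (hp : ∀ i, ratio (n 0 i) (d 0 i) = p i)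
    (hY : ∀ᶠ s in 𝓝[≠] (0 : ℂ), ∀ i, ratio (n s i) (d s i) = genPt s⁻¹ (Y s) i)
    (hT : ∀ᶠ s in 𝓝[≠] (0 : ℂ), genPt s⁻¹ (Y s) ∈ T) : p ∈ closure T := by
  have : (fun i => ratio (n 0 i) (d 0 i)) = p := funext hp
  rw [← this]
  refine mem_closure_of_ratio n d hn hd h0 ?_
  filter_upwards [hY, hT] with s h1 h2
  rwa [funext h1]

theorem eventually_ne_nhdsNE {a : ℂ} (h : a ≠ 0) : ∀ᶠ s in 𝓝[≠] (0 : ℂ), s ≠ a :=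
  eventually_nhdsWithin_of_eventually_nhds (eventually_ne_nhds h.symm)

theorem eventually_genPt_mem {Y : ℂ → ℂ} : ∀ᶠ s in 𝓝[≠] (0 : ℂ), genPt s⁻¹ (Y s) ∈ blowup := by
  filter_upwards [self_mem_nhdsWithin, eventually_ne_nhdsNE one_ne_zero] with s h0 h1
  exact genPt_mem (inv_ne_zero h0) (fun e => h1 (inv_eq_one.1 e))

theorem ptE_mem_blowup (a : P1) : ptE a ∈ blowup := by
  rw [← isClosed_blowup.closure_eq]
  refine mem_closure_of_cofinite (Set.finite_singleton 0) continuous_ptE (fun u hu => ?_) a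
  have hu0 : u ≠ 0 := hu
  rw [← isClosed_blowup.closure_eq]
  -- The family x = 1/s, y = u/s, for which t = (u - s)/(1 - s) and w = (u - 1)s/(1 - s). For u = 0
  -- the coordinates of y would be (0, 0) at s = 0; that point is recovered by closure.
  refine mem_closure_genPt (fun s => u / s) (fun s => ![1, u, u, u - s, (u - 1) * s])
    (fun s => ![s, s, 1, 1 - s, 1 - s]) (by fun_prop) (by fun_prop) ?_ ?_ ?_ eventually_genPt_mem
  · simp [Fin.forall_fin_succ, hu0]
  · simp [Fin.forall_fin_succ, ptE]
  · filter_upwards [self_mem_nhdsWithin, eventually_ne_nhdsNE one_ne_zero] with s h0 h1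
    have h0' : s ≠ 0 := h0
    have h1' := sub_ne_zero.2 h1.symm
    simp only [Fin.forall_fin_succ, genPt]
    simp [ratio_of_ne h0', ratio_of_ne h1', h0']
    refine ⟨?_, ?_⟩ <;> field_simp

theorem ptQ_mem_blowup (a : P1) : ptQ a ∈ blowup := by
  rw [← isClosed_blowup.closure_eq]
  refine mem_closure_of_cofinite (Set.finite_singleton 0) continuous_ptQ (fun w hw => ?_) a
  have hw0 : w ≠ 0 := hw
  rw [← isClosed_blowup.closure_eq]
  -- The value of y solves (y - x)/(x(x - 1)) = w for x = 1/s, so w is constant along the family.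
  refine mem_closure_genPt (fun s => (w * (1 - s) + s) / s ^ 2)
    (fun s => ![1, w * (1 - s) + s, w * (1 - s) + s, w + s, w])
    (fun s => ![s, s ^ 2, s, s, 1]) (by fun_prop) (by fun_prop) ?_ ?_ ?_ eventually_genPt_mem
  · simp [Fin.forall_fin_succ, hw0]
  · simp [Fin.forall_fin_succ, ptQ]
  · filter_upwards [self_mem_nhdsWithin, eventually_ne_nhdsNE one_ne_zero] with s h0 h1
    have h0' : s ≠ 0 := h0
    have h1' := sub_ne_zero.2 h1.symm
    have h2 : s ^ 2 ≠ 0 := pow_ne_zero 2 h0'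
    simp only [Fin.forall_fin_succ, genPt]
    simp [ratio_of_ne h0', ratio_of_ne h2]
    refine ⟨?_, ?_, ?_⟩ <;> field_simp <;> ring

theorem mem_blowupThree {x : ℂ} (h0 : x ≠ 0) (h1 : x ≠ 1) :
    (![(x : P1), ∞, ∞, ∞] : Fin 4 → P1) ∈ blowupThree := by
  have h1' := sub_ne_zero.2 h1
  have := mem_closure_of_ratio (T := {p | ∃ x y : ℂ, x ≠ 0 ∧ x ≠ 1 ∧
      p = ![(x : P1), (y : P1), ((y / x : ℂ) : P1), (((y - 1) / (x - 1) : ℂ) : P1)]})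
    (fun s => ![x, 1, 1, 1 - s]) (fun s => ![1, s, x * s, s * (x - 1)]) (by fun_prop) (by fun_prop)
    (by simp [Fin.forall_fin_succ]) (by
      filter_upwards [self_mem_nhdsWithin] with s hs
      have hs' : s ≠ 0 := hs
      refine ⟨x, s⁻¹, h0, h1, ?_⟩
      rw [funext_iff]
      simp only [Fin.forall_fin_succ]
      simp [ratio_of_ne hs', ratio_of_ne (mul_ne_zero h0 hs'), ratio_of_ne (mul_ne_zero hs' h1')]
      refine ⟨?_, ?_⟩ <;> field_simp)
  have e : (![(x : P1), ∞, ∞, ∞] : Fin 4 → P1) =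
      fun i => ratio ((![x, 1, 1, 1 - 0] : Fin 4 → ℂ) i) ((![1, 0, x * 0, 0 * (x - 1)] : Fin 4 → ℂ) i) := by
    rw [funext_iff]
    simp [Fin.forall_fin_succ]
  rw [e]
  exact this

/-- Along the line y = ∞ both u and t are ∞ at finite x, hence also in the limit x → ∞. The points
with x = 1/s on this line show that the limit exists. -/
theorem centreQ_eq : centreQ = {fun _ => ∞} := by
  refine Set.Subset.antisymm ?_ ?_
  · rintro p ⟨⟨-, h0, h1⟩, h⟩
    have hcl : closure {p | p ∈ blowupThree ∧ p 1 = ∞ ∧ p 0 ≠ ∞} ⊆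
        {p | p 2 = ∞} ∩ {p | p 3 = ∞} := by
      refine closure_minimal ?_ ((isClosed_eq (continuous_apply 2) continuous_const).inter
        (isClosed_eq (continuous_apply 3) continuous_const))
      rintro p ⟨hp, hp1, hp0⟩
      exact blowupThree_subset hp hp1 hp0
    rw [Set.mem_singleton_iff, funext_iff]
    simp only [Fin.forall_fin_succ]
    exact ⟨h0, h1, (hcl h).1, (hcl h).2, by simp⟩
  · rintro _ rfl
    have hlim : (fun _ => ∞) ∈ closure {p : Fin 4 → P1 | p ∈ blowupThree ∧ p 1 = ∞ ∧ p 0 ≠ ∞} := by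
      have := mem_closure_of_ratio (T := {p : Fin 4 → P1 | p ∈ blowupThree ∧ p 1 = ∞ ∧ p 0 ≠ ∞})
        (fun s => ![1, 1, 1, 1]) (fun s => ![s, 0, 0, 0]) (by fun_prop) (by fun_prop)
        (by simp [Fin.forall_fin_succ]) (by
          filter_upwards [self_mem_nhdsWithin, eventually_ne_nhdsNE one_ne_zero] with s h0 h1
          have h0' : s ≠ 0 := h0
          have e : (fun i : Fin 4 => ratio ((![1, 1, 1, 1] : Fin 4 → ℂ) i)
              ((![s, 0, 0, 0] : Fin 4 → ℂ) i)) = ![((s⁻¹ : ℂ) : P1), ∞, ∞, ∞] := by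
            rw [funext_iff]
            simp [Fin.forall_fin_succ, ratio_of_ne h0']
          have hm : ![((s⁻¹ : ℂ) : P1), ∞, ∞, ∞] ∈
              {p : Fin 4 → P1 | p ∈ blowupThree ∧ p 1 = ∞ ∧ p 0 ≠ ∞} :=
            ⟨mem_blowupThree (inv_ne_zero h0') (fun e => h1 (inv_eq_one.1 e)), rfl, by simp⟩
          rw [← e] at hm
          exact hm)
      convert this using 1
      rw [funext_iff]
      simp [Fin.forall_fin_succ]
    refine ⟨⟨?_, rfl, rfl⟩, hlim⟩
    have : closure {p : Fin 4 → P1 | p ∈ blowupThree ∧ p 1 = ∞ ∧ p 0 ≠ ∞} ⊆ blowupThree :=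
      closure_minimal (fun p hp => hp.1) isClosed_closure
    exact this hlim

theorem ExcQ_eq : ExcQ = Set.range ptQ := by
  refine Set.Subset.antisymm ?_ ?_
  · rintro p ⟨-, h⟩
    rw [centreQ_eq, Set.mem_singleton_iff, funext_iff] at h
    refine ⟨p 4, ?_⟩
    rw [funext_iff]
    simp only [Fin.forall_fin_succ] at h ⊢
    exact ⟨h.1.symm, h.2.1.symm, h.2.2.1.symm, h.2.2.2.1.symm, rfl, by simp⟩
  · rintro _ ⟨w, rfl⟩
    refine ⟨ptQ_mem_blowup w, ?_⟩
    rw [centreQ_eq, Set.mem_singleton_iff, funext_iff]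
    simp only [Fin.forall_fin_succ]
    exact ⟨rfl, rfl, rfl, rfl, by simp⟩

theorem ptE_coe_notMem_ExcQ (u : ℂ) : ptE (u : P1) ∉ ExcQ := by
  rw [ExcQ_eq]
  rintro ⟨w, hw⟩
  exact infty_ne_coe u (congrFun hw 2)

/-- At x = ∞ the relation `relUT` reads t = u, and `relUW` gives w = 0 unless u = ∞; in the latter
case the point lies on `E_q`. -/
theorem ExcInf_eq : ExcInf = Set.range ptE := by
  refine Set.Subset.antisymm ?_ ?_
  · refine closure_minimal ?_ (isCompact_range continuous_ptE).isClosed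
    rintro p ⟨hp, hs, hq⟩
    have hx : p 0 = ∞ := (Prod.mk.inj hs).1
    have hy : p 1 = ∞ := (Prod.mk.inj hs).2
    have e1 := blowup_relUT hp
    have e2 := blowup_relUW hp
    simp only [relUT, relUW, hx, hom0_infty, hom1_infty, sub_zero, mul_one, mul_zero,
      zero_mul] at e1 e2
    refine ⟨p 2, ?_⟩
    by_cases hu : p 2 = ∞
    · exfalso
      apply hq
      have h3 : p 3 = ∞ := by
        apply eq_infty_of_hom1
        simp only [hu, hom0_infty, hom1_infty, mul_zero, mul_one] at e1
        linear_combination -e1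
      rw [ExcQ_eq]
      refine ⟨p 4, ?_⟩
      rw [funext_iff]
      simp only [Fin.forall_fin_succ]
      exact ⟨hx.symm, hy.symm, hu.symm, h3.symm, rfl, by simp⟩
    · obtain ⟨u, hu⟩ := ne_infty_iff_exists.1 hu
      simp only [← hu, hom0_coe, hom1_coe, mul_one] at e1 e2
      have h3 : p 3 = (u : P1) := eq_coe_of_hom (by linear_combination e1)
      have h4 : p 4 = ((0 : ℂ) : P1) := eq_zero_of_hom0 (by linear_combination e2)
      rw [funext_iff]
      simp only [Fin.forall_fin_succ]
      exact ⟨hx.symm, hy.symm, rfl, hu.symm.trans h3.symm, h4.symm, by simp⟩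
  · rintro _ ⟨a, rfl⟩
    refine mem_closure_of_cofinite Set.finite_empty continuous_ptE (fun u _ => ?_) a
    exact ⟨ptE_mem_blowup _, rfl, ptE_coe_notMem_ExcQ u⟩

/-! ### The curve `𝒵` -/

/-- The equations of the four components of `𝒵`. -/
def relZ : Fin 4 → (Fin 5 → ℂ) → (Fin 5 → ℂ) → ℂ :=
  ![fun n d => d 1 * (n 0 - d 0) ^ 2 - n 1 * d 0 ^ 2,
    fun n d => n 0 ^ 2 * d 1 + n 1 * d 0 ^ 2 - d 0 ^ 2 * d 1,
    fun n d => n 0 * d 1 + n 1 * d 0 - d 0 * d 1,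
    fun n d => 2 * n 0 * d 0 * n 1 + n 0 ^ 2 * d 1 - n 1 * d 0 ^ 2 - 2 * n 0 * d 0 * d 1 +
      d 0 ^ 2 * d 1]

/-- The equations of the proper transforms of the four components of `𝒵` in terms of `x` and `u`. -/
def relZU : Fin 4 → (Fin 5 → ℂ) → (Fin 5 → ℂ) → ℂ :=
  ![fun n d => n 2 * n 0 * d 0 - d 2 * (n 0 - d 0) ^ 2,
    fun n d => n 2 * n 0 * d 0 - d 2 * (d 0 ^ 2 - n 0 ^ 2),
    fun n d => (n 2 + d 2) * n 0 - d 2 * d 0,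
    fun n d => (2 * n 2 + d 2) * n 0 ^ 2 - (n 2 + 2 * d 2) * n 0 * d 0 + d 2 * d 0 ^ 2]

/-- The equations of the proper transforms of two components of `𝒵` in terms of `x` and `w`. -/
def relZW : Fin 4 → (Fin 5 → ℂ) → (Fin 5 → ℂ) → ℂ :=
  ![fun n d => n 4 * n 0 * (n 0 - d 0) - d 4 * ((n 0 - d 0) ^ 2 - n 0 * d 0),
    fun n d => n 4 * n 0 * (n 0 - d 0) - d 4 * (d 0 ^ 2 - n 0 ^ 2 - n 0 * d 0),
    fun _ _ => 0, fun _ _ => 0]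

theorem isClosed_relZ (i : Fin 4) : IsClosed (zeroSet (relZ i)) := by
  refine isClosed_multihomogeneous _ ?_ fun s n d _ h => ?_
  · fin_cases i <;> simp only [relZ] <;> simp <;> fun_prop
  · fin_cases i <;> simp [relZ] at h ⊢
    · linear_combination s 0 ^ 2 * s 1 * h
    · linear_combination s 0 ^ 2 * s 1 * h
    · linear_combination s 0 * s 1 * h
    · linear_combination s 0 ^ 2 * s 1 * h

theorem isClosed_relZU (i : Fin 4) : IsClosed (zeroSet (relZU i)) := by
  refine isClosed_multihomogeneous _ ?_ fun s n d _ h => ?_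
  · fin_cases i <;> simp only [relZU] <;> simp <;> fun_prop
  · fin_cases i <;> simp [relZU] at h ⊢
    · linear_combination s 0 ^ 2 * s 2 * h
    · linear_combination s 0 ^ 2 * s 2 * h
    · linear_combination s 0 * s 2 * h
    · linear_combination s 0 ^ 2 * s 2 * h

theorem isClosed_relZW (i : Fin 4) : IsClosed (zeroSet (relZW i)) := by
  refine isClosed_multihomogeneous _ ?_ fun s n d _ h => ?_
  · fin_cases i <;> simp only [relZW] <;> simp <;> fun_prop
  · fin_cases i <;> simp [relZW] at h ⊢
    · linear_combination s 0 ^ 2 * s 4 * h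
    · linear_combination s 0 ^ 2 * s 4 * h

/-- The finite points of `𝒵` satisfy one of the four equations. -/
theorem ZSet_finite {x y : ℂ} (h : ((x : P1), (y : P1)) ∈ ZSet) :
    1 - 2 * x + x ^ 2 - y = 0 ∨ x ^ 2 + y = 1 ∨ x + y = 1 ∨
      2 * x * y + x ^ 2 - y - 2 * x + 1 = 0 := by
  -- The equations `relZ` involve only x and y. The remaining coordinates are filled with `∞` so
  -- that the closedness proved for five coordinates can be used.
  have hcl : IsClosed {p : P1 × P1 | ![p.1, p.2, ∞, ∞, ∞] ∈ ⋃ i, zeroSet (relZ i)} := by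
    refine (isClosed_iUnion_of_finite isClosed_relZ).preimage (continuous_pi fun i => ?_)
    fin_cases i <;> simp <;> fun_prop
  have := closure_minimal ?_ hcl h
  · simp [zeroSet, relZ, Fin.exists_fin_succ] at this
    refine this.imp (fun e => by linear_combination e) (Or.imp (fun e => by linear_combination e)
      (Or.imp (fun e => by linear_combination e) (fun e => by linear_combination e)))
  · rintro p ⟨x, y, rfl, h⟩
    simp [zeroSet, relZ, Fin.exists_fin_succ]
    refine h.imp (fun e => by linear_combination e) (Or.imp (fun e => by linear_combination e)
      (Or.imp (fun e => by linear_combination e) (fun e => by linear_combination e)))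

theorem mem_ZSet {x y : ℂ} (h : 1 - 2 * x + x ^ 2 - y = 0 ∨ x ^ 2 + y = 1 ∨ x + y = 1 ∨
      2 * x * y + x ^ 2 - y - 2 * x + 1 = 0) : ((x : P1), (y : P1)) ∈ ZSet :=
  subset_closure ⟨x, y, rfl, h⟩

theorem mem_Mf {x y : ℂ} (h : Nondeg x y) : ((x : P1), (y : P1)) ∈ Mf := by
  rintro (hL | hZ)
  · simp only [LSet, Set.mem_ofPred_eq, coe_eq_coe, coe_ne_infty, or_false] at hL
    rcases hL with e | e | e | e
    exacts [h.x0 e, h.y0 e, h.x1 e, h.y1 e]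
  · rcases ZSet_finite hZ with e | e | e | e
    exacts [h.z0 e, h.z1 e, h.zinf e, h.zy e]

/-! ### The curve `X` -/

theorem finite_not_nondeg : {t : ℂ | ¬ Nondeg t t}.Finite := by
  let P : ℂ[X] := X * (X - C 1) * (1 - 2 * X + X ^ 2 - X) * (X ^ 2 + X - 1) * (X + X - 1) *
    (2 * X * X + X ^ 2 - X - 2 * X + 1)
  have hP : P ≠ 0 := by
    intro h
    have := congrArg (Polynomial.eval 2) h
    simp [P] at this
    norm_num at this
  refine (P.rootSet_finite ℂ).subset fun t ht => ?_
  rw [mem_rootSet]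
  refine ⟨hP, ?_⟩
  by_contra h
  apply ht
  simp [P, sub_eq_zero] at h
  obtain ⟨⟨⟨⟨⟨h1, h2⟩, h3⟩, h4⟩, h5⟩, h6⟩ := h
  exact ⟨h1, h2, h1, h2, fun e => h3 (by linear_combination e), fun e => h4 (by linear_combination e),
    fun e => h5 (by linear_combination e), h6⟩

/-- The part of a proper transform that is not exceptional. -/
def openTransform (S : Set (P1 × P1)) : Set (Fin 5 → P1) :=
  {p | p ∈ blowup ∧ sigma p ∈ S ∧ sigma p ≠ (((0 : ℂ) : P1), ((0 : ℂ) : P1)) ∧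
    sigma p ≠ (((1 : ℂ) : P1), ((1 : ℂ) : P1)) ∧ sigma p ≠ (∞, ∞)}

theorem genPt_mem_openTransform {S : Set (P1 × P1)} {x y : ℂ} (h0 : x ≠ 0) (h1 : x ≠ 1)
    (h : ((x : P1), (y : P1)) ∈ S) : genPt x y ∈ openTransform S := by
  refine ⟨genPt_mem h0 h1, h, ?_, ?_, ?_⟩ <;> intro e <;> have := (Prod.mk.inj e).1 <;>
    simp [genPt] at this
  · exact h0 this
  · exact h1 this

/-- Only finitely many points of the diagonal are degenerate, so the closure restores all of them,
and the image of the compact line is closed. -/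
theorem properTransform_VSet : properTransform VSet = Set.range ptV := by
  refine Set.Subset.antisymm ?_ ?_
  · refine closure_minimal ?_ (isCompact_range continuous_ptV).isClosed
    rintro p ⟨hp, ⟨hM, he⟩, -⟩
    have hn := Mf.nondeg hM
    have hL : sigma p ∉ LSet := fun h => hM (Or.inl h)
    simp only [LSet, Set.mem_ofPred_eq, not_or] at hL
    obtain ⟨x, hx⟩ := ne_infty_iff_exists.1 hL.2.2.2.2.1
    have hx0 : p 0 = (x : P1) := hx.symm
    have hx1 : p 1 = (x : P1) := he.symm.trans hx0
    have h0 : x ≠ 0 := by rintro rfl; exact hL.1 hx.symm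
    have h1 : x ≠ 1 := by rintro rfl; exact hL.2.2.1 hx.symm
    exact ⟨x, by rw [eq_genPt hp h0 h1 hx0 hx1, genPt_self h0 h1]⟩
  · rintro _ ⟨a, rfl⟩
    refine mem_closure_of_cofinite finite_not_nondeg continuous_ptV (fun t ht => ?_) a
    have hn : Nondeg t t := not_not.1 ht
    rw [← genPt_self hn.x0 hn.x1]
    exact genPt_mem_openTransform hn.x0 hn.x1 ⟨mem_Mf hn, rfl⟩

/-- A closed set that contains the proper transforms of the lines and of `𝒵`. -/
def degenerate : Set (Fin 5 → P1) :=
  {p | p 0 = ((0 : ℂ) : P1) ∧ p 2 = ∞} ∪ {p | p 0 = ((1 : ℂ) : P1) ∧ p 3 = ∞} ∪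
  {p | p 0 = ∞ ∧ p 2 = ((0 : ℂ) : P1)} ∪ {p | p 1 = ((0 : ℂ) : P1) ∧ p 2 = ((0 : ℂ) : P1)} ∪
  {p | p 1 = ((1 : ℂ) : P1) ∧ p 3 = ((0 : ℂ) : P1)} ∪ {p | p 1 = ∞ ∧ p 4 = ∞} ∪
  ⋃ i, zeroSet (relZ i) ∩ zeroSet (relZU i) ∩ zeroSet (relZW i)

theorem isClosed_degenerate : IsClosed degenerate := by
  have h : ∀ (i j : Fin 5) (a b : P1), IsClosed {p : Fin 5 → P1 | p i = a ∧ p j = b} :=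
    fun i j a b => (isClosed_eq (continuous_apply i) continuous_const).inter
      (isClosed_eq (continuous_apply j) continuous_const)
  refine ((((((h _ _ _ _).union (h _ _ _ _)).union (h _ _ _ _)).union (h _ _ _ _)).union
    (h _ _ _ _)).union (h _ _ _ _)).union (isClosed_iUnion_of_finite fun i => ?_)
  exact ((isClosed_relZ i).inter (isClosed_relZU i)).inter (isClosed_relZW i)

theorem mem_degenerate {p : Fin 5 → P1} : p ∈ degenerate ↔
    (p 0 = ((0 : ℂ) : P1) ∧ p 2 = ∞) ∨ (p 0 = ((1 : ℂ) : P1) ∧ p 3 = ∞) ∨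
    (p 0 = ∞ ∧ p 2 = ((0 : ℂ) : P1)) ∨ (p 1 = ((0 : ℂ) : P1) ∧ p 2 = ((0 : ℂ) : P1)) ∨
    (p 1 = ((1 : ℂ) : P1) ∧ p 3 = ((0 : ℂ) : P1)) ∨ (p 1 = ∞ ∧ p 4 = ∞) ∨
    ∃ i, p ∈ zeroSet (relZ i) ∧ p ∈ zeroSet (relZU i) ∧ p ∈ zeroSet (relZW i) := by
  simp only [degenerate, Set.mem_union, Set.mem_ofPred_eq, Set.mem_iUnion, Set.mem_inter_iff,
    or_assoc, and_assoc]

theorem genPt_mem_degenerate {x y : ℂ} (h0 : x ≠ 0) (h1 : x ≠ 1)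
    (h : ((x : P1), (y : P1)) ∈ ZSet) : genPt x y ∈ degenerate := by
  have h1' := sub_ne_zero.2 h1
  simp only [mem_degenerate]
  iterate 6 right
  rcases ZSet_finite h with e | e | e | e
  · refine ⟨0, ?_, ?_, ?_⟩ <;> simp [zeroSet, relZ, relZU, relZW, genPt] <;>
      field_simp <;> first | linear_combination e | linear_combination -e
  · refine ⟨1, ?_, ?_, ?_⟩ <;> simp [zeroSet, relZ, relZU, relZW, genPt] <;>
      field_simp <;> linear_combination e
  · refine ⟨2, ?_, ?_, ?_⟩ <;> simp [zeroSet, relZ, relZU, relZW, genPt] <;>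
      field_simp <;> linear_combination e
  · refine ⟨3, ?_, ?_, ?_⟩ <;> simp [zeroSet, relZ, relZU, relZW, genPt] <;>
      field_simp <;> linear_combination e

/-- Away from the three blown-up points the relations of the blowup force a second coordinate on
each line, for instance u = ∞ on x = 0 or w = ∞ on y = ∞. Likewise, each component of `𝒵` satisfies
equations in x, u and in x, w. These extra conditions survive in the closure and cut the exceptional
curves in the right points. -/
theorem properTransform_subset_degenerate : properTransform (LSet ∪ ZSet) ⊆ degenerate := by
  refine closure_minimal ?_ isClosed_degenerate
  rintro p ⟨hp, hS, hz, ho, hi⟩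
  have e1 := blowup_relU hp
  have e2 := blowup_relT hp
  have e3 := blowup_relW hp
  simp only [relU, relT, relW] at e1 e2 e3
  have hz' : p 0 = ((0 : ℂ) : P1) → p 1 ≠ ((0 : ℂ) : P1) := fun a b => hz (Prod.ext a b)
  have ho' : p 0 = ((1 : ℂ) : P1) → p 1 ≠ ((1 : ℂ) : P1) := fun a b => ho (Prod.ext a b)
  have hi' : p 0 = ∞ → p 1 ≠ ∞ := fun a b => hi (Prod.ext a b)
  have key : sigma p ∈ LSet → p ∈ degenerate := by
    rw [mem_degenerate]
    rintro (h | h | h | h | h | h)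
    · have h : p 0 = ((0 : ℂ) : P1) := h
      refine Or.inl ⟨h, eq_infty_of_hom1 ?_⟩
      have := hom0_ne_zero (hz' h)
      simp only [h, hom0_coe, hom1_coe, mul_zero, zero_mul, sub_zero, mul_one] at e1
      exact (mul_eq_zero.1 e1).resolve_left this
    · have h : p 1 = ((0 : ℂ) : P1) := h
      refine Or.inr (Or.inr (Or.inr (Or.inl ⟨h, eq_zero_of_hom0 ?_⟩)))
      have := hom0_ne_zero (fun e => hz' e h)
      simp only [h, hom0_coe, hom1_coe, zero_mul, zero_sub, one_mul, neg_eq_zero] at e1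
      exact (mul_eq_zero.1 e1).resolve_left this
    · have h : p 0 = ((1 : ℂ) : P1) := h
      refine Or.inr (Or.inl ⟨h, eq_infty_of_hom1 ?_⟩)
      have := hom_sub_ne_zero (ho' h)
      simp only [h, hom0_coe, hom1_coe, sub_self, mul_zero, zero_mul, sub_zero, mul_one] at e2
      exact (mul_eq_zero.1 e2).resolve_left this
    · have h : p 1 = ((1 : ℂ) : P1) := h
      refine Or.inr (Or.inr (Or.inr (Or.inr (Or.inl ⟨h, eq_zero_of_hom0 ?_⟩))))
      have := hom_sub_ne_zero (fun e => ho' e h)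
      simp only [h, hom0_coe, hom1_coe, sub_self, zero_mul, zero_sub, mul_one, neg_eq_zero] at e2
      exact (mul_eq_zero.1 e2).resolve_right this
    · have h : p 0 = ∞ := h
      refine Or.inr (Or.inr (Or.inl ⟨h, eq_zero_of_hom0 ?_⟩))
      have := hom1_ne_zero (hi' h)
      simp only [h, hom0_infty, hom1_infty, mul_zero, zero_mul, zero_sub, mul_one,
        neg_eq_zero] at e1
      exact (mul_eq_zero.1 e1).resolve_left this
    · have h : p 1 = ∞ := h
      refine Or.inr (Or.inr (Or.inr (Or.inr (Or.inr (Or.inl ⟨h, eq_infty_of_hom1 ?_⟩)))))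
      have := hom1_ne_zero (fun e => hi' e h)
      simp only [h, hom0_infty, hom1_infty, mul_zero, zero_sub, sub_zero, one_mul,
        neg_eq_zero, mul_eq_zero] at e3
      tauto
  by_cases hL : sigma p ∈ LSet
  · exact key hL
  · have hZ := hS.resolve_left hL
    simp only [LSet, Set.mem_ofPred_eq, not_or] at hL
    obtain ⟨x, hx⟩ := ne_infty_iff_exists.1 hL.2.2.2.2.1
    obtain ⟨y, hy⟩ := ne_infty_iff_exists.1 hL.2.2.2.2.2
    have h0 : x ≠ 0 := by rintro rfl; exact hL.1 hx.symm
    have h1 : x ≠ 1 := by rintro rfl; exact hL.2.2.1 hx.symm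
    rw [eq_genPt hp h0 h1 hx.symm hy.symm]
    refine genPt_mem_degenerate h0 h1 ?_
    rw [hx, hy]
    exact hZ

/-! ### Points of X̂ = diagonal ∪ `E_∞` ∪ `E_q` on the removed set. -/

theorem eventually_genPt_mem_Z {Y : ℂ → ℂ}
    (h : ∀ s : ℂ, s ≠ 0 → s ≠ 2 → 1 - 2 * s⁻¹ + s⁻¹ ^ 2 - Y s = 0 ∨ s⁻¹ ^ 2 + Y s = 1 ∨
      s⁻¹ + Y s = 1 ∨ 2 * s⁻¹ * Y s + s⁻¹ ^ 2 - Y s - 2 * s⁻¹ + 1 = 0) :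
    ∀ᶠ s in 𝓝[≠] (0 : ℂ), genPt s⁻¹ (Y s) ∈ openTransform (LSet ∪ ZSet) := by
  filter_upwards [self_mem_nhdsWithin, eventually_ne_nhdsNE one_ne_zero,
    eventually_ne_nhdsNE two_ne_zero] with s h0 h1 h2
  exact genPt_mem_openTransform (inv_ne_zero h0) (fun e => h1 (inv_eq_one.1 e))
    (Or.inr (mem_ZSet (h s h0 h2)))

/-- The branch of x + y = 1 at infinity has y / x → -1. -/
theorem ptE_neg_one_mem : ptE ((-1 : ℂ) : P1) ∈ properTransform (LSet ∪ ZSet) := by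
  refine mem_closure_genPt (fun s => 1 - s⁻¹) (fun s => ![1, s - 1, s - 1, -1, s ^ 2 - 2 * s])
    (fun s => ![s, s, 1, 1 - s, 1 - s]) (by fun_prop) (by fun_prop) ?_ ?_ ?_
    (eventually_genPt_mem_Z fun s h _ => Or.inr (Or.inr (Or.inl (by ring))))
  · simp [Fin.forall_fin_succ]
  · simp [Fin.forall_fin_succ, ptE]
  · filter_upwards [self_mem_nhdsWithin, eventually_ne_nhdsNE one_ne_zero] with s h0 h1
    have h0' : s ≠ 0 := h0
    have h1' := sub_ne_zero.2 h1.symm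
    simp only [Fin.forall_fin_succ, genPt]
    simp [ratio_of_ne h0', ratio_of_ne h1']
    refine ⟨?_, ?_, ?_, ?_⟩ <;> field_simp <;> ring

theorem ptE_neg_half_mem : ptE ((-(1 / 2) : ℂ) : P1) ∈ properTransform (LSet ∪ ZSet) := by
  -- The fourth curve is y = -(x - 1)²/(2x - 1), whence y / x → -1/2. The value s = 2, that is x =
  -- 1/2, is its pole and is avoided.
  refine mem_closure_genPt (fun s => -(1 - s) ^ 2 / (s * (2 - s)))
    (fun s => ![1, -(1 - s) ^ 2, -(1 - s) ^ 2, -1, -s * ((1 - s) ^ 2 + 2 - s)])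
    (fun s => ![s, s * (2 - s), 2 - s, (2 - s) * (1 - s), (2 - s) * (1 - s)])
    (by fun_prop) (by fun_prop) ?_ ?_ ?_
    (eventually_genPt_mem_Z fun s h h2 => Or.inr (Or.inr (Or.inr ?_)))
  · simp [Fin.forall_fin_succ]
  · simp [Fin.forall_fin_succ, ptE, ratio_of_ne]
    norm_num
  · filter_upwards [self_mem_nhdsWithin, eventually_ne_nhdsNE one_ne_zero,
      eventually_ne_nhdsNE two_ne_zero] with s h0 h1 h2
    have h0' : s ≠ 0 := h0
    have h1' := sub_ne_zero.2 h1.symm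
    have h2' := sub_ne_zero.2 h2.symm
    simp only [Fin.forall_fin_succ, genPt]
    simp [ratio_of_ne h0', ratio_of_ne h2', ratio_of_ne (mul_ne_zero h0' h2'),
      ratio_of_ne (mul_ne_zero h2' h1')]
    refine ⟨?_, ?_, ?_⟩ <;> field_simp <;> ring
  · have h2' := sub_ne_zero.2 h2.symm
    field_simp
    ring

/-- The parabola y = (1 - x)² passes through q with w → 1. -/
theorem ptQ_one_mem : ptQ ((1 : ℂ) : P1) ∈ properTransform (LSet ∪ ZSet) := by
  refine mem_closure_genPt (fun s => (1 - s) ^ 2 / s ^ 2)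
    (fun s => ![1, (1 - s) ^ 2, (1 - s) ^ 2, 1 - 2 * s, (1 - s) ^ 2 - s])
    (fun s => ![s, s ^ 2, s, s * (1 - s), 1 - s]) (by fun_prop) (by fun_prop) ?_ ?_ ?_
    (eventually_genPt_mem_Z fun s h _ => Or.inl ?_)
  · simp [Fin.forall_fin_succ]
  · simp [Fin.forall_fin_succ, ptQ]
  · filter_upwards [self_mem_nhdsWithin, eventually_ne_nhdsNE one_ne_zero] with s h0 h1
    have h0' : s ≠ 0 := h0
    have h1' := sub_ne_zero.2 h1.symm
    simp only [Fin.forall_fin_succ, genPt]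
    simp [ratio_of_ne h0', ratio_of_ne h1', ratio_of_ne (pow_ne_zero 2 h0'),
      ratio_of_ne (mul_ne_zero h0' h1')]
    refine ⟨?_, ?_, ?_⟩ <;> field_simp <;> ring
  · field_simp
    ring

/-- The parabola y = 1 - x² passes through q with w → -1. -/
theorem ptQ_neg_one_mem : ptQ ((-1 : ℂ) : P1) ∈ properTransform (LSet ∪ ZSet) := by
  refine mem_closure_genPt (fun s => (s ^ 2 - 1) / s ^ 2)
    (fun s => ![1, s ^ 2 - 1, s ^ 2 - 1, -1, s ^ 2 - 1 - s])
    (fun s => ![s, s ^ 2, s, s * (1 - s), 1 - s]) (by fun_prop) (by fun_prop) ?_ ?_ ?_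
    (eventually_genPt_mem_Z fun s h _ => Or.inr (Or.inl ?_))
  · simp [Fin.forall_fin_succ]
  · simp [Fin.forall_fin_succ, ptQ]
  · filter_upwards [self_mem_nhdsWithin, eventually_ne_nhdsNE one_ne_zero] with s h0 h1
    have h0' : s ≠ 0 := h0
    have h1' := sub_ne_zero.2 h1.symm
    simp only [Fin.forall_fin_succ, genPt]
    simp [ratio_of_ne h0', ratio_of_ne h1', ratio_of_ne (pow_ne_zero 2 h0'),
      ratio_of_ne (mul_ne_zero h0' h1')]
    refine ⟨?_, ?_, ?_⟩ <;> field_simp <;> ring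
  · field_simp
    ring

theorem ptE_zero_mem : ptE ((0 : ℂ) : P1) ∈ properTransform (LSet ∪ ZSet) := by
  -- A parametrization by y of the proper transform of the line x = ∞; its point at y = ∞ is the
  -- point u = 0 of `E_∞`.
  let f (a : P1) : Fin 5 → P1 :=
    ![∞, a, ((0 : ℂ) : P1), ((0 : ℂ) : P1), ((0 : ℂ) : P1)]
  have hf : Continuous f := by
    refine continuous_pi fun i => ?_
    fin_cases i <;> simp only [f] <;> first | exact continuous_id | exact continuous_const
  refine mem_closure_of_cofinite (f := f) Set.finite_empty hf (fun c _ => ?_) ∞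
  refine ⟨?_, Or.inl (Or.inr (Or.inr (Or.inr (Or.inr (Or.inl rfl))))), ?_, ?_, ?_⟩
  · rw [← isClosed_blowup.closure_eq]
    refine mem_closure_genPt (fun s => c)
      (fun s => ![1, c, c * s, s * (c - 1), c * s ^ 2 - s])
      (fun s => ![s, 1, 1, 1 - s, 1 - s]) (by fun_prop) (by fun_prop) ?_ ?_ ?_ eventually_genPt_mem
    · simp [Fin.forall_fin_succ]
    · simp [Fin.forall_fin_succ, f]
    · filter_upwards [self_mem_nhdsWithin, eventually_ne_nhdsNE one_ne_zero] with s h0 h1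
      have h0' : s ≠ 0 := h0
      have h1' := sub_ne_zero.2 h1.symm
      simp only [Fin.forall_fin_succ, genPt]
      simp [ratio_of_ne h0', ratio_of_ne h1']
      refine ⟨?_, ?_⟩ <;> field_simp
  · exact fun e => infty_ne_coe _ (Prod.mk.inj e).1
  · exact fun e => infty_ne_coe _ (Prod.mk.inj e).1
  · exact fun e => coe_ne_infty _ (Prod.mk.inj e).2

theorem ptQ_infty_mem : ptQ ∞ ∈ properTransform (LSet ∪ ZSet) := by
  -- A parametrization by x of the proper transform of the line y = ∞; its point at x = ∞ is the
  -- point w = ∞ of `E_q`.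
  let f (a : P1) : Fin 5 → P1 := ![a, ∞, ∞, ∞, ∞]
  have hf : Continuous f := by
    refine continuous_pi fun i => ?_
    fin_cases i <;> simp only [f] <;> first | exact continuous_id | exact continuous_const
  refine mem_closure_of_cofinite (f := f) (Set.toFinite {0, 1}) hf (fun x hx => ?_) ∞
  simp only [Set.mem_insert_iff, Set.mem_singleton_iff, not_or] at hx
  have h1' := sub_ne_zero.2 hx.2
  refine ⟨?_, Or.inl (Or.inr (Or.inr (Or.inr (Or.inr (Or.inr rfl))))), ?_, ?_, ?_⟩
  · rw [← isClosed_blowup.closure_eq]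
    have := mem_closure_of_ratio (T := blowup) (fun s => ![x, 1, 1, 1 - s, 1 - x * s])
      (fun s => ![1, s, x * s, s * (x - 1), s * x * (x - 1)]) (by fun_prop) (by fun_prop)
      (by simp [Fin.forall_fin_succ]) (by
        filter_upwards [self_mem_nhdsWithin] with s hs
        have hs' : s ≠ 0 := hs
        have e : (fun i : Fin 5 => ratio ((![x, 1, 1, 1 - s, 1 - x * s] : Fin 5 → ℂ) i)
            ((![1, s, x * s, s * (x - 1), s * x * (x - 1)] : Fin 5 → ℂ) i)) = genPt x s⁻¹ := by
          rw [funext_iff]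
          simp only [Fin.forall_fin_succ, genPt]
          simp [ratio_of_ne hs', ratio_of_ne (mul_ne_zero hx.1 hs'),
            ratio_of_ne (mul_ne_zero hs' h1'),
            ratio_of_ne (mul_ne_zero (mul_ne_zero hs' hx.1) h1')]
          refine ⟨?_, ?_, ?_⟩ <;> field_simp
        rw [e]
        exact genPt_mem hx.1 hx.2)
    have e : f x = fun i => ratio ((![x, 1, 1, 1 - 0, 1 - x * 0] : Fin 5 → ℂ) i)
        ((![1, 0, x * 0, 0 * (x - 1), 0 * x * (x - 1)] : Fin 5 → ℂ) i) := by
      rw [funext_iff]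
      simp [Fin.forall_fin_succ, f]
    rw [e]
    exact this
  · exact fun e => infty_ne_coe _ (Prod.mk.inj e).2
  · exact fun e => infty_ne_coe _ (Prod.mk.inj e).2
  · exact fun e => coe_ne_infty _ (Prod.mk.inj e).1

theorem ptV_mem {x : ℂ} (h0 : x ≠ 0) (h1 : x ≠ 1) (h : ¬ Nondeg x x) :
    ptV x ∈ properTransform (LSet ∪ ZSet) := by
  rw [← genPt_self h0 h1]
  refine subset_closure (genPt_mem_openTransform h0 h1 ?_)
  by_contra hM
  exact h (Mf.nondeg (p := ((x : P1), (x : P1))) hM)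

theorem ptV_notMem {x : ℂ} (h : x = 0 ∨ x = 1 ∨ Nondeg x x) : ptV x ∉ degenerate := by
  rw [mem_degenerate]
  simp only [ptV, zeroSet, relZ, Fin.exists_fin_succ, Set.mem_ofPred_eq]
  rcases h with rfl | rfl | h
  · simp
  · simp
  · simp [h.x0, h.x1]
    refine ⟨fun e => ?_, fun e => ?_, fun e => ?_, fun e => ?_⟩
    · exact absurd (by linear_combination e) h.z0
    · exact absurd (by linear_combination e) h.z1
    · exact absurd (by linear_combination e) h.zinf
    · exact absurd (by linear_combination e) h.zy

/-- At x = ∞ the four equations `relZU` take the values -1, 1, u + 1 and 2u + 1. -/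
theorem ptE_notMem {u : ℂ} (h : GoodU u) : ptE u ∉ degenerate := by
  rw [mem_degenerate]
  simp only [ptE, zeroSet, relZU, Fin.exists_fin_succ, Set.mem_ofPred_eq]
  simp [h.u0, h.u1, h.u2]

/-- At x = u = ∞ the first two equations `relZU` are trivial and are replaced by `relZW`, with
values w - 1 and w + 1; the other two equations `relZU` take nonzero constant values. -/
theorem ptQ_notMem {w : ℂ} (h1 : w ≠ 1) (h2 : w ≠ -1) : ptQ w ∉ degenerate := by
  rw [mem_degenerate]
  simp only [ptQ, zeroSet, relZU, relZW, Fin.exists_fin_succ, Set.mem_ofPred_eq]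
  have h1' := sub_ne_zero.2 h1
  have h2' : w + 1 ≠ 0 := fun e => h2 (by linear_combination e)
  simp [h1', h2']

/-- The explicit description of X on which all later case distinctions rest. Points are shown to be
absent by exhibiting them as limits of the lines or of `𝒵`, and to be present by the closed set
`degenerate`. -/
theorem mem_XSet_iff {p : Fin 5 → P1} : p ∈ XSet ↔
    (∃ x : ℂ, (x = 0 ∨ x = 1 ∨ Nondeg x x) ∧ p = ptV x) ∨ (∃ u : ℂ, GoodU u ∧ p = ptE u) ∨
    ∃ w : ℂ, w ≠ 1 ∧ w ≠ -1 ∧ p = ptQ w := by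
  have hg : GoodU 1 := ⟨by norm_num, by norm_num, by norm_num⟩
  constructor
  · rintro ⟨hp, hn⟩
    rw [properTransform_VSet, ExcInf_eq, ExcQ_eq] at hp
    have hQ : ∀ a, p = ptQ a → ∃ w : ℂ, w ≠ 1 ∧ w ≠ -1 ∧ p = ptQ w := by
      rintro a rfl
      induction a using OnePoint.rec with
      | infty => exact absurd ptQ_infty_mem hn
      | coe w =>
        refine ⟨w, ?_, ?_, rfl⟩
        · rintro rfl; exact hn ptQ_one_mem
        · rintro rfl; exact hn ptQ_neg_one_mem
    rcases hp with (⟨a, rfl⟩ | ⟨a, rfl⟩) | ⟨a, rfl⟩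
    · induction a using OnePoint.rec with
      -- The point at infinity of the diagonal is the point u = 1 of `E_∞`.
      | infty => exact Or.inr (Or.inl ⟨1, hg, rfl⟩)
      | coe x =>
        refine Or.inl ⟨x, ?_, rfl⟩
        by_contra h
        simp only [not_or] at h
        exact hn (ptV_mem h.1 h.2.1 h.2.2)
    · induction a using OnePoint.rec with
      | infty => exact Or.inr (Or.inr (hQ _ rfl))
      | coe u =>
        refine Or.inr (Or.inl ⟨u, ⟨?_, ?_, ?_⟩, rfl⟩)
        · rintro rfl; exact hn ptE_zero_mem
        · intro e
          rw [eq_neg_of_add_eq_zero_left e] at hn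
          exact hn ptE_neg_one_mem
        · intro e
          have : u = -(1 / 2) := by linear_combination e / 2
          rw [this] at hn
          exact hn ptE_neg_half_mem
    · exact Or.inr (Or.inr (hQ _ rfl))
  · rintro (⟨x, h, rfl⟩ | ⟨u, h, rfl⟩ | ⟨w, h1, h2, rfl⟩)
    · refine ⟨Or.inl (Or.inl ?_), fun h' => ptV_notMem h (properTransform_subset_degenerate h')⟩
      rw [properTransform_VSet]; exact ⟨_, rfl⟩
    · refine ⟨Or.inl (Or.inr ?_), fun h' => ptE_notMem h (properTransform_subset_degenerate h')⟩
      rw [ExcInf_eq]; exact ⟨_, rfl⟩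
    · refine ⟨Or.inr ?_, fun h' => ptQ_notMem h1 h2 (properTransform_subset_degenerate h')⟩
      rw [ExcQ_eq]; exact ⟨_, rfl⟩

/-- The complement of a finite subset of ℂ is connected and dense in the projective line, and `S`
lies between its image and the closure of that image. -/
theorem isConnected_of_cofinite {S : Set P1} (h : {t : ℂ | (t : P1) ∉ S}.Finite) :
    IsConnected S := by
  have h1 : IsConnected {t : ℂ | (t : P1) ∉ S}ᶜ :=
    h.countable.isConnected_compl_of_one_lt_rank (by rw [Complex.rank_real_complex]; norm_num)
  refine (h1.image _ continuous_coe.continuousOn).subset_closure ?_ ?_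
  · rintro _ ⟨t, ht, rfl⟩
    exact not_not.1 ht
  · rw [closure_coe_compl_finite h]
    exact Set.subset_univ _

/-- The three pieces are images of cofinite subsets of the line and form a chain: the point x = ∞ of
the diagonal is u = 1 on `E_∞`, and u = ∞ on `E_∞` is w = 0 on `E_q`. -/
theorem isConnected_XSet : IsConnected XSet := by
  have hV : IsConnected (ptV ⁻¹' XSet) := by
    refine isConnected_of_cofinite (finite_not_nondeg.subset fun t ht hn => ht ?_)
    exact mem_XSet_iff.2 (Or.inl ⟨t, Or.inr (Or.inr hn), rfl⟩)
  have hE : IsConnected (ptE ⁻¹' XSet) := by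
    refine isConnected_of_cofinite ((Set.toFinite {0, -1, -(1 / 2)}).subset fun t ht => ?_)
    by_contra hn
    simp only [Set.mem_insert_iff, Set.mem_singleton_iff, not_or] at hn
    refine ht (mem_XSet_iff.2 (Or.inr (Or.inl ⟨t, ⟨hn.1, ?_, ?_⟩, rfl⟩)))
    · exact fun e => hn.2.1 (by linear_combination e)
    · exact fun e => hn.2.2 (by linear_combination e / 2)
  have hQ : IsConnected (ptQ ⁻¹' XSet) := by
    refine isConnected_of_cofinite ((Set.toFinite {1, -1}).subset fun t ht => ?_)
    by_contra hn
    simp only [Set.mem_insert_iff, Set.mem_singleton_iff, not_or] at hn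
    exact ht (mem_XSet_iff.2 (Or.inr (Or.inr ⟨t, hn.1, hn.2, rfl⟩)))
  have h1 : ptE ((1 : ℂ) : P1) ∈ XSet :=
    mem_XSet_iff.2 (Or.inr (Or.inl ⟨1, ⟨by norm_num, by norm_num, by norm_num⟩, rfl⟩))
  have h2 : ptQ ((0 : ℂ) : P1) ∈ XSet :=
    mem_XSet_iff.2 (Or.inr (Or.inr ⟨0, by norm_num, by norm_num, rfl⟩))
  have hVE : IsConnected (ptV '' (ptV ⁻¹' XSet) ∪ ptE '' (ptE ⁻¹' XSet)) :=
    IsConnected.union ⟨ptE ((1 : ℂ) : P1), ⟨∞, h1, rfl⟩, ⟨_, h1, rfl⟩⟩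
      (hV.image _ continuous_ptV.continuousOn) (hE.image _ continuous_ptE.continuousOn)
  have : IsConnected (ptV '' (ptV ⁻¹' XSet) ∪ ptE '' (ptE ⁻¹' XSet) ∪ ptQ '' (ptQ ⁻¹' XSet)) :=
    IsConnected.union ⟨ptQ ((0 : ℂ) : P1), Or.inr ⟨∞, h2, rfl⟩, ⟨_, h2, rfl⟩⟩
      hVE (hQ.image _ continuous_ptQ.continuousOn)
  convert this using 1
  refine Set.Subset.antisymm (fun p hp => ?_) ?_
  · rcases mem_XSet_iff.1 hp with ⟨x, -, rfl⟩ | ⟨x, -, rfl⟩ | ⟨x, -, -, rfl⟩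
    · exact Or.inl (Or.inl ⟨_, hp, rfl⟩)
    · exact Or.inl (Or.inr ⟨_, hp, rfl⟩)
    · exact Or.inr ⟨_, hp, rfl⟩
  · simp

/-! ### Homogeneous coordinates of the marked points of the smooth coverings -/

/-- Homogeneous coordinates of the points over `0, 1, ∞, x, z` in terms of `x` and `r`. -/
def upLift {R : Type*} [CommRing R] (x r : R) : LP → R × R
  | .zero => (0, 1)
  | .one => (1, 1)
  | .inf => (1, 0)
  | .x => (x, 1)
  | .crit => (2 * x * r, x + r)
  | .inf' => (x * r, x + r)
  | .x' => (r, 1)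
  | .one' => (x * r, 1 - x)

/-- Homogeneous coordinates of the points `0, 1, ∞, x, z` in terms of `x` and `r`. -/
def lowLift {R : Type*} [CommRing R] (x r : R) : LB → R × R
  | .zero => (0, 1)
  | .one => (1, 1)
  | .inf => (1, 0)
  | .y => (x, 1)
  | .z => (-(x - r) ^ 2, 4 * x * r)

/-- The formulas for marked points are written over an arbitrary commutative ring, so that the same
expression gives local regular functions (in `Reg c p`) and complex numbers. Compatibility with the
evaluations `ev q` links the two; the other lemmas of this form have the same purpose. -/
theorem upLift_map {R R' : Type*} [CommRing R] [CommRing R'] (f : R →+* R') (x r : R) (a : LP) :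
    upLift (f x) (f r) a = (f (upLift x r a).1, f (upLift x r a).2) := by
  cases a <;> simp [upLift, map_ofNat]

theorem lowLift_map {R R' : Type*} [CommRing R] [CommRing R'] (f : R →+* R') (x r : R) (a : LB) :
    lowLift (f x) (f r) a = (f (lowLift x r a).1, f (lowLift x r a).2) := by
  cases a <;> simp [lowLift, map_ofNat]

theorem upLift_ne {x : ℂ} (h : Nondeg x x) (a : LP) :
    (upLift x (rPar x x) a).1 ≠ 0 ∨ (upLift x (rPar x x) a).2 ≠ 0 := by
  have := h.x0
  have := h.r_ne
  cases a <;> simp_all [upLift]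

theorem lowLift_ne {x : ℂ} (h : Nondeg x x) (a : LB) :
    (lowLift x (rPar x x) a).1 ≠ 0 ∨ (lowLift x (rPar x x) a).2 ≠ 0 := by
  have := h.x0
  have := h.r_ne
  cases a <;> simp_all [lowLift]

theorem upMark_eq {x : ℂ} (h : Nondeg x x) (a : LP) :
    upMark x x a = ratio (upLift x (rPar x x) a).1 (upLift x (rPar x x) a).2 := by
  have h1 := h.xr_ne
  have h2 := sub_ne_zero.2 h.x1.symm
  cases a <;> simp [upMark, upLift, ratio_of_ne, h1, h2]

theorem lowMark_eq {x : ℂ} (h : Nondeg x x) (a : LB) :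
    lowMark x x a = ratio (lowLift x (rPar x x) a).1 (lowLift x (rPar x x) a).2 := by
  have h1 : 4 * x * rPar x x ≠ 0 := by simp [h.x0, h.r_ne]
  cases a <;> simp [lowMark, lowLift, h.z_eq, ratio_of_ne h1]

/-- The Möbius images of the smooth upper curve. -/
theorem smooth_upper_realizes {x : ℂ} (h : Nondeg x x) {α β γ δ : ℂ} (hdet : α * δ - β * γ ≠ 0)
    {n' : LP → ℂ × ℂ} (h' : ∀ a, (n' a).1 ≠ 0 ∨ (n' a).2 ≠ 0)
    (e : ∀ a, (n' a).1 * (γ * (upLift x (rPar x x) a).1 + δ * (upLift x (rPar x x) a).2) =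
      (n' a).2 * (α * (upLift x (rPar x x) a).1 + β * (upLift x (rPar x x) a).2)) :
    (smoothDiagram x x h).upper.Realizes fun a => ratio (n' a).1 (n' a).2 :=
  MarkedCurve.realizes_of_ratio (C := smoothCurve (upMark x x) (upMark_inj h)) () hdet (upLift_ne h) h'
    (fun a => (MarkedCurve.smoothCurve_proj _ () a).trans (upMark_eq h a)) e

/-- The Möbius images of the smooth lower curve. -/
theorem smooth_lower_realizes {x : ℂ} (h : Nondeg x x) {α β γ δ : ℂ} (hdet : α * δ - β * γ ≠ 0)
    {n' : LB → ℂ × ℂ} (h' : ∀ a, (n' a).1 ≠ 0 ∨ (n' a).2 ≠ 0)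
    (e : ∀ a, (n' a).1 * (γ * (lowLift x (rPar x x) a).1 + δ * (lowLift x (rPar x x) a).2) =
      (n' a).2 * (α * (lowLift x (rPar x x) a).1 + β * (lowLift x (rPar x x) a).2)) :
    (smoothDiagram x x h).lower.Realizes fun a => ratio (n' a).1 (n' a).2 :=
  MarkedCurve.realizes_of_ratio (C := smoothCurve (lowMark x x) h.lowMark_inj) () hdet (lowLift_ne h) h'
    (fun a => (MarkedCurve.smoothCurve_proj _ () a).trans (lowMark_eq h a)) e

theorem rPar_self (x : ℂ) : rPar x x = (2 * x - 1) / (x - 1) := by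
  rw [rPar]; congr 1; ring

theorem Nondeg.two_x {x : ℂ} (h : Nondeg x x) : 2 * x - 1 ≠ 0 :=
  fun e => h.zinf (by linear_combination e)

/-! ### Sections near `E_∞` -/

/-- The marked points of the upper curve as seen from its components near a point of `E_∞`. -/
def upSecU {R : Type*} [CommRing R] (s u r : R) : Fin 3 → LP → R × R :=
  ![fun
    | .zero => (1, 0) | .one => (2 * r - 1, 1) | .inf => (-1, 1) | .x => (2 * r * s - 1, 1)
    | .crit => (r * s, 1) | .inf' => (1 + 2 * r * s, 1) | .x' => (1, 1)
    | .one' => (2 * s - 2 * u - 1, 1),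
    fun
    | .zero => (1, 0) | .one => (s - 1, s) | .inf => (1, 1) | .x => (0, 1)
    | .crit => (r * s - 1, 2 * r * s) | .inf' => (-1, r * s) | .x' => (r * s - 1, r * s)
    | .one' => (s * (r - 1) + u, r * s),
    fun
    | .zero => (1, 0) | .one => (r - 1, r * s) | .inf => (-1, r * s) | .x => (r * s - 1, r * s)
    | .crit => (r * s - 1, 2 * r * s) | .inf' => (1, 1) | .x' => (0, 1)
    | .one' => (s - u - 1, r * s)]

/-- The marked points of the lower curve as seen from its components near a point of `E_∞`. -/
def lowSecU {R : Type*} [CommRing R] (s u r : R) : Fin 2 → LB → R × R :=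
  ![fun
    | .zero => (1, 1) | .one => ((1 + r * s) ^ 2, (1 - r * s) ^ 2) | .inf => (1, 0)
    | .y => ((1 - r * s) ^ 2 + 4 * r * u, (1 - r * s) ^ 2) | .z => (0, 1),
    fun
    | .zero => (0, 1) | .one => (1, 1) | .inf => (1, 0) | .y => (u, s)
    | .z => (-(1 - r * s) ^ 2, 4 * r * s)]

theorem upSecU_map {R R' : Type*} [CommRing R] [CommRing R'] (f : R →+* R') (s u r : R) (v : Fin 3)
    (a : LP) : upSecU (f s) (f u) (f r) v a = (f (upSecU s u r v a).1, f (upSecU s u r v a).2) := by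
  fin_cases v <;> cases a <;> simp [upSecU, map_ofNat]

theorem lowSecU_map {R R' : Type*} [CommRing R] [CommRing R'] (f : R →+* R') (s u r : R) (v : Fin 2)
    (a : LB) : lowSecU (f s) (f u) (f r) v a = (f (lowSecU s u r v a).1, f (lowSecU s u r v a).2) := by
  fin_cases v <;> cases a <;> simp [lowSecU, map_ofNat]

theorem upSecU_ne {u : ℂ} (h : GoodU u) (v : Fin 3) (a : LP) :
    (upSecU 0 u (u + 1) v a).1 ≠ 0 ∨ (upSecU 0 u (u + 1) v a).2 ≠ 0 := by
  have h0 := h.u0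
  have h1 : -u - 1 ≠ 0 := fun e => h.u1 (by linear_combination -e)
  fin_cases v <;> cases a <;> simp [upSecU, h0, h1]

theorem lowSecU_ne {u : ℂ} (h : GoodU u) (v : Fin 2) (a : LB) :
    (lowSecU 0 u (u + 1) v a).1 ≠ 0 ∨ (lowSecU 0 u (u + 1) v a).2 ≠ 0 := by
  have h0 := h.u0
  fin_cases v <;> cases a <;> simp [lowSecU, h0]

theorem upperU_proj {u : ℂ} (h : GoodU u) (v : Fin 3) (a : LP) :
    (upperU u h).proj v a = ratio (upSecU 0 u (u + 1) v a).1 (upSecU 0 u (u + 1) v a).2 := by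
  fin_cases v <;> cases a <;> simp [CurveTable.proj, upperU, upSecU]
  all_goals ring

theorem lowerU_proj {u : ℂ} (h : GoodU u) (v : Fin 2) (a : LB) :
    (lowerU u h).proj v a = ratio (lowSecU 0 u (u + 1) v a).1 (lowSecU 0 u (u + 1) v a).2 := by
  fin_cases v <;> cases a <;> simp [CurveTable.proj, lowerU, lowSecU]
  all_goals ring

/-- The matrices are the coordinates (2r - t)/t, (t - x)/t and x(r - t)/(rt) on the source. Each
keeps three of the marked points apart as x → ∞, namely those that become distinct on the
corresponding component of the limit. -/
theorem smooth_upSecU {x : ℂ} (h : Nondeg x x) (v : Fin 3)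
    (h' : ∀ a, (upSecU x⁻¹ 1 (rPar x x) v a).1 ≠ 0 ∨ (upSecU x⁻¹ 1 (rPar x x) v a).2 ≠ 0) :
    (smoothDiagram x x h).upper.Realizes
      fun a => ratio (upSecU x⁻¹ 1 (rPar x x) v a).1 (upSecU x⁻¹ 1 (rPar x x) v a).2 := by
  have h0 := h.x0
  have h1 := sub_ne_zero.2 h.x1
  have hr := h.r_ne
  fin_cases v
  · refine smooth_upper_realizes h (α := -1) (β := 2 * rPar x x) (γ := 1) (δ := 0)
      (by simp [hr]) h' fun a => ?_
    cases a <;> simp [upSecU, upLift, rPar_self] <;> field_simp <;> ring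
  · refine smooth_upper_realizes h (α := 1) (β := -x) (γ := 1) (δ := 0)
      (by simp [h0]) h' fun a => ?_
    cases a <;> simp [upSecU, upLift, rPar_self] <;> field_simp <;> ring
  · refine smooth_upper_realizes h (α := -x) (β := x * rPar x x) (γ := rPar x x) (δ := 0)
      (by simp [h0, hr]) h' fun a => ?_
    cases a <;> simp [upSecU, upLift, rPar_self] <;> field_simp <;> ring

/-- The first matrix is the affine map fixing ∞ and taking the mark z to 0 and the mark 0 to 1; in
this coordinate the covering becomes the squaring map. The second is the identity, since 0, 1, ∞
stay apart on that component. -/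
theorem smooth_lowSecU {x : ℂ} (h : Nondeg x x) (v : Fin 2)
    (h' : ∀ a, (lowSecU x⁻¹ 1 (rPar x x) v a).1 ≠ 0 ∨ (lowSecU x⁻¹ 1 (rPar x x) v a).2 ≠ 0) :
    (smoothDiagram x x h).lower.Realizes
      fun a => ratio (lowSecU x⁻¹ 1 (rPar x x) v a).1 (lowSecU x⁻¹ 1 (rPar x x) v a).2 := by
  have h0 := h.x0
  have h1 := sub_ne_zero.2 h.x1
  have hr := h.r_ne
  have hxr := sub_ne_zero.2 h.x_ne_r
  fin_cases v
  · refine smooth_lower_realizes h (α := 4 * x * rPar x x) (β := (x - rPar x x) ^ 2) (γ := 0)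
      (δ := (x - rPar x x) ^ 2) (by simp [h0, hr, hxr]) h' fun a => ?_
    cases a <;> simp [lowSecU, lowLift, rPar_self] <;> field_simp <;> ring
  · refine smooth_lower_realizes h (α := 1) (β := 0) (γ := 0) (δ := 1)
      (by simp) h' fun a => ?_
    cases a <;> simp [lowSecU, lowLift, rPar_self] <;> field_simp

/-! ### Sections near `E_q` -/

/-- The marked points of the upper curve as seen from its components near `E_∞ ∩ E_q`, in
terms of `k = 1 / u` and `w`. -/
def upSecQ {R : Type*} [CommRing R] (k w : R) : Fin 4 → LP → R × R :=
  ![fun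
    | .zero => (1, 0) | .one => (2 + k, k) | .one' => (-2 - k, k) | .inf => (-(1 + w), 1)
    | .inf' => (1 + w, 1) | .x => (w - 1, 1) | .x' => (1 - w, 1) | .crit => (0, 1),
    fun
    | .zero => (1, 0) | .one => (1, 1) | .one' => (-1, 1) | .inf => (-k, 2 + k)
    | .x => (-k, 2 + k) | .inf' => (k, 2 + k) | .x' => (k, 2 + k) | .crit => (0, 1),
    fun
    | .zero => (1, 0) | .one => (1, 0) | .one' => (1, 0) | .inf => (1, 1) | .x => (0, 1)
    | .inf' => (1, -w) | .x' => (1 - w, -w) | .crit => (1 - w, -2 * w),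
    fun
    | .zero => (1, 0) | .one => (1, 0) | .one' => (1, 0) | .inf' => (1, 1) | .x' => (0, 1)
    | .inf => (-1, w) | .x => (w - 1, w) | .crit => (w - 1, 2 * w)]

/-- The marked points of the lower curve as seen from its components near `E_∞ ∩ E_q`. -/
def lowSecQ {R : Type*} [CommRing R] (k w : R) : Fin 3 → LB → R × R :=
  ![fun
    | .inf => (1, 0) | .z => (0, 1) | .one => ((1 + w) ^ 2, 1) | .zero => ((1 - w) ^ 2, 1)
    | .y => ((2 + k) ^ 2, k ^ 2),
    fun
    | .inf => (1, 0) | .y => (1, 1) | .z => (0, 1) | .zero => (k ^ 2, (2 + k) ^ 2)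
    | .one => (k ^ 2, (2 + k) ^ 2),
    fun
    | .zero => (0, 1) | .one => (1, 1) | .z => (-(1 - w) ^ 2, 4 * w) | .y => (1, 0) | .inf => (1, 0)]

theorem upSecQ_map {R R' : Type*} [CommRing R] [CommRing R'] (f : R →+* R') (k w : R) (v : Fin 4)
    (a : LP) : upSecQ (f k) (f w) v a = (f (upSecQ k w v a).1, f (upSecQ k w v a).2) := by
  fin_cases v <;> cases a <;> simp [upSecQ, map_ofNat]

theorem lowSecQ_map {R R' : Type*} [CommRing R] [CommRing R'] (f : R →+* R') (k w : R) (v : Fin 3)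
    (a : LB) : lowSecQ (f k) (f w) v a = (f (lowSecQ k w v a).1, f (lowSecQ k w v a).2) := by
  fin_cases v <;> cases a <;> simp [lowSecQ, map_ofNat]

theorem upSecQ_ne (w : ℂ) (v : Fin 4) (hv : v = 0 ∨ v = 1 ∨ w = 0) (a : LP) :
    (upSecQ 0 w v a).1 ≠ 0 ∨ (upSecQ 0 w v a).2 ≠ 0 := by
  fin_cases v <;> cases a <;> simp_all [upSecQ]

theorem lowSecQ_ne (w : ℂ) (v : Fin 3) (hv : v = 0 ∨ v = 1 ∨ w = 0) (a : LB) :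
    (lowSecQ 0 w v a).1 ≠ 0 ∨ (lowSecQ 0 w v a).2 ≠ 0 := by
  fin_cases v <;> cases a <;> simp_all [lowSecQ]

theorem upperCorner_proj (v : Fin 4) (a : LP) :
    upperCorner.proj v a = ratio (upSecQ 0 0 v a).1 (upSecQ 0 0 v a).2 := by
  fin_cases v <;> cases a <;> simp [CurveTable.proj, upperCorner, upSecQ, ratio]

theorem lowerCorner_proj (v : Fin 3) (a : LB) :
    lowerCorner.proj v a = ratio (lowSecQ 0 0 v a).1 (lowSecQ 0 0 v a).2 := by
  fin_cases v <;> cases a <;> simp [CurveTable.proj, lowerCorner, lowSecQ, ratio]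

theorem upperW_proj {w : ℂ} (h : GoodW w) (v : Fin 2) (a : LP) :
    (upperW w h).proj v a =
      ratio (upSecQ 0 w (v.castLE (by norm_num)) a).1 (upSecQ 0 w (v.castLE (by norm_num)) a).2 := by
  fin_cases v <;> cases a <;> simp [CurveTable.proj, upperW, upSecQ, ratio]

theorem lowerW_proj {w : ℂ} (h : GoodW w) (v : Fin 2) (a : LB) :
    (lowerW w h).proj v a =
      ratio (lowSecQ 0 w (v.castLE (by norm_num)) a).1 (lowSecQ 0 w (v.castLE (by norm_num)) a).2 := by
  fin_cases v <;> cases a <;> simp [CurveTable.proj, lowerW, lowSecQ, ratio]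

/-- For w ≠ 0 the components 2 and 3 of the corner are merged with the component 0. Their sections
are therefore rescalings of it, which enlarge the pairs ∞, x and `inf'`, `x'`, each at distance 2w.
-/
theorem diagramW_upSecQ {w : ℂ} (h : GoodW w) (v : Fin 4)
    (h' : ∀ a, (upSecQ 0 w v a).1 ≠ 0 ∨ (upSecQ 0 w v a).2 ≠ 0) :
    (diagramW w h).upper.Realizes fun a => ratio (upSecQ 0 w v a).1 (upSecQ 0 w v a).2 := by
  have hw := h.w0
  have key : ∀ (v : Fin 2) (a : LP), (upperW w h).curve.proj v ((upperW w h).curve.mark a) = _ :=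
    fun v a => ((upperW w h).curve_proj v a).trans (upperW_proj h v a)
  fin_cases v
  · exact MarkedCurve.realizes_of_proj (C := (upperW w h).curve) (0 : Fin 2) (key 0)
  · exact MarkedCurve.realizes_of_proj (C := (upperW w h).curve) (1 : Fin 2) (key 1)
  · refine MarkedCurve.realizes_of_ratio (C := (upperW w h).curve) (0 : Fin 2) (α := 1) (β := 1 - w) (γ := 0)
      (δ := -2 * w) (by simp [hw]) (upSecQ_ne w 0 (by simp)) h' (key 0) fun a => ?_
    cases a <;> simp [upSecQ] <;> ring
  · refine MarkedCurve.realizes_of_ratio (C := (upperW w h).curve) (0 : Fin 2) (α := 1) (β := w - 1) (γ := 0)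
      (δ := 2 * w) (by simp [hw]) (upSecQ_ne w 0 (by simp)) h' (key 0) fun a => ?_
    cases a <;> simp [upSecQ] <;> ring

theorem diagramW_lowSecQ {w : ℂ} (h : GoodW w) (v : Fin 3)
    (h' : ∀ a, (lowSecQ 0 w v a).1 ≠ 0 ∨ (lowSecQ 0 w v a).2 ≠ 0) :
    (diagramW w h).lower.Realizes fun a => ratio (lowSecQ 0 w v a).1 (lowSecQ 0 w v a).2 := by
  have hw := h.w0
  have key : ∀ (v : Fin 2) (a : LB), (lowerW w h).curve.proj v ((lowerW w h).curve.mark a) = _ :=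
    fun v a => ((lowerW w h).curve_proj v a).trans (lowerW_proj h v a)
  fin_cases v
  · exact MarkedCurve.realizes_of_proj (C := (lowerW w h).curve) (0 : Fin 2) (key 0)
  · exact MarkedCurve.realizes_of_proj (C := (lowerW w h).curve) (1 : Fin 2) (key 1)
  · refine MarkedCurve.realizes_of_ratio (C := (lowerW w h).curve) (0 : Fin 2) (α := 1) (β := -(1 - w) ^ 2)
      (γ := 0) (δ := 4 * w) (by simp [hw]) (lowSecQ_ne w 0 (by simp)) h' (key 0) fun a => ?_
    cases a <;> simp [lowSecQ] <;> ring

/-- For finite u the components 0 and 1 of the corner are merged into one, and their sections differ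
by the factor k/(2 + k) with k = 1/u. The other two components persist. -/
theorem diagramU_upSecQ {u : ℂ} (h : GoodU u) (v : Fin 4)
    (h' : ∀ a, (upSecQ u⁻¹ 0 v a).1 ≠ 0 ∨ (upSecQ u⁻¹ 0 v a).2 ≠ 0) :
    (diagramU u h).upper.Realizes fun a => ratio (upSecQ u⁻¹ 0 v a).1 (upSecQ u⁻¹ 0 v a).2 := by
  have hu := h.u0
  have h2 := h.u2
  have hk : 2 + u⁻¹ ≠ 0 := by
    intro e
    apply h2
    field_simp at e
    linear_combination e
  have key : ∀ (v : Fin 3) (a : LP), (upperU u h).curve.proj v ((upperU u h).curve.mark a) = _ :=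
    fun v a => ((upperU u h).curve_proj v a).trans (upperU_proj h v a)
  fin_cases v
  · refine MarkedCurve.realizes_of_ratio (C := (upperU u h).curve) (0 : Fin 3) (α := 1) (β := 0) (γ := 0)
      (δ := 1) (by simp) (upSecU_ne h 0) h' (key 0) fun a => ?_
    cases a <;> simp [upSecQ, upSecU] <;> field_simp <;> ring
  · refine MarkedCurve.realizes_of_ratio (C := (upperU u h).curve) (0 : Fin 3) (α := u⁻¹) (β := 0) (γ := 0)
      (δ := 2 + u⁻¹) (by simp [hu, hk]) (upSecU_ne h 0) h' (key 0) fun a => ?_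
    cases a <;> simp [upSecQ, upSecU] <;> field_simp <;> ring
  · refine MarkedCurve.realizes_of_ratio (C := (upperU u h).curve) (1 : Fin 3) (α := 1) (β := 0) (γ := 0)
      (δ := 1) (by simp) (upSecU_ne h 1) h' (key 1) fun a => ?_
    cases a <;> simp [upSecQ, upSecU]
  · refine MarkedCurve.realizes_of_ratio (C := (upperU u h).curve) (2 : Fin 3) (α := 1) (β := 0) (γ := 0)
      (δ := 1) (by simp) (upSecU_ne h 2) h' (key 2) fun a => ?_
    cases a <;> simp [upSecQ, upSecU]

theorem diagramU_lowSecQ {u : ℂ} (h : GoodU u) (v : Fin 3)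
    (h' : ∀ a, (lowSecQ u⁻¹ 0 v a).1 ≠ 0 ∨ (lowSecQ u⁻¹ 0 v a).2 ≠ 0) :
    (diagramU u h).lower.Realizes fun a => ratio (lowSecQ u⁻¹ 0 v a).1 (lowSecQ u⁻¹ 0 v a).2 := by
  have hu := h.u0
  have h2 := h.u2
  have hk : 2 + u⁻¹ ≠ 0 := by
    intro e
    apply h2
    field_simp at e
    linear_combination e
  have key : ∀ (v : Fin 2) (a : LB), (lowerU u h).curve.proj v ((lowerU u h).curve.mark a) = _ :=
    fun v a => ((lowerU u h).curve_proj v a).trans (lowerU_proj h v a)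
  fin_cases v
  · refine MarkedCurve.realizes_of_ratio (C := (lowerU u h).curve) (0 : Fin 2) (α := 1) (β := 0) (γ := 0)
      (δ := 1) (by simp) (lowSecU_ne h 0) h' (key 0) fun a => ?_
    cases a <;> simp [lowSecQ, lowSecU] <;> field_simp <;> ring
  · refine MarkedCurve.realizes_of_ratio (C := (lowerU u h).curve) (0 : Fin 2) (α := (u⁻¹) ^ 2) (β := 0) (γ := 0)
      (δ := (2 + u⁻¹) ^ 2) (by simp [hu, hk]) (lowSecU_ne h 0) h' (key 0) fun a => ?_
    cases a <;> simp [lowSecQ, lowSecU] <;> field_simp <;> ring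
  · refine MarkedCurve.realizes_of_ratio (C := (lowerU u h).curve) (1 : Fin 2) (α := 1) (β := 0) (γ := 0)
      (δ := 1) (by simp) (lowSecU_ne h 1) h' (key 1) fun a => ?_
    cases a <;> simp [lowSecQ, lowSecU]

/-! ### Sections near the diagonal -/

/-- The marked points of the upper curve as seen from its components near `x = 0`. -/
def upSecZero {R : Type*} [CommRing R] (x r : R) : Fin 5 → LP → R × R :=
  ![fun
    | .zero => (1, 0) | .crit => (x, r) | .inf' => (r + 2 * x, r) | .x => (1, 1)
    | .x' => (2 * x - r, r) | .one => (2 * x - 1, 1) | .inf => (-1, 1)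
    | .one' => (2 * (1 - x) - r, r),
    fun
    | .zero => (1, 0) | .one => (0, 1) | .inf => (1, 1) | .x => (x - 1, x)
    | .crit => (2 * x * r - x - r, 2 * x * r) | .inf' => (x * r - x - r, x * r)
    | .x' => (r - 1, r) | .one' => (x * r - 1 + x, x * r),
    fun
    | .zero => (1, 0) | .one => (2 * x - 1, x) | .inf => (-r, x) | .crit => (x - r, 2 * x)
    | .x' => (x - r, x) | .inf' => (1, 1) | .x => (0, 1) | .one' => (x, 1 - x),
    fun
    | .zero => (1, 0) | .inf => (1 - x, x) | .x => ((1 - x) * (x - r), x ^ 2)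
    | .crit => ((1 - x) * (x - r), 2 * x ^ 2) | .inf' => (-(1 - x) * r, x ^ 2)
    | .one' => ((1 - x) * (2 * x - 1), x ^ 2) | .one => (1, 1) | .x' => (0, 1),
    fun
    | .zero => (1, 0) | .inf => (2 * x - 1, x ^ 2) | .one => ((2 * x - 1) * (1 - x), x ^ 2)
    | .crit => ((2 * x - 1) * (r - x), 2 * r * x ^ 2) | .inf' => (-(2 * x - 1), r * x)
    | .x' => ((2 * x - 1) * (r - x), r * x ^ 2) | .x => (0, 1) | .one' => (1, 1)]

/-- The marked points of the lower curve as seen from its components near `x = 0`. -/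
def lowSecZero {R : Type*} [CommRing R] (x r : R) : Fin 3 → LB → R × R :=
  ![fun
    | .zero => (1, 1) | .one => ((x + r) ^ 2, (x - r) ^ 2)
    | .y => ((x - r) ^ 2 + 4 * x ^ 2 * r, (x - r) ^ 2) | .inf => (1, 0) | .z => (0, 1),
    fun
    | .zero => (0, 1) | .one => (1, 1) | .inf => (1, 0) | .y => (x, 1)
    | .z => (-(x - r) ^ 2, 4 * x * r),
    fun
    | .zero => (0, 1) | .y => (1, 1) | .one => (1, x) | .inf => (1, 0)
    | .z => (-(x - r) ^ 2, 4 * x ^ 2 * r)]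

/-- The marked points of the upper curve as seen from its components near `x = 1`, in terms of `x`
and `R = 1 / r`. -/
def upSecOne {R : Type*} [CommRing R] (x r : R) : Fin 5 → LP → R × R :=
  ![fun
    | .zero => (1, 0) | .crit => (x * r, 1) | .inf' => (1 + 2 * x * r, 1) | .x => (1, 1)
    | .one => (2 * x - 1, 1) | .x' => (2 * x * r - 1, 1) | .inf => (-1, 1)
    | .one' => (-2 * (x - 1) * r - 1, 1),
    fun
    | .inf => (0, 1) | .x' => (1, 1) | .one' => (1 - x, x) | .zero => (1, 0) | .one => (1, r)
    | .x => (1, x * r) | .crit => (x * r + 1, 2 * x * r) | .inf' => (x * r + 1, x * r),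
    fun
    | .x => (1, 1) | .one => (1 - x, x) | .inf => (x * r + 1, x * r)
    | .crit => (x * r + 1, 2 * x * r) | .x' => (1, x * r)
    | .one' => (x * r + (x - 1) * r + 1, x * r) | .zero => (1, 0) | .inf' => (0, 1),
    fun
    | .inf => (0, 1) | .one' => (1, 1) | .zero => (1, 0) | .crit => (-(x * r + 1), 2 * (x - 1) * r)
    | .inf' => (-(x * r + 1), (x - 1) * r) | .x' => (-x, x - 1) | .x => (-1, (x - 1) * r)
    | .one => (-x, (x - 1) * r),
    fun
    | .zero => (1, 0) | .inf' => (0, 1) | .one => (1, 1) | .inf => (-(x * r + 1), (x - 1) * r)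
    | .x => (-x, x - 1) | .crit => (-(x * r + 1), 2 * (x - 1) * r) | .x' => (-1, (x - 1) * r)
    | .one' => (-(x * r + 1 + (x - 1) * r), (x - 1) * r)]

/-- The marked points of the lower curve as seen from its components near `x = 1`. -/
def lowSecOne {R : Type*} [CommRing R] (x r : R) : Fin 3 → LB → R × R :=
  ![fun
    | .zero => (1, 1) | .one => ((1 + x * r) ^ 2, (1 - x * r) ^ 2)
    | .y => ((1 - x * r) ^ 2 + 4 * x ^ 2 * r, (1 - x * r) ^ 2) | .inf => (1, 0) | .z => (0, 1),
    fun
    | .zero => (1, 1) | .one => (0, 1) | .inf => (1, 0) | .y => (1 - x, 1)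
    | .z => ((1 + x * r) ^ 2, 4 * x * r),
    fun
    | .one => (0, 1) | .y => (1, 1) | .zero => (-1, x - 1) | .inf => (1, 0)
    | .z => (-(1 + x * r) ^ 2, 4 * x * r * (x - 1))]

/-- The marked points of the upper curve as seen from its components near `x = 0` (if `b` is false,
and then `r` is the second zero of the covering) and near `x = 1` (if `b` is true, and then `r` is
the inverse of the second zero). -/
def upSecCusp {R : Type*} [CommRing R] (b : Bool) (x r : R) : Fin 5 → LP → R × R :=
  if b then upSecOne x r else upSecZero x r

/-- The marked points of the lower curve as seen from its components near `x = 0, 1`. -/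
def lowSecCusp {R : Type*} [CommRing R] (b : Bool) (x r : R) : Fin 3 → LB → R × R :=
  if b then lowSecOne x r else lowSecZero x r

theorem upSecCusp_map {R R' : Type*} [CommRing R] [CommRing R'] (f : R →+* R') (b : Bool) (x r : R)
    (v : Fin 5) (a : LP) :
    upSecCusp b (f x) (f r) v a = (f (upSecCusp b x r v a).1, f (upSecCusp b x r v a).2) := by
  cases b <;> fin_cases v <;> cases a <;> simp [upSecCusp, upSecOne, upSecZero, map_ofNat]

theorem lowSecCusp_map {R R' : Type*} [CommRing R] [CommRing R'] (f : R →+* R') (b : Bool) (x r : R)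
    (v : Fin 3) (a : LB) :
    lowSecCusp b (f x) (f r) v a = (f (lowSecCusp b x r v a).1, f (lowSecCusp b x r v a).2) := by
  cases b <;> fin_cases v <;> cases a <;> simp [lowSecCusp, lowSecOne, lowSecZero, map_ofNat]

/-- The value of `x` at a cusp. -/
def cuspX (b : Bool) : ℂ := if b then 1 else 0

/-- The value of `r` or `1 / r` at a cusp. -/
def cuspR (b : Bool) : ℂ := if b then 0 else 1

theorem upSecCusp_ne (b : Bool) (v : Fin 5) (a : LP) :
    (upSecCusp b (cuspX b) (cuspR b) v a).1 ≠ 0 ∨ (upSecCusp b (cuspX b) (cuspR b) v a).2 ≠ 0 := by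
  cases b <;> fin_cases v <;> cases a <;> simp [upSecCusp, upSecOne, upSecZero, cuspX, cuspR]

theorem lowSecCusp_ne (b : Bool) (v : Fin 3) (a : LB) :
    (lowSecCusp b (cuspX b) (cuspR b) v a).1 ≠ 0 ∨
      (lowSecCusp b (cuspX b) (cuspR b) v a).2 ≠ 0 := by
  cases b <;> fin_cases v <;> cases a <;> simp [lowSecCusp, lowSecOne, lowSecZero, cuspX, cuspR]

theorem upperCusp_proj (b : Bool) (v : Fin 5) (a : LP) :
    (upperCusp.relabel (swapLP b) (swapLP_injective b)).proj v a =
      ratio (upSecCusp b (cuspX b) (cuspR b) v a).1 (upSecCusp b (cuspX b) (cuspR b) v a).2 := by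
  cases b <;> fin_cases v <;> cases a <;> simp [upSecCusp, upSecOne, upSecZero, cuspX, cuspR,
    CurveTable.proj, CurveTable.relabel, upperCusp, swapLP] <;> norm_num

theorem lowerCusp_proj (b : Bool) (v : Fin 3) (a : LB) :
    (lowerCusp.relabel (swapLB b) (swapLB_injective b)).proj v a =
      ratio (lowSecCusp b (cuspX b) (cuspR b) v a).1 (lowSecCusp b (cuspX b) (cuspR b) v a).2 := by
  cases b <;> fin_cases v <;> cases a <;> simp [lowSecCusp, lowSecOne, lowSecZero, cuspX, cuspR,
    CurveTable.proj, CurveTable.relabel, lowerCusp, swapLB]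

/-- The parameter `r` or `1 / r` near a cusp. -/
def cuspPar (b : Bool) (x : ℂ) : ℂ := if b then (x - 1) / (2 * x - 1) else (2 * x - 1) / (x - 1)

/-- The matrices are the zooms that separate the marks of the five components. For x → 0 they are
(2x - t)/t, (t - 1)/t, r(x - t)/(xt), (1 - x)(t - r)/(xt) and (2x - 1)(t - x)/(x²t). -/
theorem smooth_upSecCusp (b : Bool) {x : ℂ} (h : Nondeg x x) (v : Fin 5)
    (h' : ∀ a, (upSecCusp b x (cuspPar b x) v a).1 ≠ 0 ∨ (upSecCusp b x (cuspPar b x) v a).2 ≠ 0) :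
    (smoothDiagram x x h).upper.Realizes
      fun a => ratio (upSecCusp b x (cuspPar b x) v a).1 (upSecCusp b x (cuspPar b x) v a).2 := by
  have h0 := h.x0
  have h1 := sub_ne_zero.2 h.x1
  have h1' := sub_ne_zero.2 h.x1.symm
  have hr := h.r_ne
  have h2 := h.two_x
  have h2' : x * 2 - 1 ≠ 0 := by rwa [mul_comm]
  cases b
  · fin_cases v
    · refine smooth_upper_realizes h (α := -1) (β := 2 * x) (γ := 1) (δ := 0)
        (by simp [h0]) h' fun a => ?_
      cases a <;> simp [upSecCusp, upSecZero, cuspPar, upLift, rPar_self] <;> field_simp <;> ring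
    · refine smooth_upper_realizes h (α := 1) (β := -1) (γ := 1) (δ := 0)
        (by simp) h' fun a => ?_
      cases a <;> simp [upSecCusp, upSecZero, cuspPar, upLift, rPar_self] <;> field_simp <;> ring
    · refine smooth_upper_realizes h (α := -rPar x x) (β := rPar x x * x) (γ := x) (δ := 0)
        (by simp [h0, hr]) h' fun a => ?_
      cases a <;> simp [upSecCusp, upSecZero, cuspPar, upLift, rPar_self] <;> field_simp <;> ring
    · refine smooth_upper_realizes h (α := 1 - x) (β := -(1 - x) * rPar x x) (γ := x) (δ := 0)
        (by simp [h0, hr, h1', -neg_sub]) h' fun a => ?_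
      cases a <;> simp [upSecCusp, upSecZero, cuspPar, upLift, rPar_self] <;> field_simp <;> ring
    · refine smooth_upper_realizes h (α := 2 * x - 1) (β := -(2 * x - 1) * x) (γ := x ^ 2) (δ := 0)
        (by simp [h0, h2, -neg_sub]) h' fun a => ?_
      cases a <;> simp [upSecCusp, upSecZero, cuspPar, upLift, rPar_self] <;> field_simp <;> ring
  · fin_cases v
    · refine smooth_upper_realizes h (α := -1) (β := 2 * x) (γ := 1) (δ := 0)
        (by simp [h0]) h' fun a => ?_
      cases a <;> simp [upSecCusp, upSecOne, cuspPar, upLift, rPar_self] <;> field_simp <;> ring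
    · refine smooth_upper_realizes h (α := 0) (β := rPar x x) (γ := 1) (δ := 0)
        (by simp [hr]) h' fun a => ?_
      cases a <;> simp [upSecCusp, upSecOne, cuspPar, upLift, rPar_self] <;> field_simp
    · refine smooth_upper_realizes h (α := x + rPar x x) (β := -rPar x x * x) (γ := x) (δ := 0)
        (by simp [h0, hr]) h' fun a => ?_
      cases a <;> simp [upSecCusp, upSecOne, cuspPar, upLift, rPar_self] <;> field_simp <;> ring
    · refine smooth_upper_realizes h (α := 0) (β := x * rPar x x) (γ := 1 - x) (δ := 0)
        (by simp [h0, hr, h1', -neg_sub]) h' fun a => ?_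
      cases a <;> simp [upSecCusp, upSecOne, cuspPar, upLift, rPar_self] <;> field_simp <;> ring
    · refine smooth_upper_realizes h (α := -(x + rPar x x)) (β := x * rPar x x) (γ := x - 1) (δ := 0)
        (by simp [h0, hr, h1, -neg_sub]) h' fun a => ?_
      cases a <;> simp [upSecCusp, upSecOne, cuspPar, upLift, rPar_self] <;> field_simp <;> ring

theorem smooth_lowSecCusp (b : Bool) {x : ℂ} (h : Nondeg x x) (v : Fin 3)
    (h' : ∀ a, (lowSecCusp b x (cuspPar b x) v a).1 ≠ 0 ∨ (lowSecCusp b x (cuspPar b x) v a).2 ≠ 0) :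
    (smoothDiagram x x h).lower.Realizes
      fun a => ratio (lowSecCusp b x (cuspPar b x) v a).1 (lowSecCusp b x (cuspPar b x) v a).2 := by
  have h0 := h.x0
  have h1 := sub_ne_zero.2 h.x1
  have hr := h.r_ne
  have h2 := h.two_x
  have h2' : x * 2 - 1 ≠ 0 := by rwa [mul_comm]
  have hxr := sub_ne_zero.2 h.x_ne_r
  cases b
  · fin_cases v
    · refine smooth_lower_realizes h (α := 4 * x * rPar x x) (β := (x - rPar x x) ^ 2) (γ := 0)
        (δ := (x - rPar x x) ^ 2) (by simp [h0, hr, hxr]) h' fun a => ?_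
      cases a <;> simp [lowSecCusp, lowSecZero, cuspPar, lowLift, rPar_self] <;> field_simp <;> ring
    · refine smooth_lower_realizes h (α := 1) (β := 0) (γ := 0) (δ := 1) (by simp) h' fun a => ?_
      cases a <;> simp [lowSecCusp, lowSecZero, cuspPar, lowLift, rPar_self] <;> field_simp
    · refine smooth_lower_realizes h (α := 1) (β := 0) (γ := 0) (δ := x) (by simp [h0]) h' fun a => ?_
      cases a <;> simp [lowSecCusp, lowSecZero, cuspPar, lowLift, rPar_self] <;> field_simp
  · fin_cases v
    · refine smooth_lower_realizes h (α := 4 * x * rPar x x) (β := (x - rPar x x) ^ 2) (γ := 0)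
        (δ := (x - rPar x x) ^ 2) (by simp [h0, hr, hxr]) h' fun a => ?_
      cases a <;> simp [lowSecCusp, lowSecOne, cuspPar, lowLift, rPar_self] <;> field_simp <;> ring
    · refine smooth_lower_realizes h (α := -1) (β := 1) (γ := 0) (δ := 1) (by simp) h' fun a => ?_
      cases a <;> simp [lowSecCusp, lowSecOne, cuspPar, lowLift, rPar_self] <;> field_simp <;> ring
    · refine smooth_lower_realizes h (α := 1) (β := -1) (γ := 0) (δ := x - 1) (by simp [h1])
        h' fun a => ?_
      cases a <;> simp [lowSecCusp, lowSecOne, cuspPar, lowLift, rPar_self] <;> field_simp <;> ring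

/-! ### Regularity of the cross ratios -/

instance : Finite LP := by
  refine Finite.of_surjective
    (![.zero, .one, .inf, .x, .crit, .inf', .x', .one'] : Fin 8 → LP) fun a => ?_
  cases a
  exacts [⟨0, rfl⟩, ⟨1, rfl⟩, ⟨2, rfl⟩, ⟨3, rfl⟩, ⟨4, rfl⟩, ⟨5, rfl⟩, ⟨6, rfl⟩, ⟨7, rfl⟩]

instance : Finite LB := by
  refine Finite.of_surjective (![.zero, .one, .inf, .y, .z] : Fin 5 → LB) fun a => ?_
  cases a
  exacts [⟨0, rfl⟩, ⟨1, rfl⟩, ⟨2, rfl⟩, ⟨3, rfl⟩, ⟨4, rfl⟩]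

section Regions

variable {S I : Type*} {c : S → I → P1} {p : S}

/-- The form of `regPt_cross` suited to the tables of sections: `N` holds the regular functions and
`E` their values, so that the hypotheses speak of complex numbers only. -/
theorem regPt_cross_of_eq {A : Type} [Finite A] (C : S → MarkedCurve A) {M : MarkedCurve A}
    (hC : C p = M) (N : M.Comp → A → Reg c p × Reg c p) (E : S → M.Comp → A → ℂ × ℂ)
    (hE : ∀ q v a, E q v a = (ev q (N v a).1, ev q (N v a).2))
    (h1 : ∀ v a, (E p v a).1 ≠ 0 ∨ (E p v a).2 ≠ 0)
    (h2 : ∀ v a, M.proj v (M.mark a) = ratio (E p v a).1 (E p v a).2)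
    (h3 : ∀ᶠ q in nearby c p, ∀ v, (∀ a, (E q v a).1 ≠ 0 ∨ (E q v a).2 ≠ 0) →
      (C q).Realizes fun a => ratio (E q v a).1 (E q v a).2)
    (a₁ a₂ a₃ a₄ : A) : RegPt c p fun q => (C q).cross a₁ a₂ a₃ a₄ := by
  refine regPt_cross C ?_ a₁ a₂ a₃ a₄
  rw [hC]
  simp only [hE] at h1 h2 h3
  exact fun v => ⟨fun a => (N v a).1, fun a => (N v a).2, h1 v, h2 v, h3.mono fun q hq => hq v⟩

theorem regPt_coord_diagram (D : S → Diagram)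
    (h : ∀ a₁ a₂ a₃ a₄, RegPt c p fun q => (D q).upper.cross a₁ a₂ a₃ a₄)
    (h' : ∀ a₁ a₂ a₃ a₄, RegPt c p fun q => (D q).lower.cross a₁ a₂ a₃ a₄) (i : AMf.Index) :
    RegPt c p fun q => AMf.coord ⟦D q⟧ i := by
  rcases i with l | l
  · exact h l.1 l.2.1 l.2.2.1 l.2.2.2
  · exact h' l.1 l.2.1 l.2.2.1 l.2.2.2

/-- Regularity near a smooth covering. -/
theorem regPt_smooth (D : S → Diagram) (x r : Reg c p)
    (H : ∀ᶠ q in nearby c p, ∃ h : Nondeg (ev q x) (ev q x),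
      D q = smoothDiagram _ _ h ∧ ev q r = rPar (ev q x) (ev q x)) (i : AMf.Index) :
    RegPt c p fun q => AMf.coord ⟦D q⟧ i := by
  obtain ⟨h₀, hD, hr⟩ := eventually_nearby_self H
  have hU : ∀ {x : ℂ} (h : Nondeg x x) (v : (smoothDiagram x x h).upper.Comp) (a : LP),
      (smoothDiagram x x h).upper.proj v ((smoothDiagram x x h).upper.mark a) =
        ratio (upLift x (rPar x x) a).1 (upLift x (rPar x x) a).2 :=
    fun h v a => (MarkedCurve.smoothCurve_proj (upMark_inj h) v a).trans (upMark_eq h a)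
  have hL : ∀ {x : ℂ} (h : Nondeg x x) (v : (smoothDiagram x x h).lower.Comp) (a : LB),
      (smoothDiagram x x h).lower.proj v ((smoothDiagram x x h).lower.mark a) =
        ratio (lowLift x (rPar x x) a).1 (lowLift x (rPar x x) a).2 :=
    fun h v a => (MarkedCurve.smoothCurve_proj h.lowMark_inj v a).trans (lowMark_eq h a)
  refine regPt_coord_diagram D
    (regPt_cross_of_eq (fun q => (D q).upper) (congrArg Diagram.upper hD)
      (fun _ => upLift x r) (fun q _ => upLift (ev q x) (ev q r)) (fun q _ a => upLift_map (ev q) x r a)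
      (fun _ => by rw [hr]; exact upLift_ne h₀) (fun v a => by rw [hr]; exact hU h₀ v a) ?_)
    (regPt_cross_of_eq (fun q => (D q).lower) (congrArg Diagram.lower hD)
      (fun _ => lowLift x r) (fun q _ => lowLift (ev q x) (ev q r)) (fun q _ a => lowLift_map (ev q) x r a)
      (fun _ => by rw [hr]; exact lowLift_ne h₀) (fun v a => by rw [hr]; exact hL h₀ v a) ?_) i
  · filter_upwards [H] with q hq v _
    obtain ⟨h, hD, hr⟩ := hq
    rw [hD, hr]
    exact MarkedCurve.realizes_of_proj _ (hU h v)
  · filter_upwards [H] with q hq v _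
    obtain ⟨h, hD, hr⟩ := hq
    rw [hD, hr]
    exact MarkedCurve.realizes_of_proj _ (hL h v)

/-- Regularity near the coverings over `E_∞`. -/
theorem regPt_diagramU (D : S → Diagram) (s u r : Reg c p) {u₀ : ℂ} (h₀ : GoodU u₀)
    (hD : D p = diagramU u₀ h₀) (hs : ev p s = 0) (hu : ev p u = u₀) (hr : ev p r = u₀ + 1)
    (H : ∀ᶠ q in nearby c p,
      (∃ (x : ℂ) (h : Nondeg x x), D q = smoothDiagram x x h ∧ ev q s = x⁻¹ ∧ ev q u = 1 ∧
        ev q r = rPar x x) ∨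
      ∃ (t : ℂ) (h : GoodU t), D q = diagramU t h ∧ ev q s = 0 ∧ ev q u = t ∧ ev q r = t + 1)
    (i : AMf.Index) : RegPt c p fun q => AMf.coord ⟦D q⟧ i := by
  have hU : ∀ {u : ℂ} (h : GoodU u) (v : Fin 3) (a : LP),
      (diagramU u h).upper.proj v ((diagramU u h).upper.mark a) = _ :=
    fun h v a => ((upperU _ h).curve_proj v a).trans (upperU_proj h v a)
  have hL : ∀ {u : ℂ} (h : GoodU u) (v : Fin 2) (a : LB),
      (diagramU u h).lower.proj v ((diagramU u h).lower.mark a) = _ :=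
    fun h v a => ((lowerU _ h).curve_proj v a).trans (lowerU_proj h v a)
  refine regPt_coord_diagram D
    (regPt_cross_of_eq (fun q => (D q).upper) (congrArg Diagram.upper hD)
      (upSecU s u r) (fun q => upSecU (ev q s) (ev q u) (ev q r))
      (fun q v a => upSecU_map (ev q) s u r v a)
      (by rw [hs, hu, hr]; exact upSecU_ne h₀) (by rw [hs, hu, hr]; exact hU h₀) ?_)
    (regPt_cross_of_eq (fun q => (D q).lower) (congrArg Diagram.lower hD)
      (lowSecU s u r) (fun q => lowSecU (ev q s) (ev q u) (ev q r))
      (fun q v a => lowSecU_map (ev q) s u r v a)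
      (by rw [hs, hu, hr]; exact lowSecU_ne h₀) (by rw [hs, hu, hr]; exact hL h₀) ?_) i
  · filter_upwards [H] with q hq v
    rcases hq with ⟨x, h, hD, h1, h2, h3⟩ | ⟨t, h, hD, h1, h2, h3⟩
    · rw [hD, h1, h2, h3]
      exact smooth_upSecU h v
    · rw [hD, h1, h2, h3]
      exact fun _ => MarkedCurve.realizes_of_proj (C := (diagramU t h).upper) v (hU h v)
  · filter_upwards [H] with q hq v
    rcases hq with ⟨x, h, hD, h1, h2, h3⟩ | ⟨t, h, hD, h1, h2, h3⟩
    · rw [hD, h1, h2, h3]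
      exact smooth_lowSecU h v
    · rw [hD, h1, h2, h3]
      exact fun _ => MarkedCurve.realizes_of_proj (C := (diagramU t h).lower) v (hL h v)

/-- Regularity near the coverings over `E_q`. -/
theorem regPt_diagramW (D : S → Diagram) (w : Reg c p)
    (H : ∀ᶠ q in nearby c p, ∃ h : GoodW (ev q w), D q = diagramW (ev q w) h)
    (i : AMf.Index) : RegPt c p fun q => AMf.coord ⟦D q⟧ i := by
  obtain ⟨h₀, hD⟩ := eventually_nearby_self H
  have hU : ∀ {w : ℂ} (h : GoodW w) (v : Fin 2) (a : LP),
      (diagramW w h).upper.proj v ((diagramW w h).upper.mark a) = _ :=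
    fun h v a => ((upperW _ h).curve_proj v a).trans (upperW_proj h v a)
  have hL : ∀ {w : ℂ} (h : GoodW w) (v : Fin 2) (a : LB),
      (diagramW w h).lower.proj v ((diagramW w h).lower.mark a) = _ :=
    fun h v a => ((lowerW _ h).curve_proj v a).trans (lowerW_proj h v a)
  have hv : ∀ {m : ℕ} (hm : 2 ≤ m + 2) (v : Fin 2), v.castLE hm = 0 ∨ v.castLE hm = 1 := by
    intro m hm v
    fin_cases v
    exacts [Or.inl rfl, Or.inr rfl]
  refine regPt_coord_diagram D
    (regPt_cross_of_eq (fun q => (D q).upper) (congrArg Diagram.upper hD)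
      (fun v => upSecQ 0 w (Fin.castLE (by norm_num : 2 ≤ 4) v))
      (fun q v => upSecQ 0 (ev q w) (Fin.castLE (by norm_num : 2 ≤ 4) v))
      (fun q v a => by rw [← upSecQ_map, map_zero])
      (fun v => upSecQ_ne _ _ ((hv _ v).imp_right Or.inl)) (hU h₀) ?_)
    (regPt_cross_of_eq (fun q => (D q).lower) (congrArg Diagram.lower hD)
      (fun v => lowSecQ 0 w (Fin.castLE (by norm_num : 2 ≤ 3) v))
      (fun q v => lowSecQ 0 (ev q w) (Fin.castLE (by norm_num : 2 ≤ 3) v))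
      (fun q v a => by rw [← lowSecQ_map, map_zero])
      (fun v => lowSecQ_ne _ _ ((hv _ v).imp_right Or.inl)) (hL h₀) ?_) i
  · filter_upwards [H] with q hq v _
    obtain ⟨h, hD⟩ := hq
    rw [hD]
    exact MarkedCurve.realizes_of_proj (C := (diagramW _ h).upper) v (hU h v)
  · filter_upwards [H] with q hq v _
    obtain ⟨h, hD⟩ := hq
    rw [hD]
    exact MarkedCurve.realizes_of_proj (C := (diagramW _ h).lower) v (hL h v)

/-- Regularity near the covering over `E_∞ ∩ E_q`. -/
theorem regPt_diagramCorner (D : S → Diagram) (k w : Reg c p)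
    (hD : D p = diagramCorner) (hk : ev p k = 0) (hw : ev p w = 0)
    (H : ∀ᶠ q in nearby c p,
      (∃ h : GoodW (ev q w), D q = diagramW (ev q w) h ∧ ev q k = 0) ∨
      (∃ (u : ℂ) (h : GoodU u), D q = diagramU u h ∧ ev q w = 0 ∧ ev q k = u⁻¹) ∨
      (D q = diagramCorner ∧ ev q w = 0 ∧ ev q k = 0))
    (i : AMf.Index) : RegPt c p fun q => AMf.coord ⟦D q⟧ i := by
  have hU : ∀ (v : Fin 4) (a : LP),
      diagramCorner.upper.proj v (diagramCorner.upper.mark a) = _ :=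
    fun v a => (upperCorner.curve_proj v a).trans (upperCorner_proj v a)
  have hL : ∀ (v : Fin 3) (a : LB),
      diagramCorner.lower.proj v (diagramCorner.lower.mark a) = _ :=
    fun v a => (lowerCorner.curve_proj v a).trans (lowerCorner_proj v a)
  refine regPt_coord_diagram D
    (regPt_cross_of_eq (fun q => (D q).upper) (congrArg Diagram.upper hD)
      (upSecQ k w) (fun q => upSecQ (ev q k) (ev q w)) (fun q v a => upSecQ_map (ev q) k w v a)
      (by rw [hk, hw]; exact fun v => upSecQ_ne 0 v (by simp)) (by rw [hk, hw]; exact hU) ?_)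
    (regPt_cross_of_eq (fun q => (D q).lower) (congrArg Diagram.lower hD)
      (lowSecQ k w) (fun q => lowSecQ (ev q k) (ev q w)) (fun q v a => lowSecQ_map (ev q) k w v a)
      (by rw [hk, hw]; exact fun v => lowSecQ_ne 0 v (by simp)) (by rw [hk, hw]; exact hL) ?_) i
  · filter_upwards [H] with q hq v
    rcases hq with ⟨h, hD, h1⟩ | ⟨u, h, hD, h1, h2⟩ | ⟨hD, h1, h2⟩
    · rw [hD, h1]
      exact diagramW_upSecQ h v
    · rw [hD, h1, h2]
      exact diagramU_upSecQ h v
    · rw [hD, h1, h2]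
      exact fun _ => MarkedCurve.realizes_of_proj (C := diagramCorner.upper) v (hU v)
  · filter_upwards [H] with q hq v
    rcases hq with ⟨h, hD, h1⟩ | ⟨u, h, hD, h1, h2⟩ | ⟨hD, h1, h2⟩
    · rw [hD, h1]
      exact diagramW_lowSecQ h v
    · rw [hD, h1, h2]
      exact diagramU_lowSecQ h v
    · rw [hD, h1, h2]
      exact fun _ => MarkedCurve.realizes_of_proj (C := diagramCorner.lower) v (hL v)

/-- Regularity near the limit coverings for `x = y → 0, 1`. -/
theorem regPt_diagramCusp (D : S → Diagram) (b : Bool) (x r : Reg c p)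
    (hD : D p = diagramCusp b) (hx : ev p x = cuspX b) (hr : ev p r = cuspR b)
    (H : ∀ᶠ q in nearby c p,
      (∃ h : Nondeg (ev q x) (ev q x), D q = smoothDiagram _ _ h ∧ ev q r = cuspPar b (ev q x)) ∨
      (D q = diagramCusp b ∧ ev q x = cuspX b ∧ ev q r = cuspR b))
    (i : AMf.Index) : RegPt c p fun q => AMf.coord ⟦D q⟧ i := by
  have hU : ∀ (v : Fin 5) (a : LP),
      (diagramCusp b).upper.proj v ((diagramCusp b).upper.mark a) = _ :=
    fun v a => ((upperCusp.relabel (swapLP b) (swapLP_injective b)).curve_proj v a).trans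
      (upperCusp_proj b v a)
  have hL : ∀ (v : Fin 3) (a : LB),
      (diagramCusp b).lower.proj v ((diagramCusp b).lower.mark a) = _ :=
    fun v a => ((lowerCusp.relabel (swapLB b) (swapLB_injective b)).curve_proj v a).trans
      (lowerCusp_proj b v a)
  refine regPt_coord_diagram D
    (regPt_cross_of_eq (fun q => (D q).upper) (congrArg Diagram.upper hD)
      (upSecCusp b x r) (fun q => upSecCusp b (ev q x) (ev q r))
      (fun q v a => upSecCusp_map (ev q) b x r v a)
      (by rw [hx, hr]; exact upSecCusp_ne b) (by rw [hx, hr]; exact hU) ?_)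
    (regPt_cross_of_eq (fun q => (D q).lower) (congrArg Diagram.lower hD)
      (lowSecCusp b x r) (fun q => lowSecCusp b (ev q x) (ev q r))
      (fun q v a => lowSecCusp_map (ev q) b x r v a)
      (by rw [hx, hr]; exact lowSecCusp_ne b) (by rw [hx, hr]; exact hL) ?_) i
  · filter_upwards [H] with q hq v
    rcases hq with ⟨h, hD, h1⟩ | ⟨hD, h1, h2⟩
    · rw [hD, h1]
      exact smooth_upSecCusp b h v
    · rw [hD, h1, h2]
      exact fun _ => MarkedCurve.realizes_of_proj (C := (diagramCusp b).upper) v (hU v)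
  · filter_upwards [H] with q hq v
    rcases hq with ⟨h, hD, h1⟩ | ⟨hD, h1, h2⟩
    · rw [hD, h1]
      exact smooth_lowSecCusp b h v
    · rw [hD, h1, h2]
      exact fun _ => MarkedCurve.realizes_of_proj (C := (diagramCusp b).lower) v (hL v)

end Regions

/-! ### The map `ξ` -/

open Classical in
/-- The covering over a point of `X`. -/
def diag (p : Fin 5 → P1) : Diagram :=
  -- Since `aff` takes ∞ to the excluded value 0, the tests for nondegeneracy and for `GoodU` fail
  -- at infinite coordinates, and each point of X falls through to its own branch; the last one is
  -- left for w = 0, u = ∞.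
  if h : Nondeg (aff (p 0)) (aff (p 1)) then smoothDiagram _ _ h
  else if p 0 = ((0 : ℂ) : P1) then diagramCusp false
  else if p 0 = ((1 : ℂ) : P1) then diagramCusp true
  else if h : GoodU (aff (p 2)) then diagramU _ h
  else if h : GoodW (aff (p 4)) then diagramW _ h
  else diagramCorner

theorem diag_ptV {x : ℂ} (h : Nondeg x x) : diag (ptV x) = smoothDiagram x x h :=
  dif_pos (show Nondeg (aff (ptV x 0)) (aff (ptV x 1)) from h)

theorem diag_cusp (b : Bool) : diag (ptV (cuspX b : P1)) = diagramCusp b := by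
  cases b
  · have h : ¬ Nondeg (aff (ptV ((0 : ℂ) : P1) 0)) (aff (ptV ((0 : ℂ) : P1) 1)) := fun h => h.x0 rfl
    rw [cuspX, if_neg (by simp), diag, dif_neg h]
    exact if_pos rfl
  · have h : ¬ Nondeg (aff (ptV ((1 : ℂ) : P1) 0)) (aff (ptV ((1 : ℂ) : P1) 1)) := fun h => h.x1 rfl
    rw [cuspX, if_pos rfl, diag, dif_neg h, if_neg (by simp [ptV])]
    exact if_pos rfl

theorem diag_ptE {u : ℂ} (h : GoodU u) : diag (ptE u) = diagramU u h := by
  have h0 : ¬ Nondeg (aff (ptE u 0)) (aff (ptE u 1)) := fun h => h.x0 rfl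
  rw [diag, dif_neg h0, if_neg (by simp [ptE]), if_neg (by simp [ptE])]
  exact dif_pos (show GoodU (aff (ptE u 2)) from h)

theorem diag_ptQ {w : ℂ} (h : GoodW w) : diag (ptQ w) = diagramW w h := by
  have h0 : ¬ Nondeg (aff (ptQ w 0)) (aff (ptQ w 1)) := fun h => h.x0 rfl
  have h1 : ¬ GoodU (aff (ptQ w 2)) := fun h => h.u0 rfl
  rw [diag, dif_neg h0, if_neg (by simp [ptQ]), if_neg (by simp [ptQ]), dif_neg h1]
  exact dif_pos (show GoodW (aff (ptQ w 4)) from h)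

theorem diag_corner : diag (ptQ ((0 : ℂ) : P1)) = diagramCorner := by
  have h0 : ¬ Nondeg (aff (ptQ ((0 : ℂ) : P1) 0)) (aff (ptQ ((0 : ℂ) : P1) 1)) := fun h => h.x0 rfl
  have h1 : ¬ GoodU (aff (ptQ ((0 : ℂ) : P1) 2)) := fun h => h.u0 rfl
  have h2 : ¬ GoodW (aff (ptQ ((0 : ℂ) : P1) 4)) := fun h => h.w0 rfl
  rw [diag, dif_neg h0, if_neg (by simp [ptQ]), if_neg (by simp [ptQ]), dif_neg h1, dif_neg h2]

/-- The points of `X` and their coverings. -/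
theorem XSet_cases (p : XSet) :
    (∃ (x : ℂ) (h : Nondeg x x), p.1 = ptV x ∧ diag p.1 = smoothDiagram x x h) ∨
    (∃ b, p.1 = ptV (cuspX b : P1) ∧ diag p.1 = diagramCusp b) ∨
    (∃ (u : ℂ) (h : GoodU u), p.1 = ptE u ∧ diag p.1 = diagramU u h) ∨
    (∃ (w : ℂ) (h : GoodW w), p.1 = ptQ w ∧ diag p.1 = diagramW w h) ∨
    (p.1 = ptQ ((0 : ℂ) : P1) ∧ diag p.1 = diagramCorner) := by
  rcases mem_XSet_iff.1 p.2 with ⟨x, rfl | rfl | h, e⟩ | ⟨u, h, e⟩ | ⟨w, h1, h2, e⟩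
  · exact Or.inr (Or.inl ⟨false, e, by rw [e]; exact diag_cusp false⟩)
  · exact Or.inr (Or.inl ⟨true, e, by rw [e]; exact diag_cusp true⟩)
  · exact Or.inl ⟨x, h, e, by rw [e, diag_ptV h]⟩
  · exact Or.inr (Or.inr (Or.inl ⟨u, h, e, by rw [e, diag_ptE h]⟩))
  · by_cases h0 : w = 0
    · subst h0
      exact Or.inr (Or.inr (Or.inr (Or.inr ⟨e, by rw [e, diag_corner]⟩)))
    · exact Or.inr (Or.inr (Or.inr (Or.inl ⟨w, ⟨h0, h1, h2⟩, e, by rw [e, diag_ptQ ⟨h0, h1, h2⟩]⟩)))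

theorem diag_mem_AV (p : XSet) : (⟦diag p.1⟧ : AMf) ∈ AV := by
  rcases XSet_cases p with ⟨x, h, -, e⟩ | ⟨b, -, e⟩ | ⟨u, h, -, e⟩ | ⟨w, h, -, e⟩ | ⟨-, e⟩ <;> rw [e]
  exacts [smoothDiagram_mem_AV h, diagramCusp_mem_AV b, diagramU_mem_AV h, diagramW_mem_AV h,
    diagramCorner_mem_AV]

/-- The embedding `ξ : X → 𝒜𝒱`. -/
def xi (p : XSet) : AV := ⟨⟦diag p.1⟧, diag_mem_AV p⟩

/-! ### Regularity of `ξ` -/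

/-- In each of the five cases the neighbourhood is shrunk by avoiding single values of coordinates
until only the strata adjacent to `p` remain; then the lemma for the corresponding sections applies.
-/
theorem regPt_coord_xi (p : XSet) (i : AMf.Index) :
    RegPt (fun p : XSet => p.1) p fun q => AMf.coord ⟦diag q.1⟧ i := by
  have hne : ∀ (j : Fin 5) (a : P1), p.1 j ≠ a →
      ∀ᶠ q in nearby (fun p : XSet => p.1) p, q.1 j ≠ a :=
    fun j a h => (tendsto_nearby (c := fun p : XSet => p.1) (p := p) j).eventually_ne h
  rcases XSet_cases p with ⟨x₀, h₀, hp, hD⟩ | ⟨b, hp, hD⟩ | ⟨u₀, h₀, hp, hD⟩ | ⟨w₀, h₀, hp, hD⟩ |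
    ⟨hp, hD⟩
  · have hX : ∀ (q : XSet) (x : ℂ), q.1 = ptV x →
        ev q (Reg.coord 0 : Reg (fun p : XSet => p.1) p) = x := by
      intro q x hq
      rw [ev_coord, hp, hq]
      exact loc_coe x₀ x
    have hinv : ev p (Reg.coord 0 - 1 : Reg (fun p : XSet => p.1) p) ≠ 0 := by
      rw [map_sub, map_one, hX p x₀ hp]
      exact sub_ne_zero.2 h₀.x1
    refine regPt_smooth (fun q : XSet => diag q.1) (Reg.coord 0)
      ((2 * Reg.coord 0 - 1) * Reg.inv (Reg.coord 0 - 1) hinv) ?_ i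
    filter_upwards [hne 0 ∞ (by rw [hp]; simp [ptV]), hne 0 ((0 : ℂ) : P1) (by rw [hp]; simp [ptV, h₀.x0]),
      hne 0 ((1 : ℂ) : P1) (by rw [hp]; simp [ptV, h₀.x1])] with q h1 h2 h3
    rcases XSet_cases q with ⟨x, h, hq, hD⟩ | ⟨b, hq, hD⟩ | ⟨u, h, hq, hD⟩ | ⟨w, h, hq, hD⟩ | ⟨hq, hD⟩
    · simp only [map_mul, map_sub, map_one, map_ofNat, ev_inv, hX q x hq]
      exact ⟨h, hD, by rw [rPar_self]; rfl⟩
    · exfalso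
      rw [hq] at h2 h3
      cases b
      exacts [h2 rfl, h3 rfl]
    all_goals
      rw [hq] at h1
      exact absurd rfl h1
  · have hX : ∀ (q : XSet) (x : ℂ), q.1 = ptV x →
        ev q (Reg.coord 0 : Reg (fun p : XSet => p.1) p) = x := by
      intro q x hq
      rw [ev_coord, hp, hq]
      exact loc_coe _ x
    obtain ⟨r, hr⟩ : ∃ r : Reg (fun p : XSet => p.1) p,
        ∀ (q : XSet) (x : ℂ), q.1 = ptV x → ev q r = cuspPar b x := by
      cases b
      · have hinv : ev p (Reg.coord 0 - 1 : Reg (fun p : XSet => p.1) p) ≠ 0 := by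
          rw [map_sub, map_one, hX p _ hp]
          simp [cuspX]
        refine ⟨(2 * Reg.coord 0 - 1) * Reg.inv (Reg.coord 0 - 1) hinv, fun q x hq => ?_⟩
        simp only [map_mul, map_sub, map_one, map_ofNat, ev_inv, hX q x hq]
        rfl
      · have hinv : ev p (2 * Reg.coord 0 - 1 : Reg (fun p : XSet => p.1) p) ≠ 0 := by
          rw [map_sub, map_one, map_mul, map_ofNat, hX p _ hp]
          norm_num [cuspX]
        refine ⟨(Reg.coord 0 - 1) * Reg.inv (2 * Reg.coord 0 - 1) hinv, fun q x hq => ?_⟩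
        simp only [map_mul, map_sub, map_one, map_ofNat, ev_inv, hX q x hq]
        rfl
    have hR : cuspPar b (cuspX b) = cuspR b := by
      cases b <;> simp [cuspPar, cuspX, cuspR]
    refine regPt_diagramCusp (fun q : XSet => diag q.1) b (Reg.coord 0) r hD (hX p _ hp)
      ((hr p _ hp).trans hR) ?_ i
    have hb : p.1 0 ≠ (cuspX (!b) : P1) := by
      rw [hp]
      cases b <;> simp [ptV, cuspX]
    filter_upwards [hne 0 ∞ (by rw [hp]; simp [ptV]), hne 0 _ hb] with q h1 h2
    rcases XSet_cases q with ⟨x, h, hq, hD⟩ | ⟨b', hq, hDq⟩ | ⟨u, h, hq, hD⟩ | ⟨w, h, hq, hD⟩ | ⟨hq, hD⟩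
    · left
      rw [hX q x hq]
      exact ⟨h, hD, hr q x hq⟩
    · right
      obtain rfl : b' = b := by
        by_contra hb
        apply h2
        rw [Bool.eq_not_of_ne hb] at hq
        rw [hq]
        rfl
      exact ⟨hDq, hX q _ hq, (hr q _ hq).trans hR⟩
    all_goals
      rw [hq] at h1
      exact absurd rfl h1
  · have hs : ∀ q : XSet, ev q (Reg.coord 0 : Reg (fun p : XSet => p.1) p) = loc ∞ (q.1 0) := by
      intro q
      rw [ev_coord, hp]
      rfl
    have hu : ∀ q : XSet, ev q (Reg.coord 2 : Reg (fun p : XSet => p.1) p) = aff (q.1 2) := by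
      intro q
      rw [ev_coord, hp]
      exact loc_coe _ _
    have hinv : ev p (1 - Reg.coord 0 : Reg (fun p : XSet => p.1) p) ≠ 0 := by
      rw [map_sub, map_one, hs, hp]
      change 1 - loc ∞ ∞ ≠ 0
      simp [loc_infty_infty]
    have hE : ∀ (q : XSet) (u : ℂ), q.1 = ptE u →
        ev q (Reg.coord 0 : Reg (fun p : XSet => p.1) p) = 0 ∧
        ev q (Reg.coord 2 : Reg (fun p : XSet => p.1) p) = u ∧
        ev q ((1 + Reg.coord 2 - Reg.coord 0) * Reg.inv (1 - Reg.coord 0) hinv :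
          Reg (fun p : XSet => p.1) p) = u + 1 := by
      intro q u hq
      have e1 : ev q (Reg.coord 0 : Reg (fun p : XSet => p.1) p) = 0 := by
        rw [hs, hq]; exact loc_infty_infty
      have e2 : ev q (Reg.coord 2 : Reg (fun p : XSet => p.1) p) = u := by
        rw [hu, hq]; rfl
      refine ⟨e1, e2, ?_⟩
      simp only [map_mul, map_sub, map_add, map_one, ev_inv, e1, e2]
      ring
    -- With s = 1/x the third parameter is r = (1 + u - s)/(1 - s). On the diagonal, where u = 1, it
    -- equals (2x - 1)/(x - 1); on `E_∞`, where s = 0, it equals u + 1. This covers the crossing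
    -- point u = 1 together with the rest of `E_∞`.
    refine regPt_diagramU (fun q : XSet => diag q.1) _ _ _ h₀ hD (hE p u₀ hp).1 (hE p u₀ hp).2.1
      (hE p u₀ hp).2.2 ?_ i
    filter_upwards [hne 2 ∞ (by rw [hp]; simp [ptE]), hne 0 ((0 : ℂ) : P1) (by rw [hp]; simp [ptE]),
      hne 0 ((1 : ℂ) : P1) (by rw [hp]; simp [ptE])] with q h1 h2 h3
    rcases XSet_cases q with ⟨x, h, hq, hD⟩ | ⟨b, hq, hD⟩ | ⟨u, h, hq, hD⟩ | ⟨w, h, hq, hD⟩ | ⟨hq, hD⟩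
    · left
      have e1 : ev q (Reg.coord 0 : Reg (fun p : XSet => p.1) p) = x⁻¹ := by
        rw [hs, hq]; exact loc_infty_coe x
      have e2 : ev q (Reg.coord 2 : Reg (fun p : XSet => p.1) p) = 1 := by
        rw [hu, hq]; rfl
      refine ⟨x, h, hD, e1, e2, ?_⟩
      simp only [map_mul, map_sub, map_add, map_one, ev_inv, e1, e2]
      have hx0 := h.x0
      have hx1 := sub_ne_zero.2 h.x1
      rw [rPar_self]
      field_simp
      ring
    · exfalso
      rw [hq] at h2 h3
      cases b
      exacts [h2 rfl, h3 rfl]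
    · right
      exact ⟨u, h, hD, hE q u hq⟩
    all_goals
      rw [hq] at h1
      exact absurd rfl h1
  · have hw : ∀ q : XSet, ev q (Reg.coord 4 : Reg (fun p : XSet => p.1) p) = aff (q.1 4) := by
      intro q
      rw [ev_coord, hp]
      exact loc_coe _ _
    refine regPt_diagramW (fun q : XSet => diag q.1) (Reg.coord 4) ?_ i
    -- The coordinate w vanishes on the diagonal, on `E_∞` and at the corner, so only `E_q` is left.
    filter_upwards [hne 4 ((0 : ℂ) : P1) (by rw [hp]; simp [ptQ, h₀.w0])] with q h1
    rcases XSet_cases q with ⟨x, h, hq, hD⟩ | ⟨b, hq, hD⟩ | ⟨u, h, hq, hD⟩ | ⟨w, h, hq, hD⟩ | ⟨hq, hD⟩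
    · rw [hq] at h1
      exact absurd rfl h1
    · rw [hq] at h1
      exact absurd rfl h1
    · rw [hq] at h1
      exact absurd rfl h1
    · have e : ev q (Reg.coord 4 : Reg (fun p : XSet => p.1) p) = w := by
        rw [hw, hq]; rfl
      rw [e]
      exact ⟨h, hD⟩
    · rw [hq] at h1
      exact absurd rfl h1
  · have hk : ∀ q : XSet, ev q (Reg.coord 2 : Reg (fun p : XSet => p.1) p) = loc ∞ (q.1 2) := by
      intro q
      rw [ev_coord, hp]
      rfl
    have hw : ∀ q : XSet, ev q (Reg.coord 4 : Reg (fun p : XSet => p.1) p) = aff (q.1 4) := by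
      intro q
      rw [ev_coord, hp]
      exact loc_coe _ _
    have hQ : ∀ (q : XSet) (w : ℂ), q.1 = ptQ w →
        ev q (Reg.coord 4 : Reg (fun p : XSet => p.1) p) = w ∧
        ev q (Reg.coord 2 : Reg (fun p : XSet => p.1) p) = 0 := by
      intro q w hq
      rw [hw, hk, hq]
      exact ⟨rfl, loc_infty_infty⟩
    refine regPt_diagramCorner (fun q : XSet => diag q.1) _ _ hD (hQ p 0 hp).2 (hQ p 0 hp).1 ?_ i
    -- The coordinate u equals 1 on the whole diagonal, which is thereby excluded near the corner.
    filter_upwards [hne 2 ((1 : ℂ) : P1) (by rw [hp]; simp [ptQ])] with q h1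
    rcases XSet_cases q with ⟨x, h, hq, hD⟩ | ⟨b, hq, hD⟩ | ⟨u, h, hq, hD⟩ | ⟨w, h, hq, hD⟩ | ⟨hq, hD⟩
    · rw [hq] at h1
      exact absurd rfl h1
    · rw [hq] at h1
      exact absurd rfl h1
    · right; left
      refine ⟨u, h, hD, ?_, ?_⟩
      · rw [hw, hq]; rfl
      · rw [hk, hq]; exact loc_infty_coe u
    · left
      rw [(hQ q w hq).1]
      exact ⟨h, hD, (hQ q w hq).2⟩
    · right; right
      exact ⟨hD, hQ q 0 hq⟩

/-! ### The cross ratios that recover the coordinates of `X` -/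

/-- The coordinates of the image of `ξ`. -/
def xiCoord (q : XSet) : AMf.Index → P1 := AMf.coord ⟦diag q.1⟧

theorem xiCoord_x (q : XSet) : xiCoord q (Sum.inl (.zero, .inf, .one, .x)) = q.1 0 := by
  unfold xiCoord
  rcases XSet_cases q with ⟨x, h, hq, hD⟩ | ⟨b, hq, hD⟩ | ⟨u, h, hq, hD⟩ | ⟨w, h, hq, hD⟩ | ⟨hq, hD⟩ <;>
    rw [hD, hq]
  · change (smoothCurve (upMark x x) (upMark_inj h)).cross _ _ _ _ = (x : P1)
    rw [smooth_cross _ (by simp) (by simp) (by simp)]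
    simp [upMark, crossRatio_infty_mid, ratio]
  · change (upperCusp.relabel (swapLP b) (swapLP_injective b)).curve.cross _ _ _ _ = (cuspX b : P1)
    cases b
    · rw [table_cross _ 1] <;>
        simp [CurveTable.proj, CurveTable.relabel, upperCusp, swapLP, crossRatio, bracket, ratio, cuspX]
    · rw [table_cross _ 0] <;>
        simp [CurveTable.proj, CurveTable.relabel, upperCusp, swapLP, crossRatio, bracket, ratio, cuspX] <;>
        norm_num
  · change (upperU u h).curve.cross _ _ _ _ = ∞
    have h1 := h.u1
    rw [table_cross _ 0] <;> simp [CurveTable.proj, upperU, crossRatio, bracket, ratio]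
    intro e
    exact h1 (by linear_combination -e / 2)
  · change (upperW w h).curve.cross _ _ _ _ = ∞
    rw [table_cross _ 1] <;> simp [CurveTable.proj, upperW, crossRatio, bracket, ratio]
  · change upperCorner.curve.cross _ _ _ _ = ∞
    rw [table_cross _ 1] <;> simp [CurveTable.proj, upperCorner, crossRatio, bracket, ratio]

theorem xiCoord_y (q : XSet) : xiCoord q (Sum.inr (.zero, .inf, .one, .y)) = q.1 1 := by
  unfold xiCoord
  rcases XSet_cases q with ⟨x, h, hq, hD⟩ | ⟨b, hq, hD⟩ | ⟨u, h, hq, hD⟩ | ⟨w, h, hq, hD⟩ | ⟨hq, hD⟩ <;>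
    rw [hD, hq]
  · change (smoothCurve (lowMark x x) h.lowMark_inj).cross _ _ _ _ = (x : P1)
    rw [smooth_cross _ (by simp) (by simp) (by simp)]
    simp [lowMark, crossRatio_infty_mid, ratio]
  · change (lowerCusp.relabel (swapLB b) (swapLB_injective b)).curve.cross _ _ _ _ = (cuspX b : P1)
    cases b
    · rw [table_cross _ 1] <;>
        simp [CurveTable.proj, CurveTable.relabel, lowerCusp, swapLB, crossRatio, bracket, ratio, cuspX]
    · rw [table_cross _ 1] <;>
        simp [CurveTable.proj, CurveTable.relabel, lowerCusp, swapLB, crossRatio, bracket, ratio, cuspX]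
  · change (lowerU u h).curve.cross _ _ _ _ = ∞
    rw [table_cross _ 1] <;> simp [CurveTable.proj, lowerU, crossRatio, bracket, ratio]
  · change (lowerW w h).curve.cross _ _ _ _ = ∞
    have h0 := h.w0
    rw [table_cross _ 0] <;> simp [CurveTable.proj, lowerW, crossRatio, bracket, ratio]
    intro e
    exact h0 (by linear_combination -e / 4)
  · change lowerCorner.curve.cross _ _ _ _ = ∞
    rw [table_cross _ 2] <;> simp [CurveTable.proj, lowerCorner, crossRatio, bracket, ratio]

/-- The cross ratios r and r/x are the ones that see the exceptional curves: the first becomes u + 1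
along `E_∞`, the second becomes w along `E_q`. -/
theorem smooth_cross_r {x : ℂ} (h : Nondeg x x) :
    AMf.coord ⟦smoothDiagram x x h⟧ (Sum.inl (.zero, .inf, .one, .x')) = (rPar x x : P1) := by
  change (smoothCurve (upMark x x) (upMark_inj h)).cross _ _ _ _ = _
  rw [smooth_cross _ (by simp) (by simp) (by simp)]
  simp [upMark, crossRatio_infty_mid, ratio]

theorem smooth_cross_v {x : ℂ} (h : Nondeg x x) :
    AMf.coord ⟦smoothDiagram x x h⟧ (Sum.inl (.zero, .inf, .x, .x')) = ((rPar x x / x : ℂ) : P1) := by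
  change (smoothCurve (upMark x x) (upMark_inj h)).cross _ _ _ _ = _
  rw [smooth_cross _ (by simp) (by simp) (by simp)]
  simp [upMark, crossRatio_infty_mid, ratio, h.x0]

theorem diagramU_cross_r {u : ℂ} (h : GoodU u) :
    AMf.coord ⟦diagramU u h⟧ (Sum.inl (.zero, .inf, .one, .x')) = ((u + 1 : ℂ) : P1) := by
  change (upperU u h).curve.cross _ _ _ _ = _
  have h1 := h.u1
  rw [table_cross _ 0] <;> simp [CurveTable.proj, upperU, crossRatio_infty_left]
  · rw [ratio_of_ne (by norm_num)]
    congr 1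
    ring
  · intro e
    exact h1 (by linear_combination -e / 2)

theorem diagramU_cross_v {u : ℂ} (h : GoodU u) :
    AMf.coord ⟦diagramU u h⟧ (Sum.inl (.zero, .inf, .x, .x')) = ((0 : ℂ) : P1) := by
  change (upperU u h).curve.cross _ _ _ _ = _
  rw [table_cross _ 1] <;> simp [CurveTable.proj, upperU, crossRatio_infty_left_right]

theorem diagramW_cross_r {w : ℂ} (h : GoodW w) :
    AMf.coord ⟦diagramW w h⟧ (Sum.inl (.zero, .inf, .one, .x')) = ∞ := by
  change (upperW w h).curve.cross _ _ _ _ = _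
  rw [table_cross _ 1] <;> simp [CurveTable.proj, upperW, crossRatio_infty_left]

theorem diagramW_cross_v {w : ℂ} (h : GoodW w) :
    AMf.coord ⟦diagramW w h⟧ (Sum.inl (.zero, .inf, .x, .x')) = (w : P1) := by
  change (upperW w h).curve.cross _ _ _ _ = _
  have h0 := h.w0
  rw [table_cross _ 0] <;> simp [CurveTable.proj, upperW, crossRatio_infty_left]
  · rw [ratio_of_ne (by ring_nf; norm_num)]
    congr 1
    rw [div_eq_iff (by ring_nf; norm_num)]
    ring
  · intro e
    exact h0 (by linear_combination -e / 2)

theorem diagramCorner_cross_r :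
    AMf.coord ⟦diagramCorner⟧ (Sum.inl (.zero, .inf, .one, .x')) = ∞ := by
  change upperCorner.curve.cross _ _ _ _ = _
  rw [table_cross _ 1] <;> simp [CurveTable.proj, upperCorner, crossRatio_infty_left]

theorem diagramCorner_cross_v :
    AMf.coord ⟦diagramCorner⟧ (Sum.inl (.zero, .inf, .x, .x')) = ((0 : ℂ) : P1) := by
  change upperCorner.curve.cross _ _ _ _ = _
  rw [table_cross _ 2] <;> simp [CurveTable.proj, upperCorner, crossRatio_infty_left_right]

theorem diagramU_cross_z {u : ℂ} (h : GoodU u) :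
    AMf.coord ⟦diagramU u h⟧ (Sum.inr (.zero, .inf, .y, .z)) = ((-1 / (4 * u * (1 + u)) : ℂ) : P1) := by
  change (lowerU u h).curve.cross _ _ _ _ = _
  have h0 := h.u0
  have h1 : 1 + u ≠ 0 := fun e => h.u1 (by linear_combination e)
  have h2 : 1 - (2 * u + 1) ^ 2 ≠ 0 := by
    have : -(4 * u * (1 + u)) ≠ 0 := by simp [h0, h1]
    exact fun e => this (by linear_combination e)
  rw [table_cross _ 0] <;> simp [CurveTable.proj, lowerU, crossRatio_infty_mid]
  · rw [ratio_of_ne h2]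
    congr 1
    rw [div_eq_div_iff h2 (by simp [h0, h1])]
    ring
  · exact fun e => h2 (by linear_combination e)

theorem diagramW_cross_z {w : ℂ} (h : GoodW w) :
    AMf.coord ⟦diagramW w h⟧ (Sum.inr (.zero, .inf, .one, .z)) =
      ((-(1 - w) ^ 2 / (4 * w) : ℂ) : P1) := by
  change (lowerW w h).curve.cross _ _ _ _ = _
  have h0 := h.w0
  have h2 : (1 - w) ^ 2 - (1 + w) ^ 2 ≠ 0 := by
    have : -(4 * w) ≠ 0 := by simp [h0]
    exact fun e => this (by linear_combination e)
  rw [table_cross _ 0] <;> simp [CurveTable.proj, lowerW, crossRatio_infty_mid]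
  · rw [ratio_of_ne h2]
    congr 1
    rw [div_eq_div_iff h2 (by simp [h0])]
    ring
  · exact fun e => h2 (by linear_combination e)

/-! ### Regularity of the inverse of `ξ` -/

/-- The points of `X` over finite points are those of the diagonal. -/
theorem eq_ptV_of_ne_infty {q : XSet} (h : q.1 0 ≠ ∞) : q.1 = ptV (q.1 0) := by
  rcases XSet_cases q with ⟨x, _, hq, _⟩ | ⟨b, hq, _⟩ | ⟨u, _, hq, _⟩ | ⟨w, _, hq, _⟩ | ⟨hq, _⟩
  · rw [hq]; rfl
  · rw [hq]; rfl
  all_goals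
    rw [hq] at h
    exact absurd rfl h

theorem eventually_xiCoord_ne {p : XSet} {a : P1} (h : p.1 0 ≠ a) :
    ∀ᶠ q in nearby xiCoord p, q.1 0 ≠ a := by
  have := tendsto_nearby (c := xiCoord) (p := p) (Sum.inl (.zero, .inf, .one, .x))
  simp only [xiCoord_x] at this
  exact this.eventually_ne h

/-- The coordinates `u`, `t` and `w` at the points of `X` near infinity, in terms of the inverse `s`
of `x` and of the cross ratios `r = [0, ∞; 1, x']` and `v = [0, ∞; x, x']`. -/
theorem coord_eq_of_ne {q : XSet} (h0 : q.1 0 ≠ ((0 : ℂ) : P1)) (h1 : q.1 0 ≠ ((1 : ℂ) : P1))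
    {s r₀ r₁ v₀ v₁ : ℂ} (hs : loc ∞ (q.1 0) = s) (hs1 : 1 - s ≠ 0)
    (hr : xiCoord q (Sum.inl (.zero, .inf, .one, .x')) = ratio r₀ r₁) (hr' : r₀ ≠ 0 ∨ r₁ ≠ 0)
    (hv : xiCoord q (Sum.inl (.zero, .inf, .x, .x')) = ratio v₀ v₁) (hv' : v₀ ≠ 0 ∨ v₁ ≠ 0) :
    q.1 2 = ratio ((r₀ - r₁) * (1 - s)) r₁ ∧ q.1 3 = q.1 2 ∧
      q.1 4 = ratio (v₀ * (1 - s) - v₁ * (2 * s - s ^ 2)) (v₁ * (1 - s)) := by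
  -- From r = 1 + y/(x - 1) one gets u = y/x = (r - 1)(1 - s), and from v = r/x = (x + y - 1)/(x(x -
  -- 1)) one gets w = v - (2s - s²)/(1 - s). These identities persist at infinity; in homogeneous
  -- form they make sense for infinite r and v.
  have hu' : (r₀ - r₁) * (1 - s) ≠ 0 ∨ r₁ ≠ 0 := by
    by_cases h : r₁ = 0
    · rw [h] at hr' ⊢
      left
      simpa [hs1] using hr'
    · exact Or.inr h
  have hw' : v₀ * (1 - s) - v₁ * (2 * s - s ^ 2) ≠ 0 ∨ v₁ * (1 - s) ≠ 0 := by
    by_cases h : v₁ = 0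
    · rw [h] at hv' ⊢
      left
      simpa [hs1] using hv'
    · exact Or.inr (mul_ne_zero h hs1)
  unfold xiCoord at hr hv
  rcases XSet_cases q with ⟨x, h, hq, hD⟩ | ⟨b, hq, hD⟩ | ⟨u, h, hq, hD⟩ | ⟨w, h, hq, hD⟩ | ⟨hq, hD⟩ <;>
    rw [hD] at hr hv
  · rw [smooth_cross_r, eq_comm, ratio_eq_coe_iff hr'] at hr
    rw [smooth_cross_v, eq_comm, ratio_eq_coe_iff hv'] at hv
    have hx0 := h.x0
    have hx1 := sub_ne_zero.2 h.x1
    rw [hq] at hs ⊢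
    have hs' : x⁻¹ = s := (loc_infty_coe x).symm.trans hs
    rw [rPar_self] at hr hv
    refine ⟨?_, rfl, ?_⟩
    · refine (show _ = ((1 : ℂ) : P1) from (ratio_eq_coe_iff hu').2 ?_).symm
      rw [hr, ← hs']
      field_simp
      ring
    · refine (show _ = ((0 : ℂ) : P1) from (ratio_eq_coe_iff hw').2 ?_).symm
      rw [hv, ← hs']
      field_simp
      ring
  · exfalso
    rw [hq] at h0 h1
    cases b
    exacts [h0 rfl, h1 rfl]
  · rw [diagramU_cross_r, eq_comm, ratio_eq_coe_iff hr'] at hr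
    rw [diagramU_cross_v, eq_comm, ratio_eq_coe_iff hv'] at hv
    rw [hq] at hs ⊢
    have hs' : s = 0 := hs.symm.trans loc_infty_infty
    subst hs'
    refine ⟨?_, rfl, ?_⟩
    · refine (show _ = (u : P1) from (ratio_eq_coe_iff hu').2 ?_).symm
      rw [hr]
      ring
    · refine (show _ = ((0 : ℂ) : P1) from (ratio_eq_coe_iff hw').2 ?_).symm
      rw [hv]
      ring
  · have e : r₁ = 0 := by
      by_contra hne
      rw [diagramW_cross_r, ratio_of_ne hne] at hr
      exact infty_ne_coe _ hr
    rw [diagramW_cross_v, eq_comm, ratio_eq_coe_iff hv'] at hv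
    rw [hq] at hs ⊢
    have hs' : s = 0 := hs.symm.trans loc_infty_infty
    subst hs'
    refine ⟨?_, rfl, ?_⟩
    · rw [e, ratio_zero_right]
      rfl
    · refine (show _ = (w : P1) from (ratio_eq_coe_iff hw').2 ?_).symm
      rw [hv]
      ring
  · have e : r₁ = 0 := by
      by_contra hne
      rw [diagramCorner_cross_r, ratio_of_ne hne] at hr
      exact infty_ne_coe _ hr
    rw [diagramCorner_cross_v, eq_comm, ratio_eq_coe_iff hv'] at hv
    rw [hq] at hs ⊢
    have hs' : s = 0 := hs.symm.trans loc_infty_infty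
    subst hs'
    refine ⟨?_, rfl, ?_⟩
    · rw [e, ratio_zero_right]
      rfl
    · refine (show _ = ((0 : ℂ) : P1) from (ratio_eq_coe_iff hw').2 ?_).symm
      rw [hv]
      ring

/-- Near a point with finite x only the diagonal is present, on which u, t, w are constant. Near a
point with x = ∞ the formulas of `coord_eq_of_ne` apply, and t agrees with u there. -/
theorem regPt_inverse (p : XSet) (i : Fin 5) : RegPt xiCoord p fun q => q.1 i := by
  have hx : RegPt xiCoord p fun q => q.1 0 := by
    simpa only [xiCoord_x] using regPt_coord (c := xiCoord) (p := p) (Sum.inl (.zero, .inf, .one, .x))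
  have hy : RegPt xiCoord p fun q => q.1 1 := by
    simpa only [xiCoord_y] using regPt_coord (c := xiCoord) (p := p) (Sum.inr (.zero, .inf, .one, .y))
  by_cases hp : p.1 0 = ∞
  · let s : Reg xiCoord p := Reg.coord (Sum.inl (.zero, .inf, .one, .x))
    let r₀ : Reg xiCoord p := Reg.coord0 (Sum.inl (.zero, .inf, .one, .x'))
    let r₁ : Reg xiCoord p := Reg.coord1 (Sum.inl (.zero, .inf, .one, .x'))
    let v₀ : Reg xiCoord p := Reg.coord0 (Sum.inl (.zero, .inf, .x, .x'))
    let v₁ : Reg xiCoord p := Reg.coord1 (Sum.inl (.zero, .inf, .x, .x'))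
    have hs : ∀ q, loc ∞ (q.1 0) = ev q s := by
      intro q
      rw [ev_coord, xiCoord_x, xiCoord_x, hp]
    have hs0 : ev p s = 0 := by rw [← hs, hp, loc_infty_infty]
    have hs1 : ev p (1 - s) ≠ 0 := by rw [map_sub, map_one, hs0]; simp
    have hr' : ∀ q, ev q r₀ ≠ 0 ∨ ev q r₁ ≠ 0 := fun q => lift_ne_zero _ _
    have hv' : ∀ q, ev q v₀ ≠ 0 ∨ ev q v₁ ≠ 0 := fun q => lift_ne_zero _ _
    have key : ∀ᶠ q in nearby xiCoord p,
        q.1 2 = ratio ((ev q r₀ - ev q r₁) * (1 - ev q s)) (ev q r₁) ∧ q.1 3 = q.1 2 ∧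
        q.1 4 = ratio (ev q v₀ * (1 - ev q s) - ev q v₁ * (2 * ev q s - ev q s ^ 2))
          (ev q v₁ * (1 - ev q s)) := by
      filter_upwards [eventually_xiCoord_ne (p := p) (a := ((0 : ℂ) : P1)) (by rw [hp]; simp),
        eventually_xiCoord_ne (p := p) (a := ((1 : ℂ) : P1)) (by rw [hp]; simp), eventually_ev_ne hs1,
        eventually_coord_eq (c := xiCoord) (p := p) (Sum.inl (.zero, .inf, .one, .x')),
        eventually_coord_eq (c := xiCoord) (p := p) (Sum.inl (.zero, .inf, .x, .x'))] with q h0 h1 h2 h3 h4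
      rw [map_sub, map_one] at h2
      exact coord_eq_of_ne h0 h1 (hs q) h2 h3 (hr' q) h4 (hv' q)
    have hu : RegPt xiCoord p fun q => q.1 2 := by
      refine regPt_of_ratio ((r₀ - r₁) * (1 - s)) r₁ ?_ ?_
      · by_cases h : ev p r₁ = 0
        · left
          have := hr' p
          rw [h] at this
          rw [map_mul, map_sub, h]
          exact mul_ne_zero (by simpa using this) hs1
        · exact Or.inr h
      · filter_upwards [key] with q hq
        simpa only [map_mul, map_sub, map_one] using hq.1
    fin_cases i
    · exact hx
    · exact hy
    · exact hu
    · exact hu.congr (key.mono fun q hq => hq.2.1)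
    · refine regPt_of_ratio (v₀ * (1 - s) - v₁ * (2 * s - s ^ 2)) (v₁ * (1 - s)) ?_ ?_
      · by_cases h : ev p v₁ = 0
        · left
          have := hv' p
          rw [h] at this
          rw [map_sub, map_mul, map_mul, h, zero_mul, sub_zero]
          exact mul_ne_zero (by simpa using this) hs1
        · right
          rw [map_mul]
          exact mul_ne_zero h hs1
      · filter_upwards [key] with q hq
        simp only [map_mul, map_sub, map_one, map_pow, map_ofNat]
        exact hq.2.2
  · have hV := (eventually_xiCoord_ne hp).mono fun q => eq_ptV_of_ne_infty (q := q)
    fin_cases i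
    · exact hx
    · exact hy
    · exact (regPt_const _).congr (hV.mono fun q hq => congrFun hq 2)
    · exact (regPt_const _).congr (hV.mono fun q hq => congrFun hq 3)
    · exact (regPt_const _).congr (hV.mono fun q hq => congrFun hq 4)

/-! ### The embeddings -/

theorem nhds_eq_nearby (p : XSet) : 𝓝 p = nearby (fun p : XSet => p.1) p := nhds_induced _ _

/-- Each family of coordinates is regular, hence continuous, in terms of the other. -/
theorem nearby_eq (p : XSet) : nearby (fun p : XSet => p.1) p = nearby xiCoord p := by
  refine le_antisymm (tendsto_iff_comap.1 ?_) (tendsto_iff_comap.1 ?_)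
  · exact tendsto_pi_nhds.2 fun i => (regPt_coord_xi p i).tendsto
  · exact tendsto_pi_nhds.2 fun i => (regPt_inverse p i).tendsto

/-- By `nearby_eq` the topology of X is induced by the cross ratios, so ξ is inducing. Injectivity
is then automatic because X is a T₀ space. -/
theorem isEmbedding_xi : IsEmbedding xi := by
  refine IsInducing.isEmbedding (isInducing_iff_nhds.2 fun p => ?_)
  rw [nhds_eq_nearby, nearby_eq, nhds_subtype_eq_comap, comap_comap]
  have : 𝓝 ((xi p).1) = comap AMf.coord (𝓝 (AMf.coord (xi p).1)) := nhds_induced _ _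
  rw [this, comap_comap]
  rfl

theorem isAlgEmbedding_xi :
    IsAlgEmbedding (fun p : XSet => p.1) (fun α : AV => AMf.coord α.1) xi := by
  refine ⟨isEmbedding_xi, fun j => ?_, fun i => ?_⟩
  · exact isRegular_of_regPt (fun p => (nhds_eq_nearby p).le) fun p => regPt_coord_xi p j
  · exact isRegular_of_regPt (c := xiCoord) (fun p => ((nhds_eq_nearby p).trans (nearby_eq p)).le)
      fun p => regPt_inverse p i

theorem VSet_eq (v : VSet) : ∃ x : ℂ, Nondeg x x ∧ v.1 = ((x : P1), (x : P1)) := by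
  obtain ⟨⟨a, b⟩, hM, hab⟩ := v
  obtain rfl : a = b := hab
  have hn := Mf.nondeg hM
  have hL : ((a, a) : P1 × P1) ∉ LSet := fun h => hM (Or.inl h)
  simp only [LSet, Set.mem_ofPred_eq, not_or] at hL
  obtain ⟨x, rfl⟩ := ne_infty_iff_exists.1 hL.2.2.2.2.1
  exact ⟨x, hn, rfl⟩

/-- The embedding `ν : 𝒱 → X`. -/
def nu (v : VSet) : XSet :=
  ⟨![v.1.1, v.1.2, ((1 : ℂ) : P1), ((1 : ℂ) : P1), ((0 : ℂ) : P1)], by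
    obtain ⟨x, h, e⟩ := VSet_eq v
    rw [e]
    exact mem_XSet_iff.2 (Or.inl ⟨x, Or.inr (Or.inr h), rfl⟩)⟩

theorem isEmbedding_nu : IsEmbedding nu := by
  refine IsEmbedding.of_comp (g := fun p : XSet => sigma p.1) ?_ ?_ IsEmbedding.subtypeVal
  · refine Continuous.subtype_mk (continuous_pi fun i => ?_) _
    fin_cases i <;> simp <;> fun_prop
  · exact ((continuous_apply 0).comp continuous_subtype_val).prodMk
      ((continuous_apply 1).comp continuous_subtype_val)

theorem xi_nu (v : VSet) : (xi (nu v)).1 = VSet.toAMf v :=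
  congrArg (Quotient.mk Diagram.setoid) (dif_pos (Mf.nondeg v.2.1))

end PerFour
end

/-! ### The lemma on X and its embedding in `𝒜𝒱`. -/

theorem mainTheorem3 :
    IsConnected PerFour.XSet ∧
    ∃ (ν : PerFour.VSet → PerFour.XSet) (ξ : PerFour.XSet → PerFour.AV),
      Topology.IsEmbedding ν ∧ (∀ v, PerFour.sigma (ν v).1 = v.1) ∧
      PerFour.IsAlgEmbedding (fun p : PerFour.XSet => p.1) (fun α : PerFour.AV => α.1.coord) ξ ∧
      (∀ v, (ξ (ν v)).1 = PerFour.VSet.toAMf v) ∧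
      (∀ p : PerFour.XSet, p.1 ∈ PerFour.ExcInf → p.1 ∉ PerFour.ExcQ →
        (ξ p).1 ∈ PerFour.AMf.A1 ∧
        ∃ u : ℂ, p.1 2 = (u : PerFour.P1) ∧ 4 * u * (1 + u) ≠ 0 ∧
          (ξ p).1.coord (Sum.inr (.zero, .inf, .y, .z)) =
            ((-1 / (4 * u * (1 + u)) : ℂ) : PerFour.P1)) ∧
      (∀ p : PerFour.XSet, p.1 ∈ PerFour.ExcQ → p.1 ∉ PerFour.ExcInf →
        (ξ p).1 ∈ PerFour.AMf.A2 ∧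
        ∃ w : ℂ, p.1 4 = (w : PerFour.P1) ∧ w ≠ 0 ∧
          (ξ p).1.coord (Sum.inr (.zero, .inf, .one, .z)) =
            ((-(1 - w) ^ 2 / (4 * w) : ℂ) : PerFour.P1)) ∧
      (∀ p : PerFour.XSet, p.1 ∈ PerFour.ExcInf → p.1 ∈ PerFour.ExcQ → (ξ p).1 ∈ PerFour.AMf.A12) := by
  refine ⟨PerFour.isConnected_XSet, PerFour.nu, PerFour.xi, PerFour.isEmbedding_nu, fun v => rfl,
    PerFour.isAlgEmbedding_xi, PerFour.xi_nu, ?_, ?_, ?_⟩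
  · intro p hE hQ
    rw [PerFour.ExcInf_eq] at hE
    rw [PerFour.ExcQ_eq] at hQ
    obtain ⟨a, ha⟩ := hE
    -- The point u = ∞ of `E_∞` is the point w = 0 of `E_q`, which is excluded here.
    have hne : p.1 2 ≠ ∞ := by
      intro e
      rw [← ha] at e
      obtain rfl : a = ∞ := e
      exact hQ ⟨((0 : ℂ) : PerFour.P1), ha⟩
    have h0 : p.1 0 = ∞ := by rw [← ha]; rfl
    rcases PerFour.XSet_cases p with ⟨x, _, hp, _⟩ | ⟨b, hp, _⟩ | ⟨u, h, hp, hD⟩ | ⟨w, _, hp, _⟩ | ⟨hp, _⟩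
    · rw [hp] at h0
      exact absurd h0 (OnePoint.coe_ne_infty _)
    · rw [hp] at h0
      exact absurd h0 (OnePoint.coe_ne_infty _)
    · have e : (PerFour.xi p).1 = (⟦PerFour.diagramU u h⟧ : PerFour.AMf) :=
        congrArg (Quotient.mk PerFour.Diagram.setoid) hD
      have h1 : 1 + u ≠ 0 := fun e => h.u1 (by linear_combination e)
      rw [e]
      exact ⟨PerFour.diagramU_mem_A1 h, u, by rw [hp]; rfl, by simp [h.u0, h1],
        PerFour.diagramU_cross_z h⟩
    · rw [hp] at hne
      exact absurd rfl hne
    · rw [hp] at hne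
      exact absurd rfl hne
  · intro p hQ hE
    rw [PerFour.ExcInf_eq] at hE
    rw [PerFour.ExcQ_eq] at hQ
    obtain ⟨a, ha⟩ := hQ
    have h0 : p.1 2 = ∞ := by rw [← ha]; rfl
    rcases PerFour.XSet_cases p with ⟨x, _, hp, _⟩ | ⟨b, hp, _⟩ | ⟨u, _, hp, _⟩ | ⟨w, h, hp, hD⟩ | ⟨hp, _⟩
    · rw [hp] at h0
      exact absurd h0 (OnePoint.coe_ne_infty _)
    · rw [hp] at h0
      exact absurd h0 (OnePoint.coe_ne_infty _)
    · rw [hp] at h0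
      exact absurd h0 (OnePoint.coe_ne_infty _)
    · have e : (PerFour.xi p).1 = (⟦PerFour.diagramW w h⟧ : PerFour.AMf) :=
        congrArg (Quotient.mk PerFour.Diagram.setoid) hD
      rw [e]
      exact ⟨PerFour.diagramW_mem_A2 h, w, by rw [hp]; rfl, h.w0, PerFour.diagramW_cross_z h⟩
    -- The corner is also the point u = ∞ of `E_∞`.
    · exact absurd ⟨∞, hp.symm⟩ hE
  · intro p hE hQ
    rw [PerFour.ExcInf_eq] at hE
    rw [PerFour.ExcQ_eq] at hQ
    obtain ⟨a, ha⟩ := hE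
    obtain ⟨b, hb⟩ := hQ
    have h2 : p.1 2 = ∞ := by rw [← hb]; rfl
    have h4 : p.1 4 = ((0 : ℂ) : PerFour.P1) := by rw [← ha]; rfl
    rcases PerFour.XSet_cases p with ⟨x, _, hp, _⟩ | ⟨b, hp, _⟩ | ⟨u, _, hp, _⟩ | ⟨w, h, hp, _⟩ | ⟨hp, hD⟩
    · rw [hp] at h2
      exact absurd h2 (OnePoint.coe_ne_infty _)
    · rw [hp] at h2
      exact absurd h2 (OnePoint.coe_ne_infty _)
    · rw [hp] at h2
      exact absurd h2 (OnePoint.coe_ne_infty _)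
    · rw [hp] at h4
      exact absurd (OnePoint.coe_eq_coe.1 h4) h.w0
    · have e : (PerFour.xi p).1 = (⟦PerFour.diagramCorner⟧ : PerFour.AMf) :=
        congrArg (Quotient.mk PerFour.Diagram.setoid) hD
      rw [e]
      exact PerFour.diagramCorner_mem_A12
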